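/- Let $n\ge 1$ and let $\phi:(0,\infty)\to\mathbb{R}$ be $C^\infty$. Let $\Phi:\mathbb{R}^n\to[0,1]$ be smooth and radial, with $\operatorname{supp}\Phi\subseteq\{|x|\le 2\}$ and $\Phi(x)=1$ for $|x|\le 1$; put $\psi(\xi)=\Phi(\xi)-\Phi(2\xi)$. With the Fourier transform $\mathscr F$ normalized by plane waves $e^{ix\cdot\xi}$, set $\triangle_k f=\mathscr F^{-1}\psi(2^{-k}\xi)\mathscr F f$ for $k\in\mathbb{Z}$, $P_{\le 0}f=\mathscr F^{-1}\Phi(\xi)\mathscr F f$ and $e^{it\phi(\sqrt{-\Delta})}f=\mathscr F^{-1}e^{it\phi(|\xi|)}\mathscr F f$. Consider the hypotheses (H1) with exponent $m_1>0$: $|\phi'(r)|\sim r^{m_1-1}$ and, for every integer $\alpha\ge 2$, $|\phi^{(\alpha)}(r)|\lesssim_\alpha r^{m_1-\alpha}$, for $r\ge 1$; (H2) with exponent $m_2>0$: $|\phi'(r)|\sim r^{m_2-1}$ and, for every integer $\alpha\ge 2$, $|\phi^{(\alpha)}(r)|\lesssim_\alpha r^{m_2-\alpha}$, for $0<r<1$;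 (H3) with exponent $\alpha_1\in\mathbb{R}$: $|\phi''(r)|\sim r^{\alpha_1-2}$ for $r\ge 1$; (H4) with exponent $\alpha_2\in\mathbb{R}$: $|\phi''(r)|\sim r^{\alpha_2-2}$ for $0<r<1$. In the estimates below $u_0\in L^1(\mathbb{R}^n)$ and $t\in\mathbb{R}$ are arbitrary (a negative power of $|t|$ is $+\infty$ at $t=0$, and $|t|^0=1$), and the implied constants do not depend on $k,\theta,t,u_0$. (a) Let $\phi$ satisfy (H1). Then, for all integers $k\ge 0$, where for $k=0$ one assumes in addition that $\phi'$ has no zero in $[\frac12,1]$, $$\|e^{it\phi(\sqrt{-\Delta})}\triangle_k u_0\|_\infty\lesssim |t|^{-\theta}2^{k(n-m_1\theta)}\|u_0\|_1,\qquad 0\le\theta\le\tfrac{n-1}{2}.$$ If $\phi$ also satisfies (H3), then for all integers $k\ge 0$, where for $k=0$ one assumes in addition that neither $\phi'$ nor $\phi''$ has a zero in $[\frac12,1]$, $$\|e^{it\phi(\sqrt{-\Delta})}\triangle_k u_0\|_\infty\lesssim |t|^{-\frac{n-1+\theta}{2}}2^{k\left(n-\frac{m_1(n-1+\theta)}{2}-\frac{\theta(\alpha_1-m_1)}{2}\right)}\|u_0\|_1,\qquad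 0\le\theta\le 1.$$ (b) Let $\phi$ satisfy (H2). Then, for all integers $k<0$, $$\|e^{it\phi(\sqrt{-\Delta})}\triangle_k u_0\|_\infty\lesssim |t|^{-\theta}2^{k(n-m_2\theta)}\|u_0\|_1,\qquad 0\le\theta\le\tfrac{n-1}{2}.$$ If $\phi$ also satisfies (H4), then for all integers $k<0$, $$\|e^{it\phi(\sqrt{-\Delta})}\triangle_k u_0\|_\infty\lesssim |t|^{-\frac{n-1+\theta}{2}}2^{k\left(n-\frac{m_2(n-1+\theta)}{2}-\frac{\theta(\alpha_2-m_2)}{2}\right)}\|u_0\|_1,\qquad 0\le\theta\le 1.$$ (c) Let $\phi$ satisfy (H2) and let $\phi'$ have no zero in $[1,2]$. Then $$\|e^{it\phi(\sqrt{-\Delta})}P_{\le 0}u_0\|_\infty\lesssim(1+|t|)^{-\theta}\|u_0\|_1,\qquad \theta=\min\left(\tfrac{n}{m_2},\tfrac{n-1}{2}\right).$$ If moreover (H4) holds with $\alpha_2=m_2$ and $\phi''$ has no zero in $[1,2]$, then $$\|e^{it\phi(\sqrt{-\Delta})}P_{\le 0}u_0\|_\infty\lesssim(1+|t|)^{-\theta}\|u_0\|_1,\qquad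 \theta=\min\left(\tfrac{n}{m_2},\tfrac n2\right).$$ -/

import Mathlib

open MeasureTheory Set
open scoped ENNReal NNReal FourierTransform ContDiff

noncomputable section

namespace DispersiveDecay

/-- First-derivative size and symbol bounds of order `m` on a set `S` of positive reals:
`|φ'(r)| ∼ r ^ (m - 1)`, and `|φ^(α)(r)| ≲ r ^ (m - α)` for every `α ≥ 2`
(the implied constant may depend on `α`), for `r ∈ S`. -/
def SymbolOrderOn (φ : ℝ → ℝ) (m : ℝ) (S : Set ℝ) : Prop :=
  (∃ c C : ℝ, 0 < c ∧ 0 < C ∧ ∀ r ∈ S,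
      c * r ^ (m - 1) ≤ |deriv φ r| ∧ |deriv φ r| ≤ C * r ^ (m - 1)) ∧
  ∀ α : ℕ, 2 ≤ α → ∃ C : ℝ, 0 < C ∧ ∀ r ∈ S, |iteratedDeriv α φ r| ≤ C * r ^ (m - (α : ℝ))

/-- `|φ''(r)| ∼ r ^ (a - 2)` for `r ∈ S`. -/
def SecondDerivOrderOn (φ : ℝ → ℝ) (a : ℝ) (S : Set ℝ) : Prop :=
  ∃ c C : ℝ, 0 < c ∧ 0 < C ∧ ∀ r ∈ S,
    c * r ^ (a - 2) ≤ |iteratedDeriv 2 φ r| ∧ |iteratedDeriv 2 φ r| ≤ C * r ^ (a - 2)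

/-- Hypothesis (H1) with exponent `m₁ > 0`. -/
def H1 (φ : ℝ → ℝ) (m₁ : ℝ) : Prop := 0 < m₁ ∧ SymbolOrderOn φ m₁ (Ici 1)

/-- Hypothesis (H2) with exponent `m₂ > 0`. -/
def H2 (φ : ℝ → ℝ) (m₂ : ℝ) : Prop := 0 < m₂ ∧ SymbolOrderOn φ m₂ (Ioo 0 1)

/-- Hypothesis (H3) with exponent `α₁`. -/
def H3 (φ : ℝ → ℝ) (α₁ : ℝ) : Prop := SecondDerivOrderOn φ α₁ (Ici 1)

/-- Hypothesis (H4) with exponent `α₂`. -/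
def H4 (φ : ℝ → ℝ) (α₂ : ℝ) : Prop := SecondDerivOrderOn φ α₂ (Ioo 0 1)

/-- `Φ` is a smooth radial (hence even) cutoff with values in `[0, 1]`, supported in the closed
ball of radius `2` and equal to `1` on the closed unit ball. -/
structure IsRadialCutoff {n : ℕ} (Φ : EuclideanSpace ℝ (Fin n) → ℝ) : Prop where
  smooth : ContDiff ℝ ∞ Φ
  radial : ∀ x y, ‖x‖ = ‖y‖ → Φ x = Φ y
  mem_Icc : ∀ x, Φ x ∈ Icc (0 : ℝ) 1
  support_subset : tsupport Φ ⊆ Metric.closedBall 0 2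
  eq_one : ∀ x, ‖x‖ ≤ 1 → Φ x = 1

/-- The Fourier multiplier operator `u ↦ 𝓕⁻¹ (σ(ξ) 𝓕 u)`, where `ξ` is the frequency variable of
the plane wave `exp (i x · ξ)`. Mathlib's transform uses the plane waves `exp (2 π i x · ξ)`, so the
symbol is evaluated at `2 π ξ`; in this way `-Δ` has symbol `|ξ| ^ 2`. -/
def multiplier {n : ℕ} (σ : EuclideanSpace ℝ (Fin n) → ℂ) (u : EuclideanSpace ℝ (Fin n) → ℂ) :
    EuclideanSpace ℝ (Fin n) → ℂ :=
  𝓕⁻ (fun ξ : EuclideanSpace ℝ (Fin n) => σ ((2 * Real.pi) • ξ) * 𝓕 u ξ)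

/-- The propagator `exp (i t φ(√(-Δ)))`, with symbol `exp (i t φ(|ξ|))`. -/
def propagator {n : ℕ} (φ : ℝ → ℝ) (t : ℝ) (u : EuclideanSpace ℝ (Fin n) → ℂ) :
    EuclideanSpace ℝ (Fin n) → ℂ :=
  multiplier (fun ξ => Complex.exp (Complex.I * (t : ℂ) * (φ ‖ξ‖ : ℂ))) u

/-- The annular bump `ψ(ξ) = Φ(ξ) - Φ(2 ξ)`. -/
def annular {n : ℕ} (Φ : EuclideanSpace ℝ (Fin n) → ℝ) (ξ : EuclideanSpace ℝ (Fin n)) : ℝ :=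
  Φ ξ - Φ ((2 : ℝ) • ξ)

/-- The Littlewood-Paley projector `Δ_k`, with symbol `ψ(2 ^ (-k) ξ)`. -/
def dyadicProj {n : ℕ} (Φ : EuclideanSpace ℝ (Fin n) → ℝ) (k : ℤ)
    (u : EuclideanSpace ℝ (Fin n) → ℂ) : EuclideanSpace ℝ (Fin n) → ℂ :=
  multiplier (fun ξ => (annular Φ (((2 : ℝ) ^ (-k)) • ξ) : ℂ)) u

/-- The low-frequency projector `P_{≤ 0}`, with symbol `Φ(ξ)`. -/
def lowProj {n : ℕ} (Φ : EuclideanSpace ℝ (Fin n) → ℝ)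
    (u : EuclideanSpace ℝ (Fin n) → ℂ) : EuclideanSpace ℝ (Fin n) → ℂ :=
  multiplier (fun ξ => (Φ ξ : ℂ)) u

end DispersiveDecay

end

open DispersiveDecay

/-! Each estimate is a sup bound on a kernel `∫ e^{i x·ξ} e^{itφ(|ξ|)} χ(ξ) dξ`, since convolution
with a bounded kernel maps `L¹` to `L^∞`. For a dyadic `χ`, scaling `|ξ| ∼ 2^k` to the unit shell
and passing to polar coordinates leaves `2^{kn}` times the one-dimensional integral `radialOsc`,
with large parameter `Λ = t 2^{mk}`, rescaled distance `s = 2^k |x|`, and phase `g_k(r) = 2^{-mk}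
φ(2^k r)`. The symbol hypotheses say that all `g_k'` are bounded below and smooth uniformly in `k`.

Two regimes remain (`IsPhaseFamily.radialOsc_dichotomy`). If `s` is small against `|Λ|`, no plane
wave on the sphere can cancel `Λ g'`, and repeated integration by parts beats every power of `|Λ|`.
If `s ≳ |Λ|`, the Fourier transform of the sphere contributes `s^{-(n-1)/2} ≲ |Λ|^{-(n-1)/2}`; when
`|g''| ≥ μ`, van der Corput's test, applied to each of the two plane waves that make up this
transform, gains a further `(|Λ| μ)^{-1/2}`. The splitting into plane waves comes from an ODE: after
multiplication by `ρ^{(n-1)/2}` the radial profile satisfies `w'' = (κ/ρ² - 1) w`, a perturbation of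
the harmonic oscillator that is integrable at infinity.

For the low-frequency part the shells are summed. Away from the critical exponent, where `m` times
the decay rate equals `n`, the sums are geometric. At the critical exponent every shell has the same
bound, and a logarithm would be lost; but at a fixed `x` the stationary terms still form a geometric
progression in the shell index, of ratio different from 1, and so are controlled by their largest
member (`exists_sum_shell_le_of_dichotomy`). This leaves out only dimension one with `m = 2`, where
`|φ''|` is bounded below and van der Corput's test applies without any decomposition. -/

/-! ### Van der Corput's second derivative test. -/

/-- The integrand is the derivative of `arctan (p' / √μ) / √μ`, and `arctan` ranges over an interval
of length `π`. -/
lemma intervalIntegral_deriv_div_sq_add_le {a b μ : ℝ} (hab : a ≤ b) (hμ : 0 < μ)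
    {p' p'' : ℝ → ℝ} (hp' : ∀ r ∈ Icc a b, HasDerivAt p' (p'' r) r)
    (hc : ContinuousOn p'' (Icc a b)) :
    ∫ r in a..b, p'' r / (p' r ^ 2 + μ) ≤ Real.pi / √μ := by
  have hs : 0 < √μ := Real.sqrt_pos.2 hμ
  have hsq : √μ ^ 2 = μ := Real.sq_sqrt hμ.le
  have hd : ∀ r ∈ Icc a b, HasDerivAt (fun r => Real.arctan (p' r / √μ) / √μ)
      (p'' r / (p' r ^ 2 + μ)) r := by
    intro r hr
    have h := (((hp' r hr).div_const (√μ)).arctan).div_const (√μ)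
    refine h.congr_deriv ?_
    rw [div_pow, hsq]
    have : 0 < p' r ^ 2 + μ := by positivity
    have h2 : 1 + p' r ^ 2 / μ = (p' r ^ 2 + μ) / μ := by field_simp; ring
    rw [h2]
    field_simp
    rw [hsq, mul_comm]
  have hp'c : ContinuousOn p' (Icc a b) := fun r hr => (hp' r hr).continuousAt.continuousWithinAt
  rw [intervalIntegral.integral_eq_sub_of_hasDerivAt (fun r hr => hd r (by rwa [uIcc_of_le hab] at hr))]
  · rw [← sub_div]
    gcongr
    have h1 := Real.arctan_lt_pi_div_two (p' b / √μ)
    have h2 := Real.neg_pi_div_two_lt_arctan (p' a / √μ)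
    linarith
  · apply ContinuousOn.intervalIntegrable
    rw [uIcc_of_le hab]
    refine hc.div (by fun_prop) fun r _ => ?_
    positivity

/-- Van der Corput's second derivative test, for a convex phase. -/
lemma norm_integral_exp_mul_le_of_le_deriv2 {a b μ M M' : ℝ} (hab : a ≤ b) (hμ : 0 < μ)
    {p p' p'' : ℝ → ℝ} {A A' : ℝ → ℂ}
    (hp : ∀ r ∈ Icc a b, HasDerivAt p (p' r) r) (hp' : ∀ r ∈ Icc a b, HasDerivAt p' (p'' r) r)
    (hc : ContinuousOn p'' (Icc a b)) (hA : ∀ r ∈ Icc a b, HasDerivAt A (A' r) r)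
    (hcA : ContinuousOn A' (Icc a b)) (hM : ∀ r ∈ Icc a b, ‖A r‖ ≤ M)
    (hM' : ∀ r ∈ Icc a b, ‖A' r‖ ≤ M') (h : ∀ r ∈ Icc a b, μ ≤ p'' r) :
    ‖∫ r in a..b, Complex.exp (Complex.I * p r) * A r‖ ≤ (8 * M + (b - a) * M') / √μ := by
  have hs : 0 < √μ := Real.sqrt_pos.2 hμ
  have hsq : √μ ^ 2 = μ := Real.sq_sqrt hμ.le
  have hM0 : 0 ≤ M := (norm_nonneg _).trans (hM a (left_mem_Icc.2 hab))
  have hM0' : 0 ≤ M' := (norm_nonneg _).trans (hM' a (left_mem_Icc.2 hab))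
  have hpos : ∀ r, 0 < p' r ^ 2 + μ := fun r => by positivity
  have hp'c : ContinuousOn p' (Icc a b) := fun r hr => (hp' r hr).continuousAt.continuousWithinAt
  have hpc : ContinuousOn p (Icc a b) := fun r hr => (hp r hr).continuousAt.continuousWithinAt
  have hAc : ContinuousOn A (Icc a b) := fun r hr => (hA r hr).continuousAt.continuousWithinAt
  -- A regularized `1 / p'`: it makes integration by parts possible across a critical point, with no
  -- splitting of the interval.
  set v : ℝ → ℝ := fun r => p' r / (p' r ^ 2 + μ) with hv
  set v' : ℝ → ℝ := fun r => p'' r * (μ - p' r ^ 2) / (p' r ^ 2 + μ) ^ 2 with hv'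
  have hdv : ∀ r ∈ Icc a b, HasDerivAt v (v' r) r := by
    intro r hr
    have h1 := (hp' r hr).div (((hp' r hr).pow 2).add_const μ) (hpos r).ne'
    refine h1.congr_deriv ?_
    simp only [hv']
    simp
    ring
  have hvc : ContinuousOn v (Icc a b) := fun r hr => (hdv r hr).continuousAt.continuousWithinAt
  have hv'c : ContinuousOn v' (Icc a b) := by
    refine (hc.mul (by fun_prop)).div (by fun_prop) fun r _ => ?_
    have := hpos r
    positivity
  have hvb : ∀ r, |v r| ≤ 1 / (2 * √μ) := by
    intro r
    rw [hv]
    simp only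
    rw [abs_div, abs_of_pos (hpos r), div_le_div_iff₀ (hpos r) (by positivity)]
    nlinarith [sq_nonneg (|p' r| - √μ), sq_abs (p' r)]
  have hv'b : ∀ r ∈ Icc a b, |v' r| ≤ p'' r / (p' r ^ 2 + μ) := by
    intro r hr
    have h0 : 0 ≤ p'' r := hμ.le.trans (h r hr)
    simp only [hv']
    rw [abs_div, abs_mul, abs_of_nonneg h0, abs_of_pos (pow_pos (hpos r) 2),
      div_le_div_iff₀ (pow_pos (hpos r) 2) (hpos r), pow_two (p' r ^ 2 + μ), mul_assoc]
    refine mul_le_mul_of_nonneg_left ?_ h0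
    refine mul_le_mul_of_nonneg_right ?_ (hpos r).le
    rw [abs_le]
    constructor <;> nlinarith [sq_nonneg (p' r)]
  -- Since `p' v = 1 - μ / (p'² + μ)`, the derivative of `B` is the integrand up to `R`. Both `|v'|`
  -- and `μ / (p'² + μ)` are at most `p'' / (p'² + μ)`, which the arctangent integral controls.
  set B : ℝ → ℂ := fun r => Complex.exp (Complex.I * p r) * (v r * A r) / Complex.I with hB
  have hEd : ∀ r ∈ Icc a b, HasDerivAt (fun r => Complex.exp (Complex.I * p r))
      (Complex.exp (Complex.I * p r) * (Complex.I * p' r)) r := fun r hr =>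
    (((hp r hr).ofReal_comp).const_mul Complex.I).cexp
  set R : ℝ → ℂ := fun r => Complex.exp (Complex.I * p r) *
    (-(v' r * A r + v r * A' r) / Complex.I + A r * ((μ / (p' r ^ 2 + μ) : ℝ) : ℂ)) with hR
  have hBd : ∀ r ∈ Icc a b, HasDerivAt B (Complex.exp (Complex.I * p r) * A r - R r) r := by
    intro r hr
    have h1 := ((hEd r hr).mul (((hdv r hr).ofReal_comp).mul (hA r hr))).div_const Complex.I
    refine h1.congr_deriv ?_
    simp only [hR, hv, Pi.mul_apply]
    have h3 : ((p' r ^ 2 + μ : ℝ) : ℂ) ≠ 0 := by exact_mod_cast (hpos r).ne'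
    push_cast at h3 ⊢
    field_simp
    ring
  have hEc : ContinuousOn (fun r => Complex.exp (Complex.I * p r)) (Icc a b) :=
    fun r hr => (hEd r hr).continuousAt.continuousWithinAt
  have hquot : ContinuousOn (fun r => μ / (p' r ^ 2 + μ)) (Icc a b) :=
    continuousOn_const.div (by fun_prop) fun r _ => (hpos r).ne'
  have hRc : ContinuousOn R (Icc a b) := by
    refine hEc.mul (ContinuousOn.add ?_ ?_)
    · refine ContinuousOn.div_const (ContinuousOn.neg (ContinuousOn.add ?_ ?_)) _
      · exact (Complex.continuous_ofReal.comp_continuousOn hv'c).mul hAc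
      · exact (Complex.continuous_ofReal.comp_continuousOn hvc).mul hcA
    · exact hAc.mul (Complex.continuous_ofReal.comp_continuousOn hquot)
  have hint : ∀ {f : ℝ → ℂ}, ContinuousOn f (Icc a b) → IntervalIntegrable f volume a b :=
    fun hf => ContinuousOn.intervalIntegrable (by rwa [uIcc_of_le hab])
  have hint' : ∀ {f : ℝ → ℝ}, ContinuousOn f (Icc a b) → IntervalIntegrable f volume a b :=
    fun hf => ContinuousOn.intervalIntegrable (by rwa [uIcc_of_le hab])
  have hFTC : ∫ r in a..b, (Complex.exp (Complex.I * p r) * A r - R r) = B b - B a :=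
    intervalIntegral.integral_eq_sub_of_hasDerivAt
      (fun r hr => hBd r (by rwa [uIcc_of_le hab] at hr)) (hint (ContinuousOn.sub (hEc.mul hAc) hRc))
  have hEA : ContinuousOn (fun r => Complex.exp (Complex.I * p r) * A r) (Icc a b) := hEc.mul hAc
  rw [intervalIntegral.integral_sub (hint hEA) (hint hRc), sub_eq_iff_eq_add] at hFTC
  rw [hFTC]
  have hE1 : ∀ r, ‖Complex.exp (Complex.I * p r)‖ = 1 := fun r => by
    rw [mul_comm]; exact Complex.norm_exp_ofReal_mul_I _
  have hBb : ∀ r ∈ Icc a b, ‖B r‖ ≤ M / (2 * √μ) := by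
    intro r hr
    simp only [hB, norm_div, norm_mul, hE1, Complex.norm_I, one_mul, div_one, Complex.norm_real,
      Real.norm_eq_abs]
    calc |v r| * ‖A r‖ ≤ 1 / (2 * √μ) * M :=
          mul_le_mul (hvb r) (hM r hr) (norm_nonneg _) (by positivity)
      _ = _ := by ring
  have hRb : ∀ r ∈ Icc a b, ‖R r‖ ≤ 2 * M * (p'' r / (p' r ^ 2 + μ)) + M' / (2 * √μ) := by
    intro r hr
    have e1 : ‖(v' r : ℂ) * A r + v r * A' r‖ ≤
        p'' r / (p' r ^ 2 + μ) * M + 1 / (2 * √μ) * M' := by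
      refine (norm_add_le _ _).trans ?_
      simp only [norm_mul, Complex.norm_real, Real.norm_eq_abs]
      gcongr
      · exact (abs_nonneg _).trans (hv'b r hr)
      · exact hv'b r hr
      · exact hM r hr
      · exact hvb r
      · exact hM' r hr
    have e2 : ‖A r * ((μ / (p' r ^ 2 + μ) : ℝ) : ℂ)‖ ≤ M * (p'' r / (p' r ^ 2 + μ)) := by
      rw [norm_mul, Complex.norm_real, Real.norm_eq_abs, abs_of_pos (div_pos hμ (hpos r))]
      gcongr
      · exact hM r hr
      · exact h r hr
    simp only [hR, norm_mul, hE1, one_mul]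
    refine (norm_add_le _ _).trans ?_
    rw [norm_div, norm_neg, Complex.norm_I, div_one]
    refine (add_le_add e1 e2).trans (le_of_eq ?_)
    ring
  have hq2 : ContinuousOn (fun r => p'' r / (p' r ^ 2 + μ)) (Icc a b) :=
    hc.div (by fun_prop) fun r _ => (hpos r).ne'
  have hq3 : ContinuousOn (fun r => 2 * M * (p'' r / (p' r ^ 2 + μ))) (Icc a b) :=
    continuousOn_const.mul hq2
  have hRint : ‖∫ r in a..b, R r‖ ≤ 2 * M * (Real.pi / √μ) + (b - a) * (M' / (2 * √μ)) := by
    calc ‖∫ r in a..b, R r‖ ≤ ∫ r in a..b, ‖R r‖ :=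
          intervalIntegral.norm_integral_le_integral_norm hab
      _ ≤ ∫ r in a..b, (2 * M * (p'' r / (p' r ^ 2 + μ)) + M' / (2 * √μ)) := by
          refine intervalIntegral.integral_mono_on hab (hint' hRc.norm) (hint' ?_) hRb
          exact hq3.add continuousOn_const
      _ = 2 * M * (∫ r in a..b, p'' r / (p' r ^ 2 + μ)) + (b - a) * (M' / (2 * √μ)) := by
          rw [intervalIntegral.integral_add (hint' hq3)
            (hint' continuousOn_const), intervalIntegral.integral_const_mul,
            intervalIntegral.integral_const, smul_eq_mul]
      _ ≤ _ := by
          gcongr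
          exact intervalIntegral_deriv_div_sq_add_le hab hμ hp' hc
  calc ‖B b - B a + ∫ r in a..b, R r‖ ≤ ‖B b‖ + ‖B a‖ + ‖∫ r in a..b, R r‖ :=
        (norm_add_le _ _).trans (add_le_add_left (norm_sub_le _ _) _)
    _ ≤ M / (2 * √μ) + M / (2 * √μ) + (2 * M * (Real.pi / √μ) + (b - a) * (M' / (2 * √μ))) :=
        add_le_add (add_le_add (hBb b (right_mem_Icc.2 hab)) (hBb a (left_mem_Icc.2 hab))) hRint
    -- The 8 of the statement is `1 + 2π` rounded up.
    _ = (M * (1 + 2 * Real.pi) + (b - a) * M' / 2) / √μ := by field_simp; ring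
    _ ≤ _ := by
        gcongr ?_ / _
        have h1 : 0 ≤ (b - a) * M' := mul_nonneg (sub_nonneg.2 hab) hM0'
        nlinarith [Real.pi_lt_d2]

/-- Van der Corput's second derivative test. -/
lemma norm_integral_exp_mul_le_of_le_abs_deriv2 {a b μ M M' : ℝ} (hab : a ≤ b) (hμ : 0 < μ)
    {p p' p'' : ℝ → ℝ} {A A' : ℝ → ℂ}
    (hp : ∀ r ∈ Icc a b, HasDerivAt p (p' r) r) (hp' : ∀ r ∈ Icc a b, HasDerivAt p' (p'' r) r)
    (hc : ContinuousOn p'' (Icc a b)) (hA : ∀ r ∈ Icc a b, HasDerivAt A (A' r) r)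
    (hcA : ContinuousOn A' (Icc a b)) (hM : ∀ r ∈ Icc a b, ‖A r‖ ≤ M)
    (hM' : ∀ r ∈ Icc a b, ‖A' r‖ ≤ M') (h : ∀ r ∈ Icc a b, μ ≤ |p'' r|) :
    ‖∫ r in a..b, Complex.exp (Complex.I * p r) * A r‖ ≤ (8 * M + (b - a) * M') / √μ := by
  have hsign : (∀ r ∈ Icc a b, μ ≤ p'' r) ∨ ∀ r ∈ Icc a b, μ ≤ -p'' r := by
    have hne : ∀ r ∈ Icc a b, p'' r ≠ 0 := fun r hr h0 => by
      have := h r hr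
      rw [h0, abs_zero] at this
      linarith
    rcases isPreconnected_Icc.mapsTo_Ioi_or_Iio hc hne with h1 | h1
    · left; intro r hr; have h2 : 0 < p'' r := h1 hr
      simpa only [abs_of_pos h2] using h r hr
    · right; intro r hr; have h2 : p'' r < 0 := h1 hr
      simpa only [abs_of_neg h2] using h r hr
  rcases hsign with h1 | h1
  · exact norm_integral_exp_mul_le_of_le_deriv2 hab hμ hp hp' hc hA hcA hM hM' h1
  · have := norm_integral_exp_mul_le_of_le_deriv2 (A := fun r => (starRingEnd ℂ) (A r))
      (A' := fun r => (starRingEnd ℂ) (A' r)) hab hμ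
      (fun r hr => (hp r hr).neg) (fun r hr => (hp' r hr).neg) hc.neg
      (fun r hr => (hA r hr).star) hcA.star (by simpa using hM) (by simpa using hM') h1
    -- Complex conjugation replaces the phase `p` by `-p`, which is convex in this case.
    convert this using 1
    rw [← Complex.norm_conj, ← intervalIntegral.intervalIntegral_conj]
    congr 2
    ext r
    simp [← Complex.exp_conj]

/-! ### Uniformly smooth families. -/

/-- A family of functions which are smooth at the points of `K`, each derivative being bounded on
`K` uniformly over the family. -/
def UniformlySmoothOn {ι : Type*} (K : Set ℝ) (f : ι → ℝ → ℝ) : Prop :=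
  (∀ i, ∀ r ∈ K, ContDiffAt ℝ ∞ (f i) r) ∧
  ∀ j : ℕ, ∃ C : ℝ, ∀ i, ∀ r ∈ K, |iteratedDeriv j (f i) r| ≤ C

namespace UniformlySmoothOn

variable {ι κ : Type*} {K : Set ℝ} {f g : ι → ℝ → ℝ}

lemma contDiffAt_nat (hf : UniformlySmoothOn K f) (i : ι) {r : ℝ} (hr : r ∈ K) (j : ℕ) :
    ContDiffAt ℝ j (f i) r := (hf.1 i r hr).of_le (by exact_mod_cast le_top)

lemma exists_bound (hf : UniformlySmoothOn K f) (j : ℕ) :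
    ∃ C : ℝ, 0 ≤ C ∧ ∀ l ≤ j, ∀ i, ∀ r ∈ K, |iteratedDeriv l (f i) r| ≤ C := by
  choose C hC using hf.2
  refine ⟨∑ l ∈ Finset.range (j + 1), |C l|, by positivity, fun l hl i r hr => ?_⟩
  exact ((hC l i r hr).trans (le_abs_self _)).trans
    (Finset.single_le_sum (f := fun l => |C l|) (fun _ _ => abs_nonneg _)
      (Finset.mem_range.2 (by omega)))

lemma comp (hf : UniformlySmoothOn K f) (e : κ → ι) : UniformlySmoothOn K (fun k => f (e k)) :=
  ⟨fun k => hf.1 (e k), fun j => (hf.2 j).imp fun _ hC k => hC (e k)⟩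

lemma bound_mul {j : ℕ} {C D : ℝ} (hC : 0 ≤ C) {u v : ℝ → ℝ} {r : ℝ}
    (hu : ContDiffAt ℝ j u r) (hv : ContDiffAt ℝ j v r)
    (hCu : ∀ l ≤ j, |iteratedDeriv l u r| ≤ C) (hDv : ∀ l ≤ j, |iteratedDeriv l v r| ≤ D) :
    |iteratedDeriv j (u * v) r| ≤ 2 ^ j * (C * D) := by
  rw [iteratedDeriv_mul hu hv]
  calc |∑ l ∈ Finset.range (j + 1),
        (j.choose l : ℝ) * iteratedDeriv l u r * iteratedDeriv (j - l) v r|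
      ≤ ∑ l ∈ Finset.range (j + 1), (j.choose l : ℝ) * (C * D) := by
        refine (Finset.abs_sum_le_sum_abs _ _).trans (Finset.sum_le_sum fun l hl => ?_)
        rw [abs_mul, abs_mul, Nat.abs_cast, mul_assoc]
        gcongr
        · exact hCu l (by rw [Finset.mem_range] at hl; omega)
        · exact hDv _ (by omega)
    _ = _ := by
        rw [← Finset.sum_mul]
        congr 1
        exact_mod_cast Nat.sum_range_choose j

lemma mul (hf : UniformlySmoothOn K f) (hg : UniformlySmoothOn K g) :
    UniformlySmoothOn K (fun i => f i * g i) := by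
  refine ⟨fun i r hr => (hf.1 i r hr).mul (hg.1 i r hr), fun j => ?_⟩
  obtain ⟨C, hC, hfC⟩ := hf.exists_bound j
  obtain ⟨D, -, hgD⟩ := hg.exists_bound j
  exact ⟨_, fun i r hr => bound_mul hC (hf.contDiffAt_nat i hr j) (hg.contDiffAt_nat i hr j)
    (fun l hl => hfC l hl i r hr) (fun l hl => hgD l hl i r hr)⟩

lemma deriv (hf : UniformlySmoothOn K f) : UniformlySmoothOn K (fun i => deriv (f i)) := by
  refine ⟨fun i r hr => ?_, fun j => ?_⟩
  · have h1 : ContDiffAt ℝ ∞ (fun x => fderiv ℝ (f i) x 1) r :=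
      ((hf.1 i r hr).fderiv_right (m := ∞) (by simp)).clm_apply contDiffAt_const
    simpa only [fderiv_apply_one_eq_deriv] using h1
  · obtain ⟨C, hC⟩ := hf.2 (j + 1)
    exact ⟨C, fun i r hr => by simpa only [iteratedDeriv_succ'] using hC i r hr⟩

lemma inv (hf : UniformlySmoothOn K f) {c : ℝ} (hc : 0 < c) (h : ∀ i, ∀ r ∈ K, c ≤ |f i r|) :
    UniformlySmoothOn K (fun i => (f i)⁻¹) := by
  have hne : ∀ i, ∀ r ∈ K, f i r ≠ 0 := fun i r hr h0 => by
    have := h i r hr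
    rw [h0, abs_zero] at this
    linarith
  have hsm : ∀ i, ∀ r ∈ K, ContDiffAt ℝ ∞ ((f i)⁻¹) r := fun i r hr =>
    (hf.1 i r hr).inv (hne i r hr)
  have hsmj : ∀ i, ∀ r ∈ K, ∀ j : ℕ, ContDiffAt ℝ j ((f i)⁻¹) r := fun i r hr j =>
    (hsm i r hr).of_le (by exact_mod_cast le_top)
  refine ⟨hsm, fun j => ?_⟩
  -- The induction carries all lower orders at once, as Leibniz' rule for `(1/f)' = -f' (1/f)²`
  -- needs them.
  suffices H : ∃ C : ℝ, 0 ≤ C ∧ ∀ l ≤ j, ∀ i, ∀ r ∈ K, |iteratedDeriv l ((f i)⁻¹) r| ≤ C from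
    ⟨_, fun i r hr => H.choose_spec.2 j le_rfl i r hr⟩
  induction j with
  | zero =>
    refine ⟨c⁻¹, by positivity, fun l hl i r hr => ?_⟩
    obtain rfl : l = 0 := by omega
    rw [iteratedDeriv_zero, Pi.inv_apply, abs_inv]
    exact inv_anti₀ hc (h i r hr)
  | succ j ih =>
    obtain ⟨C, hC, hCb⟩ := ih
    obtain ⟨D, hD, hDb⟩ := hf.deriv.exists_bound j
    have key : ∀ i, ∀ r ∈ K, |iteratedDeriv (j + 1) ((f i)⁻¹) r| ≤
        2 ^ j * (D * (2 ^ j * (C * C))) := by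
      intro i r hr
      have hev : _root_.deriv ((f i)⁻¹) =ᶠ[nhds r] -(_root_.deriv (f i) * ((f i)⁻¹ * (f i)⁻¹)) := by
        have h1 : ∀ᶠ x in nhds r, f i x ≠ 0 :=
          (hf.1 i r hr).continuousAt.eventually_ne (hne i r hr)
        have h2 : ∀ᶠ x in nhds r, DifferentiableAt ℝ (f i) x := by
          have h3 : ContDiffAt ℝ 1 (f i) r := (hf.1 i r hr).of_le (by exact_mod_cast le_top)
          filter_upwards [h3.eventually (by simp)] with x hx
          exact hx.differentiableAt one_ne_zero
        filter_upwards [h1, h2] with x hx1 hx2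
        rw [(hx2.hasDerivAt.inv hx1).deriv]
        simp only [Pi.neg_apply, Pi.mul_apply, Pi.inv_apply]
        field_simp
      rw [iteratedDeriv_succ', (hev.iteratedDeriv j).eq_of_nhds, iteratedDeriv_neg, abs_neg]
      refine bound_mul hD ((hf.deriv).contDiffAt_nat i hr j)
        ((hsmj i r hr j).mul (hsmj i r hr j)) (fun l hl => hDb l hl i r hr) fun l hl => ?_
      refine (bound_mul hC (hsmj i r hr l) (hsmj i r hr l)
        (fun l' hl' => hCb l' (hl'.trans hl) i r hr)
        (fun l' hl' => hCb l' (hl'.trans hl) i r hr)).trans ?_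
      gcongr
      norm_num
    refine ⟨max C (2 ^ j * (D * (2 ^ j * (C * C)))), le_max_of_le_left hC, fun l hl i r hr => ?_⟩
    rcases Nat.lt_or_ge l (j + 1) with h1 | h1
    · exact (hCb l (by omega) i r hr).trans (le_max_left _ _)
    · obtain rfl : l = j + 1 := by omega
      exact (key i r hr).trans (le_max_right _ _)

lemma of_contDiff {b : ℝ → ℝ} (hb : ContDiff ℝ ∞ b) (hK : IsCompact K) :
    UniformlySmoothOn K (fun _ : ι => b) := by
  refine ⟨fun _ r _ => hb.contDiffAt, fun j => ?_⟩
  obtain ⟨C, hC⟩ := hK.exists_bound_of_continuousOn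
    (hb.continuous_iteratedDeriv j (by exact_mod_cast le_top)).continuousOn
  exact ⟨C, fun _ r hr => hC r hr⟩

lemma continuousOn (hf : UniformlySmoothOn K f) (i : ι) : ContinuousOn (f i) K :=
  fun r hr => (hf.1 i r hr).continuousAt.continuousWithinAt

lemma hasDerivAt (hf : UniformlySmoothOn K f) (i : ι) {r : ℝ} (hr : r ∈ K) :
    HasDerivAt (f i) (_root_.deriv (f i) r) r :=
  ((hf.1 i r hr).differentiableAt (by simp)).hasDerivAt

end UniformlySmoothOn

/-! ### Nonstationary phase. -/

/-- Limits are taken from outside the interval. This removes the boundary terms in the integrations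
by parts. -/
lemma eq_zero_endpoints_of_eqOn_compl_Icc {a b : ℝ} {f : ℝ → ℝ}
    (ha : ContinuousAt f a) (hb : ContinuousAt f b) (h : ∀ r, r ∉ Icc a b → f r = 0) :
    f a = 0 ∧ f b = 0 := by
  constructor
  · refine tendsto_nhds_unique (ha.tendsto.mono_left (nhdsWithin_le_nhds (s := Iio a))) ?_
    refine tendsto_const_nhds.congr' ?_
    filter_upwards [self_mem_nhdsWithin] with r hr
    exact (h r fun hr' => (not_lt.2 hr'.1) hr).symm
  · refine tendsto_nhds_unique (hb.tendsto.mono_left (nhdsWithin_le_nhds (s := Ioi b))) ?_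
    refine tendsto_const_nhds.congr' ?_
    filter_upwards [self_mem_nhdsWithin] with r hr
    exact (h r fun hr' => (not_lt.2 hr'.2) hr).symm

lemma deriv_eq_zero_of_notMem_Icc {a b : ℝ} {f : ℝ → ℝ} (h : ∀ r, r ∉ Icc a b → f r = 0)
    {r : ℝ} (hr : r ∉ Icc a b) : deriv f r = 0 := by
  have : f =ᶠ[nhds r] fun _ => 0 := by
    filter_upwards [isClosed_Icc.isOpen_compl.mem_nhds hr] with x hx using h x hx
  rw [this.deriv_eq, deriv_const]

/-- Nonstationary phase: if `Λ / p'` and the amplitude are uniformly smooth over a family, the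
oscillatory integrals decay faster than any power of `Λ`, uniformly. -/
lemma exists_pow_mul_norm_integral_exp_le {ι : Type*} {a b : ℝ} (hab : a ≤ b)
    {p p' q : ι → ℝ → ℝ} {Λ : ι → ℝ}
    (hp : ∀ i, ∀ r ∈ Icc a b, HasDerivAt (p i) (p' i r) r)
    (hpq : ∀ i, ∀ r ∈ Icc a b, p' i r * q i r = Λ i)
    (hp'c : ∀ i, ContinuousOn (p' i) (Icc a b))
    (hq : UniformlySmoothOn (Icc a b) q) (N : ℕ) :
    ∀ f : ι → ℝ → ℝ, UniformlySmoothOn (Icc a b) f → (∀ i, ∀ r, r ∉ Icc a b → f i r = 0) →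
    ∃ C : ℝ, 0 ≤ C ∧ ∀ i,
      |Λ i| ^ N * ‖∫ r in a..b, Complex.exp (Complex.I * p i r) * (f i r : ℂ)‖ ≤ C := by
  have hE1 : ∀ i r, ‖Complex.exp (Complex.I * p i r)‖ = 1 := fun i r => by
    rw [mul_comm]; exact Complex.norm_exp_ofReal_mul_I _
  induction N with
  | zero =>
    intro f hf _
    obtain ⟨C, hC0, hC⟩ := hf.exists_bound 0
    refine ⟨C * |b - a|, by positivity, fun i => ?_⟩
    rw [pow_zero, one_mul]
    refine intervalIntegral.norm_integral_le_of_norm_le_const fun r hr => ?_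
    rw [norm_mul, hE1, one_mul, Complex.norm_real]
    rw [uIoc_of_le hab] at hr
    simpa using hC 0 le_rfl i r (Ioc_subset_Icc_self hr)
  | succ N ih =>
    intro f hf hf0
    have hqf := hq.mul hf
    have hqf0 : ∀ i, ∀ r, r ∉ Icc a b → (q i * f i) r = 0 := fun i r hr => by
      rw [Pi.mul_apply, hf0 i r hr, mul_zero]
    -- One integration by parts trades a factor `Λ = p' q` for the new amplitude `(q f)'`, which is
    -- again uniformly smooth and supported in the interval.
    obtain ⟨C, hC0, hC⟩ := ih _ hqf.deriv fun i r hr => deriv_eq_zero_of_notMem_Icc (hqf0 i) hr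
    refine ⟨C, hC0, fun i => ?_⟩
    refine le_trans (le_of_eq ?_) (hC i)
    rw [pow_succ, mul_assoc]
    congr 1
    have hEd : ∀ r ∈ Icc a b, HasDerivAt (fun r => Complex.exp (Complex.I * p i r))
        (Complex.exp (Complex.I * p i r) * (Complex.I * p' i r)) r := fun r hr =>
      (((hp i r hr).ofReal_comp).const_mul Complex.I).cexp
    have hEc : ContinuousOn (fun r => Complex.exp (Complex.I * p i r)) (Icc a b) :=
      fun r hr => (hEd r hr).continuousAt.continuousWithinAt
    have hE'c : ContinuousOn
        (fun r => Complex.exp (Complex.I * p i r) * (Complex.I * p' i r)) (Icc a b) :=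
      hEc.mul (continuousOn_const.mul (Complex.continuous_ofReal.comp_continuousOn (hp'c i)))
    have hqfd : ∀ r ∈ Icc a b, HasDerivAt (fun r => (((q i * f i) r : ℝ) : ℂ))
        ((deriv (q i * f i) r : ℝ) : ℂ) r := fun r hr => (hqf.hasDerivAt i hr).ofReal_comp
    have hend : (q i * f i) a = 0 ∧ (q i * f i) b = 0 := eq_zero_endpoints_of_eqOn_compl_Icc
      ((hqf.1 i a (left_mem_Icc.2 hab)).continuousAt)
      ((hqf.1 i b (right_mem_Icc.2 hab)).continuousAt) (hqf0 i)
    have hibp := intervalIntegral.integral_deriv_mul_eq_sub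
      (u := fun r => Complex.exp (Complex.I * p i r)) (v := fun r => (((q i * f i) r : ℝ) : ℂ))
      (fun r hr => hEd r (by rwa [uIcc_of_le hab] at hr))
      (fun r hr => hqfd r (by rwa [uIcc_of_le hab] at hr))
      (ContinuousOn.intervalIntegrable (by rwa [uIcc_of_le hab]))
      (ContinuousOn.intervalIntegrable (by
        rw [uIcc_of_le hab]
        exact Complex.continuous_ofReal.comp_continuousOn (hqf.deriv.continuousOn i)))
    rw [hend.1, hend.2, Complex.ofReal_zero, mul_zero, mul_zero, sub_zero] at hibp
    have hcongr : ∫ r in a..b, (Complex.exp (Complex.I * p i r) * (Complex.I * p' i r) *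
        (((q i * f i) r : ℝ) : ℂ) + Complex.exp (Complex.I * p i r) * (deriv (q i * f i) r : ℝ)) =
        ∫ r in a..b, (Complex.I * Λ i * (Complex.exp (Complex.I * p i r) * (f i r : ℂ)) +
          Complex.exp (Complex.I * p i r) * (deriv (q i * f i) r : ℝ)) := by
      refine intervalIntegral.integral_congr fun r hr => ?_
      rw [uIcc_of_le hab] at hr
      simp only [← hpq i r hr, Pi.mul_apply]
      push_cast
      ring
    rw [hcongr, intervalIntegral.integral_add, intervalIntegral.integral_const_mul] at hibp
    · have := eq_neg_of_add_eq_zero_left hibp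
      rw [← norm_neg (∫ r in a..b, Complex.exp (Complex.I * p i r) * (deriv (q i * f i) r : ℝ)),
        ← this, norm_mul, norm_mul, Complex.norm_I, Complex.norm_real, one_mul, Real.norm_eq_abs]
    · refine ContinuousOn.intervalIntegrable ?_
      rw [uIcc_of_le hab]
      exact continuousOn_const.mul
        (hEc.mul (Complex.continuous_ofReal.comp_continuousOn (hf.continuousOn i)))
    · refine ContinuousOn.intervalIntegrable ?_
      rw [uIcc_of_le hab]
      exact hEc.mul (Complex.continuous_ofReal.comp_continuousOn (hqf.deriv.continuousOn i))

/-- Differentiation under the integral sign. The phase is affine in `s`, so the derivative has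
modulus `|a d|` independently of `s`. -/
lemma hasDerivAt_integral_mul_exp {X : Type*} [TopologicalSpace X] [CompactSpace X]
    [MeasurableSpace X] [BorelSpace X] [SecondCountableTopology X] (σ : Measure X) [IsFiniteMeasure σ]
    {a : X → ℂ} {c d : X → ℝ} (ha : Continuous a) (hc : Continuous c) (hd : Continuous d) (s : ℝ) :
    HasDerivAt (fun s : ℝ => ∫ x, a x * Complex.exp (Complex.I * ((c x + s * d x : ℝ) : ℂ)) ∂σ)
      (∫ x, Complex.I * (a x * d x) * Complex.exp (Complex.I * ((c x + s * d x : ℝ) : ℂ)) ∂σ) s := by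
  have hE1 : ∀ r : ℝ, ‖Complex.exp (Complex.I * r)‖ = 1 := fun r => by
    rw [mul_comm]; exact Complex.norm_exp_ofReal_mul_I _
  have hint : ∀ {f : X → ℂ}, Continuous f → Integrable f σ := fun hf =>
    hf.integrable_of_hasCompactSupport (HasCompactSupport.of_compactSpace _)
  refine (hasDerivAt_integral_of_dominated_loc_of_deriv_le
    (F := fun s x => a x * Complex.exp (Complex.I * ((c x + s * d x : ℝ) : ℂ)))
    (F' := fun s x => Complex.I * (a x * d x) * Complex.exp (Complex.I * ((c x + s * d x : ℝ) : ℂ)))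
    (bound := fun x => ‖a x * d x‖) Filter.univ_mem ?_ ?_ ?_ ?_ ?_ ?_).2
  · exact Filter.Eventually.of_forall fun s => (hint (by fun_prop)).aestronglyMeasurable
  · exact hint (by fun_prop)
  · exact (hint (by fun_prop)).aestronglyMeasurable
  · refine Filter.Eventually.of_forall fun x t _ => ?_
    rw [norm_mul, hE1, norm_mul, Complex.norm_I, one_mul, mul_one]
  · exact (hint (f := fun x => a x * d x) (by fun_prop)).norm
  · refine Filter.Eventually.of_forall fun x t _ => ?_
    have h1 : HasDerivAt (fun t : ℝ => c x + t * d x) (d x) t := by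
      simpa using ((hasDerivAt_id t).mul_const (d x)).const_add (c x)
    refine (((h1.ofReal_comp.const_mul Complex.I).cexp).const_mul (a x)).congr_deriv ?_
    ring

/-! ### The Fourier transform of the sphere: radial symmetry and the Helmholtz equation. -/

section Sphere

variable {n : ℕ}

/-- The surface measure of the unit sphere of `ℝⁿ`. -/
noncomputable abbrev sphereMeasure (n : ℕ) :
    Measure (Metric.sphere (0 : EuclideanSpace ℝ (Fin n)) 1) :=
  (volume : Measure (EuclideanSpace ℝ (Fin n))).toSphere

/-- The Fourier transform of the surface measure of the unit sphere. -/
noncomputable def sphereFourier (x : EuclideanSpace ℝ (Fin n)) : ℂ :=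
  ∫ η : Metric.sphere (0 : EuclideanSpace ℝ (Fin n)) 1,
    Complex.exp (Complex.I * ((inner ℝ (η : EuclideanSpace ℝ (Fin n)) x : ℝ) : ℂ)) ∂sphereMeasure n

open scoped Pointwise in
-- The surface measure of a set is a multiple of the volume of the cone over it; a linear isometry
-- maps cones to cones and preserves volume.
lemma measurePreserving_sphereMeasure
    (A : EuclideanSpace ℝ (Fin n) ≃ₗᵢ[ℝ] EuclideanSpace ℝ (Fin n)) :
    MeasurePreserving
      (fun η : Metric.sphere (0 : EuclideanSpace ℝ (Fin n)) 1 =>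
        (⟨A η, by simp⟩ : Metric.sphere (0 : EuclideanSpace ℝ (Fin n)) 1))
      (sphereMeasure n) (sphereMeasure n) := by
  have hm : Measurable (fun η : Metric.sphere (0 : EuclideanSpace ℝ (Fin n)) 1 =>
      (⟨A η, by simp⟩ : Metric.sphere (0 : EuclideanSpace ℝ (Fin n)) 1)) :=
    (Continuous.subtype_mk (A.continuous.comp continuous_subtype_val) _).measurable
  refine ⟨hm, Measure.ext fun s hs => ?_⟩
  rw [Measure.map_apply hm hs, Measure.toSphere_apply' _ (hm hs), Measure.toSphere_apply' _ hs,
    ← A.measurePreserving.measure_preimage_equiv (f := A.toHomeomorph.toMeasurableEquiv)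
      (Ioo (0 : ℝ) 1 • (Subtype.val '' s))]
  congr 2
  ext x
  simp only [mem_preimage, Set.mem_smul, mem_image, Subtype.exists]
  constructor
  · rintro ⟨r, hr, y, ⟨η, hη, hmem, rfl⟩, rfl⟩
    exact ⟨r, hr, A η, ⟨A η, by simpa using hη, hmem, rfl⟩, by simp⟩
  · rintro ⟨r, hr, y, ⟨η, hη, hmem, rfl⟩, hx⟩
    refine ⟨r, hr, A.symm η, ⟨A.symm η, by simpa using hη, by simpa using hmem, rfl⟩, ?_⟩
    apply A.injective
    simpa using hx

lemma sphereFourier_isometry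
    (A : EuclideanSpace ℝ (Fin n) ≃ₗᵢ[ℝ] EuclideanSpace ℝ (Fin n)) (x : EuclideanSpace ℝ (Fin n)) :
    sphereFourier (A x) = sphereFourier x := by
  have hme : MeasurableEmbedding (fun η : Metric.sphere (0 : EuclideanSpace ℝ (Fin n)) 1 =>
      (⟨A η, by simp⟩ : Metric.sphere (0 : EuclideanSpace ℝ (Fin n)) 1)) := by
    refine Topology.IsClosedEmbedding.measurableEmbedding (Continuous.isClosedEmbedding ?_ ?_)
    · exact Continuous.subtype_mk (A.continuous.comp continuous_subtype_val) _
    · intro x y h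
      exact Subtype.ext (A.injective (congrArg Subtype.val h))
  unfold sphereFourier
  rw [← (measurePreserving_sphereMeasure A).integral_comp hme]
  simp

/-- Two vectors of equal norm are exchanged by the reflection in the hyperplane orthogonal to their
difference. -/
lemma sphereFourier_eq_of_norm_eq {x y : EuclideanSpace ℝ (Fin n)} (h : ‖x‖ = ‖y‖) :
    sphereFourier x = sphereFourier y := by
  rw [← Submodule.reflection_sub h, sphereFourier_isometry]

/-- The radial profile of the Fourier transform of the sphere, and its first two derivatives, given
as the moments of the `i₀`-th coordinate. -/
noncomputable def sphereMoment (i₀ : Fin n) (j : ℕ) (ρ : ℝ) : ℂ :=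
  ∫ η : Metric.sphere (0 : EuclideanSpace ℝ (Fin n)) 1,
    (Complex.I * ((η : EuclideanSpace ℝ (Fin n)) i₀ : ℂ)) ^ j *
      Complex.exp (Complex.I * ((ρ * (η : EuclideanSpace ℝ (Fin n)) i₀ : ℝ) : ℂ)) ∂sphereMeasure n

lemma hasDerivAt_sphereMoment (i₀ : Fin n) (j : ℕ) (ρ : ℝ) :
    HasDerivAt (sphereMoment i₀ j) (sphereMoment i₀ (j + 1) ρ) ρ := by
  have h := hasDerivAt_integral_mul_exp (sphereMeasure n)
    (a := fun η => (Complex.I * ((η : EuclideanSpace ℝ (Fin n)) i₀ : ℂ)) ^ j) (c := fun _ => 0)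
    (d := fun η => (η : EuclideanSpace ℝ (Fin n)) i₀) (by fun_prop) (by fun_prop) (by fun_prop) ρ
  simp only [zero_add] at h
  refine h.congr_deriv ?_
  unfold sphereMoment
  congr 1
  ext η
  ring

lemma sphereFourier_eq_sphereMoment (i₀ : Fin n) (x : EuclideanSpace ℝ (Fin n)) :
    sphereFourier x = sphereMoment i₀ 0 ‖x‖ := by
  have h : ‖x‖ = ‖EuclideanSpace.single i₀ ‖x‖‖ := by simp
  rw [sphereFourier_eq_of_norm_eq h]
  unfold sphereFourier sphereMoment
  simp [EuclideanSpace.inner_single_right]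

/-- By radial symmetry the transform at `ρ e_{i₀} + ε e_j` is `F(√(ρ² + ε²))`, where `F` is its
radial profile. Its second derivative in `ε` at `0` is `F'(ρ)/ρ`; computed under the integral, it is
minus the left-hand side. -/
lemma integral_sq_coord_mul_exp {i₀ j : Fin n} (hj : j ≠ i₀) {ρ : ℝ} (hρ : 0 < ρ) :
    ∫ η : Metric.sphere (0 : EuclideanSpace ℝ (Fin n)) 1,
      (((η : EuclideanSpace ℝ (Fin n)) j : ℝ) : ℂ) ^ 2 *
      Complex.exp (Complex.I * ((ρ * (η : EuclideanSpace ℝ (Fin n)) i₀ : ℝ) : ℂ)) ∂sphereMeasure n =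
    -(sphereMoment i₀ 1 ρ / ρ) := by
  set N : ℝ → ℝ := fun ε => √(ρ ^ 2 + ε ^ 2) with hN
  have hNpos : ∀ ε, 0 < ρ ^ 2 + ε ^ 2 := fun ε => by positivity
  have hN0 : N 0 = ρ := by simp [hN, Real.sqrt_sq hρ.le]
  have hNd : ∀ ε, HasDerivAt N (ε / N ε) ε := by
    intro ε
    have h1 : HasDerivAt (fun ε : ℝ => ρ ^ 2 + ε ^ 2) (2 * ε) ε := by
      simpa using ((hasDerivAt_id ε).pow 2).const_add (ρ ^ 2)
    refine (h1.sqrt (hNpos ε).ne').congr_deriv ?_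
    simp only [hN]
    have := Real.sqrt_pos.2 (hNpos ε)
    field_simp
  have hG : ∀ ε : ℝ, ∫ η : Metric.sphere (0 : EuclideanSpace ℝ (Fin n)) 1,
      1 * Complex.exp (Complex.I * ((ρ * (η : EuclideanSpace ℝ (Fin n)) i₀ +
        ε * (η : EuclideanSpace ℝ (Fin n)) j : ℝ) : ℂ)) ∂sphereMeasure n =
      sphereMoment i₀ 0 (N ε) := by
    intro ε
    have hn : ‖EuclideanSpace.single i₀ ρ + EuclideanSpace.single j ε‖ = N ε := by
      rw [hN, ← Real.sqrt_sq (norm_nonneg _), sq, norm_add_sq_eq_norm_sq_add_norm_sq_real]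
      · simp [← sq]
      · simp [EuclideanSpace.inner_single_left, hj.symm]
    rw [← hn, ← sphereFourier_eq_sphereMoment]
    unfold sphereFourier
    simp [inner_add_right, EuclideanSpace.inner_single_right]
  have hd1 : ∀ ε : ℝ, ∫ η : Metric.sphere (0 : EuclideanSpace ℝ (Fin n)) 1,
      (Complex.I * (1 * (((η : EuclideanSpace ℝ (Fin n)) j : ℝ) : ℂ))) *
      Complex.exp (Complex.I * ((ρ * (η : EuclideanSpace ℝ (Fin n)) i₀ +
        ε * (η : EuclideanSpace ℝ (Fin n)) j : ℝ) : ℂ)) ∂sphereMeasure n =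
      (ε : ℂ) * (((N ε)⁻¹ : ℝ) * sphereMoment i₀ 1 (N ε)) := by
    intro ε
    have h := hasDerivAt_integral_mul_exp (sphereMeasure n) (a := fun _ => 1)
      (c := fun η => ρ * (η : EuclideanSpace ℝ (Fin n)) i₀)
      (d := fun η => (η : EuclideanSpace ℝ (Fin n)) j) (by fun_prop) (by fun_prop) (by fun_prop) ε
    simp only [hG] at h
    refine h.unique ?_
    refine ((hasDerivAt_sphereMoment i₀ 0 (N ε)).scomp ε (hNd ε)).congr_deriv ?_
    rw [zero_add, Complex.real_smul]
    push_cast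
    ring
  have h2 := hasDerivAt_integral_mul_exp (sphereMeasure n)
    (a := fun η => Complex.I * (1 * (((η : EuclideanSpace ℝ (Fin n)) j : ℝ) : ℂ)))
    (c := fun η => ρ * (η : EuclideanSpace ℝ (Fin n)) i₀)
    (d := fun η => (η : EuclideanSpace ℝ (Fin n)) j) (by fun_prop) (by fun_prop) (by fun_prop) 0
  simp only [hd1] at h2
  have hNne : N 0 ≠ 0 := by rw [hN0]; exact hρ.ne'
  -- The first derivative is `ε` times this function, so at `ε = 0` the product rule uses only its
  -- value there and its differentiability.
  have h3 : DifferentiableAt ℝ (fun ε => (((N ε)⁻¹ : ℝ) : ℂ) * sphereMoment i₀ 1 (N ε)) 0 :=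
    (((hNd 0).inv hNne).ofReal_comp.differentiableAt).mul
      ((hasDerivAt_sphereMoment i₀ 1 (N 0)).scomp 0 (hNd 0)).differentiableAt
  have h4 := ((hasDerivAt_id (0 : ℝ)).ofReal_comp).mul h3.hasDerivAt
  have h5 := h2.unique h4
  simp only [id, Complex.ofReal_zero, zero_mul, add_zero, Complex.ofReal_one, one_mul, hN0] at h5
  calc _ = -∫ η : Metric.sphere (0 : EuclideanSpace ℝ (Fin n)) 1,
      Complex.I * (Complex.I * (((η : EuclideanSpace ℝ (Fin n)) j : ℝ) : ℂ) *
        (((η : EuclideanSpace ℝ (Fin n)) j : ℝ) : ℂ)) *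
      Complex.exp (Complex.I * ((ρ * (η : EuclideanSpace ℝ (Fin n)) i₀ : ℝ) : ℂ))
        ∂sphereMeasure n := by
        rw [← integral_neg]
        congr 1
        ext η
        linear_combination ((((η : EuclideanSpace ℝ (Fin n)) j : ℝ) : ℂ) ^ 2 *
          Complex.exp (Complex.I * ((ρ * (η : EuclideanSpace ℝ (Fin n)) i₀ : ℝ) : ℂ))) *
          Complex.I_sq
    _ = _ := by
        rw [h5]
        push_cast
        ring

/-- The radial Helmholtz equation. -/
lemma sphereMoment_two (i₀ : Fin n) {ρ : ℝ} (hρ : 0 < ρ) :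
    sphereMoment i₀ 2 ρ + (((n : ℝ) - 1) / ρ : ℝ) * sphereMoment i₀ 1 ρ + sphereMoment i₀ 0 ρ = 0 := by
  have hint : ∀ j : Fin n, Integrable (fun η : Metric.sphere (0 : EuclideanSpace ℝ (Fin n)) 1 =>
      (((η : EuclideanSpace ℝ (Fin n)) j : ℝ) : ℂ) ^ 2 *
      Complex.exp (Complex.I * ((ρ * (η : EuclideanSpace ℝ (Fin n)) i₀ : ℝ) : ℂ)))
      (sphereMeasure n) := fun j =>
    Continuous.integrable_of_hasCompactSupport (by fun_prop) (HasCompactSupport.of_compactSpace _)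
  -- On the unit sphere `1 = ∑ η_j²`: the `i₀` term is minus the second moment, each of the other `n
  -- - 1` terms is given by the preceding lemma.
  have h0 : sphereMoment i₀ 0 ρ = ∑ j : Fin n,
      ∫ η : Metric.sphere (0 : EuclideanSpace ℝ (Fin n)) 1,
      (((η : EuclideanSpace ℝ (Fin n)) j : ℝ) : ℂ) ^ 2 *
      Complex.exp (Complex.I * ((ρ * (η : EuclideanSpace ℝ (Fin n)) i₀ : ℝ) : ℂ))
        ∂sphereMeasure n := by
    rw [← integral_finsetSum _ fun j _ => hint j]
    unfold sphereMoment
    congr 1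
    ext η
    rw [← Finset.sum_mul, pow_zero]
    congr 1
    have h1 : ‖(η : EuclideanSpace ℝ (Fin n))‖ = 1 := by simp
    have h2 := EuclideanSpace.real_norm_sq_eq (η : EuclideanSpace ℝ (Fin n))
    rw [h1, one_pow] at h2
    exact_mod_cast h2
  have h2 : sphereMoment i₀ 2 ρ = -∫ η : Metric.sphere (0 : EuclideanSpace ℝ (Fin n)) 1,
      (((η : EuclideanSpace ℝ (Fin n)) i₀ : ℝ) : ℂ) ^ 2 *
      Complex.exp (Complex.I * ((ρ * (η : EuclideanSpace ℝ (Fin n)) i₀ : ℝ) : ℂ))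
        ∂sphereMeasure n := by
    rw [← integral_neg]
    unfold sphereMoment
    congr 1
    ext η
    rw [mul_pow, Complex.I_sq]
    ring
  rw [← Finset.add_sum_erase _ _ (Finset.mem_univ i₀), Finset.sum_congr rfl fun j hj =>
    integral_sq_coord_mul_exp (Finset.ne_of_mem_erase hj) hρ] at h0
  rw [h0, h2, Finset.sum_const, Finset.card_erase_of_mem (Finset.mem_univ _), Finset.card_univ,
    Fintype.card_fin, nsmul_eq_mul, Nat.cast_sub (Nat.one_le_of_lt i₀.2)]
  push_cast
  ring

end Sphere

/-! ### Plane-wave decomposition of the Fourier transform of the sphere. -/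

/-- Solutions of `w'' = (κ / ρ² - 1) w` are bounded at infinity, with their first derivatives. -/
lemma exists_bound_of_hasDerivAt_inverse_square {κ ρ₀ : ℝ} (hρ₀ : 0 < ρ₀) {w w' : ℝ → ℂ}
    (hw : ∀ ρ, ρ₀ ≤ ρ → HasDerivAt w (w' ρ) ρ)
    (hw' : ∀ ρ, ρ₀ ≤ ρ → HasDerivAt w' (((κ / ρ ^ 2 - 1 : ℝ) : ℂ) * w ρ) ρ) :
    ∃ M : ℝ, 0 ≤ M ∧ ∀ ρ, ρ₀ ≤ ρ → ‖w ρ‖ ≤ M ∧ ‖w' ρ‖ ≤ M := by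
  -- The oscillator energy: the `-1` in the equation cancels in its derivative, leaving only the
  -- perturbation `κ/ρ²`.
  set E : ℝ → ℝ := fun ρ => ‖w ρ‖ ^ 2 + ‖w' ρ‖ ^ 2 with hE
  have hEd : ∀ ρ, ρ₀ ≤ ρ → HasDerivAt E (2 * (κ / ρ ^ 2 * inner ℝ (w ρ) (w' ρ))) ρ := by
    intro ρ hρ
    refine ((hw ρ hρ).norm_sq.add (hw' ρ hρ).norm_sq).congr_deriv ?_
    rw [← Complex.real_smul, real_inner_smul_right, real_inner_comm (w ρ)]
    ring
  have hexp : ∀ ρ, ρ₀ ≤ ρ → HasDerivAt (fun ρ => Real.exp (|κ| * ρ⁻¹))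
      (Real.exp (|κ| * ρ⁻¹) * (|κ| * (-(ρ ^ 2)⁻¹))) ρ := fun ρ hρ =>
    (((hasDerivAt_inv (hρ₀.trans_le hρ).ne').const_mul |κ|)).exp
  -- Grönwall's argument: `E' ≤ |κ| E / ρ²`, and `|κ|/ρ` is a decreasing primitive of `-|κ|/ρ²`.
  have hmain : AntitoneOn (fun ρ => E ρ * Real.exp (|κ| * ρ⁻¹)) (Ici ρ₀) := by
    refine antitoneOn_of_deriv_nonpos (convex_Ici _)
      (fun ρ hρ => ((hEd ρ hρ).mul (hexp ρ hρ)).continuousAt.continuousWithinAt)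
      (fun ρ hρ => ?_) fun ρ hρ => ?_
    · rw [interior_Ici] at hρ
      exact ((hEd ρ (le_of_lt hρ)).mul (hexp ρ (le_of_lt hρ))).differentiableAt.differentiableWithinAt
    · rw [interior_Ici] at hρ
      have hρ' : ρ₀ ≤ ρ := le_of_lt hρ
      have hp : 0 < ρ := hρ₀.trans hρ
      have hd := ((hEd ρ hρ').mul (hexp ρ hρ')).deriv
      rw [show (fun ρ => E ρ * Real.exp (|κ| * ρ⁻¹)) = E * fun ρ => Real.exp (|κ| * ρ⁻¹) from rfl, hd]
      have h1 : κ * inner ℝ (w ρ) (w' ρ) ≤ |κ| * (‖w ρ‖ * ‖w' ρ‖) :=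
        (le_abs_self _).trans (by
          rw [abs_mul]
          exact mul_le_mul_of_nonneg_left (abs_real_inner_le_norm _ _) (abs_nonneg _))
      have h2 : 2 * (κ * inner ℝ (w ρ) (w' ρ)) ≤ |κ| * E ρ := by
        have h3 : 2 * (‖w ρ‖ * ‖w' ρ‖) ≤ E ρ := by
          simp only [hE]; nlinarith [sq_nonneg (‖w ρ‖ - ‖w' ρ‖)]
        have h4 := mul_le_mul_of_nonneg_left h3 (abs_nonneg κ)
        linarith
      have h5 : 2 * (κ / ρ ^ 2 * inner ℝ (w ρ) (w' ρ)) * Real.exp (|κ| * ρ⁻¹) +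
          E ρ * (Real.exp (|κ| * ρ⁻¹) * (|κ| * -(ρ ^ 2)⁻¹)) =
          (2 * (κ * inner ℝ (w ρ) (w' ρ)) - |κ| * E ρ) * ((ρ ^ 2)⁻¹ * Real.exp (|κ| * ρ⁻¹)) := by
        field_simp
        ring
      rw [h5]
      exact mul_nonpos_of_nonpos_of_nonneg (by linarith) (by positivity)
  have hb : ∀ ρ, ρ₀ ≤ ρ → E ρ ≤ E ρ₀ * Real.exp (|κ| * ρ₀⁻¹) := by
    intro ρ hρ
    have h1 := hmain (mem_Ici.2 le_rfl) (mem_Ici.2 hρ) hρ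
    have hp : 0 < ρ := hρ₀.trans_le hρ
    refine le_trans ?_ h1
    refine le_mul_of_one_le_right (by simp only [hE]; positivity) (Real.one_le_exp (by positivity))
  refine ⟨√(E ρ₀ * Real.exp (|κ| * ρ₀⁻¹)), Real.sqrt_nonneg _, fun ρ hρ => ⟨?_, ?_⟩⟩ <;>
  · refine Real.le_sqrt_of_sq_le (le_trans ?_ (hb ρ hρ))
    simp only [hE]
    nlinarith [sq_nonneg ‖w ρ‖, sq_nonneg ‖w' ρ‖]

/-- The Fourier transform of the sphere is `ρ^(-(n-1)/2)` times the sum of two plane waves with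
slowly varying amplitudes. -/
lemma exists_sphereMoment_eq_exp_mul_add {n : ℕ} (i₀ : Fin n) {ρ₀ : ℝ} (hρ₀ : 0 < ρ₀) :
    ∃ (M : ℝ) (α α' : ℝ → ℝ → ℂ), 0 ≤ M ∧
      (∀ ρ, ρ₀ ≤ ρ → sphereMoment i₀ 0 ρ = ((ρ ^ (-(((n : ℝ) - 1) / 2)) : ℝ) : ℂ) *
        (Complex.exp (Complex.I * ((1 * ρ : ℝ) : ℂ)) * α 1 ρ +
          Complex.exp (Complex.I * (((-1) * ρ : ℝ) : ℂ)) * α (-1) ρ)) ∧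
      ∀ ε : ℝ, |ε| = 1 → ∀ ρ, ρ₀ ≤ ρ → HasDerivAt (α ε) (α' ε ρ) ρ ∧ ContinuousAt (α' ε) ρ ∧
        ‖α ε ρ‖ ≤ M ∧ ‖α' ε ρ‖ ≤ M / ρ ^ 2 := by
  set ν : ℝ := ((n : ℝ) - 1) / 2 with hν
  set κ : ℝ := ν * (ν - 1) with hκ
  set w : ℝ → ℂ := fun ρ => ((ρ ^ ν : ℝ) : ℂ) * sphereMoment i₀ 0 ρ with hwdef
  set w' : ℝ → ℂ := fun ρ => ((ρ ^ ν : ℝ) : ℂ) * sphereMoment i₀ 1 ρ +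
    ((ν * ρ ^ (ν - 1) : ℝ) : ℂ) * sphereMoment i₀ 0 ρ with hw'def
  have hw : ∀ ρ, 0 < ρ → HasDerivAt w (w' ρ) ρ := by
    intro ρ hρ
    refine (((Real.hasDerivAt_rpow_const (p := ν) (Or.inl hρ.ne')).ofReal_comp).mul
      (hasDerivAt_sphereMoment i₀ 0 ρ)).congr_deriv ?_
    simp only [hw'def, zero_add]
    ring
  have hw' : ∀ ρ, 0 < ρ → HasDerivAt w' (((κ / ρ ^ 2 - 1 : ℝ) : ℂ) * w ρ) ρ := by
    intro ρ hρ
    refine ((((Real.hasDerivAt_rpow_const (p := ν) (Or.inl hρ.ne')).ofReal_comp).mul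
      (hasDerivAt_sphereMoment i₀ 1 ρ)).add
      ((((Real.hasDerivAt_rpow_const (p := ν - 1) (Or.inl hρ.ne')).const_mul ν).ofReal_comp).mul
      (hasDerivAt_sphereMoment i₀ 0 ρ))).congr_deriv ?_
    have h := sphereMoment_two i₀ hρ
    rw [show ((n : ℝ) - 1) = 2 * ν by rw [hν]; ring] at h
    have h2 : sphereMoment i₀ 2 ρ = -(((2 * ν / ρ : ℝ) : ℂ) * sphereMoment i₀ 1 ρ) -
      sphereMoment i₀ 0 ρ := by linear_combination h
    simp only [hwdef, zero_add, one_add_one_eq_two, h2, Real.rpow_sub_one hρ.ne', hκ]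
    have hρc : (ρ : ℂ) ≠ 0 := by exact_mod_cast hρ.ne'
    push_cast
    field_simp
    ring
  obtain ⟨M, hM0, hM⟩ := exists_bound_of_hasDerivAt_inverse_square hρ₀
    (fun ρ hρ => hw ρ (hρ₀.trans_le hρ)) (fun ρ hρ => hw' ρ (hρ₀.trans_le hρ))
  have hE1 : ∀ r : ℝ, ‖Complex.exp (Complex.I * r)‖ = 1 := fun r => by
    rw [mul_comm]; exact Complex.norm_exp_ofReal_mul_I _
  -- The amplitude `e^{-iερ} (w - iε w')/2` would be constant if `κ` were zero, so its derivative
  -- keeps only the term `κ/ρ²`. The two values `ε = ±1` recombine to `w`.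
  refine ⟨M * (1 + |κ|),
    fun ε ρ => Complex.exp (Complex.I * ((-(ε * ρ) : ℝ) : ℂ)) * (w ρ - Complex.I * ε * w' ρ) / 2,
    fun ε ρ => Complex.exp (Complex.I * ((-(ε * ρ) : ℝ) : ℂ)) *
      (-(Complex.I * ε) * (((κ / ρ ^ 2 : ℝ) : ℂ) * w ρ)) / 2,
    by positivity, ?_, ?_⟩
  · intro ρ hρ
    have hp : 0 < ρ := hρ₀.trans_le hρ
    have e1 : ∀ z : ℂ, Complex.exp (Complex.I * ((1 * ρ : ℝ) : ℂ)) *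
        (Complex.exp (Complex.I * ((-(1 * ρ) : ℝ) : ℂ)) * z / 2) = z / 2 := fun z => by
      rw [mul_div_assoc, ← mul_assoc, ← Complex.exp_add]
      simp
    have e2 : ∀ z : ℂ, Complex.exp (Complex.I * (((-1) * ρ : ℝ) : ℂ)) *
        (Complex.exp (Complex.I * ((-((-1) * ρ) : ℝ) : ℂ)) * z / 2) = z / 2 := fun z => by
      rw [mul_div_assoc, ← mul_assoc, ← Complex.exp_add]
      simp
    simp only [e1, e2]
    have h1 : ((ρ ^ (-ν) : ℝ) : ℂ) * ((ρ ^ ν : ℝ) : ℂ) = 1 := by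
      rw [← Complex.ofReal_mul, ← Real.rpow_add hp]
      simp
    simp only [hwdef]
    push_cast
    linear_combination (-sphereMoment i₀ 0 ρ) * h1
  · intro ε hε ρ hρ
    have hp : 0 < ρ := hρ₀.trans_le hρ
    have hε2 : (ε : ℂ) ^ 2 = 1 := by
      have : ε ^ 2 = 1 := by rw [← sq_abs, hε, one_pow]
      exact_mod_cast this
    have hεn : ‖(ε : ℂ)‖ = 1 := by rw [Complex.norm_real]; exact hε
    have hexp : HasDerivAt (fun ρ : ℝ => Complex.exp (Complex.I * ((-(ε * ρ) : ℝ) : ℂ)))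
        (Complex.exp (Complex.I * ((-(ε * ρ) : ℝ) : ℂ)) * (Complex.I * ((-ε : ℝ) : ℂ))) ρ := by
      have h1 : HasDerivAt (fun ρ : ℝ => -(ε * ρ)) (-ε) ρ := by
        simpa using ((hasDerivAt_id ρ).const_mul ε).fun_neg
      exact (h1.ofReal_comp.const_mul Complex.I).cexp
    obtain ⟨hM1, hM2⟩ := hM ρ hρ
    refine ⟨?_, ?_, ?_, ?_⟩
    · refine ((hexp.mul ((hw ρ hp).sub ((hw' ρ hp).const_mul (Complex.I * ε)))).div_const 2).congr_deriv ?_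
      simp only [Pi.sub_apply]
      push_cast
      linear_combination (Complex.exp (Complex.I * -(ε * ρ)) * w' ρ / 2) *
        ((ε : ℂ) ^ 2 * Complex.I_sq - hε2)
    · have hwc : ContinuousAt w ρ := (hw ρ hp).continuousAt
      have hk : ContinuousAt (fun ρ : ℝ => κ / ρ ^ 2) ρ :=
        continuousAt_const.div (by fun_prop) (by positivity)
      exact ((hexp.continuousAt).mul (continuousAt_const.mul
        ((Complex.continuous_ofReal.continuousAt.comp hk).mul hwc))).div_const 2
    · rw [norm_div, norm_mul, hE1, one_mul]
      have : ‖w ρ - Complex.I * ε * w' ρ‖ ≤ M + M := by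
        refine (norm_sub_le _ _).trans (add_le_add hM1 ?_)
        rw [norm_mul, norm_mul, hεn, Complex.norm_I, one_mul, one_mul]
        exact hM2
      simp only [Complex.norm_ofNat]
      nlinarith [mul_nonneg hM0 (abs_nonneg κ)]
    · rw [norm_div, norm_mul, hE1, one_mul, norm_mul, norm_neg, norm_mul, hεn, Complex.norm_I,
        norm_mul, Complex.norm_real, Real.norm_eq_abs, abs_div, abs_of_pos (pow_pos hp 2)]
      simp only [Complex.norm_ofNat, one_mul]
      rw [div_mul_eq_mul_div, div_div, div_le_div_iff₀ (by positivity) (by positivity)]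
      have h1 : |κ| * ‖w ρ‖ ≤ |κ| * M := mul_le_mul_of_nonneg_left hM1 (abs_nonneg _)
      have h2 : |κ| * ‖w ρ‖ ≤ M * (1 + |κ|) * 2 := by
        nlinarith [mul_nonneg hM0 (abs_nonneg κ)]
      nlinarith [mul_le_mul_of_nonneg_right h2 (pow_pos hp 2).le]

/-! ### Fourier multipliers and their kernels. -/

section Multiplier

variable {n : ℕ}

/-- This is Fubini's theorem for `m ⊗ u`; no inversion theorem is involved, so integrability of `m`
and `u` is enough. -/
lemma fourierInv_mul_fourier {m u : EuclideanSpace ℝ (Fin n) → ℂ} (hm : Integrable m)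
    (hu : Integrable u) (x : EuclideanSpace ℝ (Fin n)) :
    𝓕⁻ (fun ξ => m ξ * 𝓕 u ξ) x = ∫ y, u y * 𝓕⁻ m (x - y) := by
  simp only [Real.fourierInv_eq, Real.fourier_eq, Circle.smul_def, smul_eq_mul]
  have h1 : ∀ ξ : EuclideanSpace ℝ (Fin n), ((Real.fourierChar (inner ℝ ξ x) : Circle) : ℂ) *
      (m ξ * ∫ y, ((Real.fourierChar (-inner ℝ y ξ) : Circle) : ℂ) * u y) =
      ∫ y, ((Real.fourierChar (inner ℝ ξ (x - y)) : Circle) : ℂ) * (m ξ * u y) := by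
    intro ξ
    rw [← integral_const_mul, ← integral_const_mul]
    congr 1
    ext y
    have : ((Real.fourierChar (inner ℝ ξ (x - y)) : Circle) : ℂ) =
        (Real.fourierChar (inner ℝ ξ x) : Circle) * (Real.fourierChar (-inner ℝ y ξ) : Circle) := by
      rw [← Circle.coe_mul, ← AddChar.map_add_eq_mul, inner_sub_right, real_inner_comm y ξ,
        sub_eq_add_neg]
    rw [this]
    ring
  simp only [h1]
  rw [integral_integral_swap]
  · congr 1
    ext y
    rw [← integral_const_mul]
    congr 1
    ext ξ
    ring
  · refine (hm.mul_prod hu).bdd_mul (c := 1) (Continuous.aestronglyMeasurable ?_) ?_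
    · have h2 : Continuous fun p : EuclideanSpace ℝ (Fin n) × EuclideanSpace ℝ (Fin n) =>
          (inner ℝ p.1 (x - p.2) : ℝ) := by fun_prop
      exact continuous_subtype_val.comp (Real.continuous_fourierChar.comp h2)
    · exact Filter.Eventually.of_forall fun p => (Circle.norm_coe _).le

lemma fourierInv_norm_mul_fourier_le {m u : EuclideanSpace ℝ (Fin n) → ℂ} (hm : Integrable m)
    (hu : Integrable u) {B : ℝ} (hB : ∀ x, ‖𝓕⁻ m x‖ ≤ B) :
    eLpNorm (𝓕⁻ (fun ξ => m ξ * 𝓕 u ξ)) ∞ volume ≤ ENNReal.ofReal B * eLpNorm u 1 volume := by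
  have hB0 : 0 ≤ B := (norm_nonneg _).trans (hB 0)
  rw [eLpNorm_exponent_top]
  refine eLpNormEssSup_le_of_ae_enorm_bound (Filter.Eventually.of_forall fun x => ?_)
  rw [fourierInv_mul_fourier hm hu, eLpNorm_one_eq_lintegral_enorm,
    ← lintegral_const_mul' _ _ ENNReal.ofReal_ne_top]
  refine (enorm_integral_le_lintegral_enorm _).trans (lintegral_mono fun y => ?_)
  rw [enorm_mul, mul_comm]
  gcongr
  rw [← ofReal_norm]
  exact ENNReal.ofReal_le_ofReal (hB _)

/-- The propagator acts on the output of a projector, so the two symbols can be merged only after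
Fourier inversion on that output. It is the convolution of `u` with a Schwartz kernel, hence
integrable. -/
lemma fourier_fourierInv_mul_fourier {m u : EuclideanSpace ℝ (Fin n) → ℂ} (hm : ContDiff ℝ ∞ m)
    (hmc : HasCompactSupport m) (hu : Integrable u) :
    𝓕 (𝓕⁻ (fun ξ => m ξ * 𝓕 u ξ)) = fun ξ => m ξ * 𝓕 u ξ := by
  have hmi : Integrable m := hm.continuous.integrable_of_hasCompactSupport hmc
  have hFu : Continuous (𝓕 u) :=
    VectorFourier.fourierIntegral_continuous Real.continuous_fourierChar continuous_inner hu
  have hc : Continuous fun ξ => m ξ * 𝓕 u ξ := hm.continuous.mul hFu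
  have hki : Integrable (𝓕⁻ m) := by
    have h1 := (𝓕⁻ (hmc.toSchwartzMap hm)).integrable (μ := volume)
    rw [SchwartzMap.fourierInv_coe] at h1
    exact h1
  refine hc.fourier_fourierInv_eq (hc.integrable_of_hasCompactSupport hmc.mul_right) ?_
  have h2 : Integrable (𝓕⁻ (fun ξ => m ξ * 𝓕 u ξ)) := by
    have h3 : 𝓕⁻ (fun ξ => m ξ * 𝓕 u ξ) =
        convolution u (𝓕⁻ m) (ContinuousLinearMap.mul ℝ ℂ) volume := by
      ext x
      rw [fourierInv_mul_fourier hmi hu]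
      rfl
    rw [h3]
    exact hu.integrable_convolution _ hki
  have h4 := h2.comp_neg
  refine h4.congr (Filter.Eventually.of_forall fun x => ?_)
  simp only
  rw [Real.fourierInv_eq_fourier_neg, neg_neg]

lemma multiplier_multiplier {σ a u : EuclideanSpace ℝ (Fin n) → ℂ} (ha : ContDiff ℝ ∞ a)
    (hac : HasCompactSupport a) (hu : Integrable u) :
    multiplier σ (multiplier a u) = multiplier (fun ξ => σ ξ * a ξ) u := by
  have h2 : (2 * Real.pi) ≠ 0 := by positivity
  have h1 : 𝓕 (multiplier a u) = fun ξ => a ((2 * Real.pi) • ξ) * 𝓕 u ξ :=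
    fourier_fourierInv_mul_fourier (ha.comp (contDiff_const_smul _))
      (hac.comp_smul h2) hu
  unfold multiplier at h1 ⊢
  rw [h1]
  congr 1
  ext ξ
  ring

/-- The kernel `∫ exp (i x · ξ) m(ξ) dξ` bounds the multiplier from `L¹` to `L^∞`. -/
lemma eLpNorm_multiplier_le {m u : EuclideanSpace ℝ (Fin n) → ℂ} (hm : Integrable m)
    (hu : Integrable u) {B : ℝ} (hB : ∀ x : EuclideanSpace ℝ (Fin n),
      ‖∫ ξ, Complex.exp (Complex.I * ((inner ℝ ξ x : ℝ) : ℂ)) * m ξ‖ ≤ B) :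
    eLpNorm (multiplier m u) ∞ volume ≤ ENNReal.ofReal B * eLpNorm u 1 volume := by
  have hB0 : 0 ≤ B := (norm_nonneg _).trans (hB 0)
  have h2 : (2 * Real.pi) ≠ 0 := by positivity
  refine fourierInv_norm_mul_fourier_le (hm.comp_smul h2) hu fun x => ?_
  rw [Real.fourierInv_eq]
  have h3 : ∀ ξ : EuclideanSpace ℝ (Fin n), Real.fourierChar (inner ℝ ξ x) • m ((2 * Real.pi) • ξ) =
      (fun ζ => Complex.exp (Complex.I * ((inner ℝ ζ x : ℝ) : ℂ)) * m ζ) ((2 * Real.pi) • ξ) := by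
    intro ξ
    simp only [Circle.smul_def, smul_eq_mul, Real.fourierChar_apply, real_inner_smul_left]
    congr 2
    push_cast
    ring
  rw [integral_congr_ae (Filter.Eventually.of_forall h3), Measure.integral_comp_smul volume
    (fun ζ => Complex.exp (Complex.I * ((inner ℝ ζ x : ℝ) : ℂ)) * m ζ), norm_smul]
  -- Undoing the dilation by `2π` costs the factor `(2π)^{-n} ≤ 1`.
  refine (mul_le_of_le_one_left (norm_nonneg _) ?_).trans (hB x)
  rw [Real.norm_eq_abs, abs_abs, abs_inv, abs_of_pos (by positivity)]
  refine inv_le_one_of_one_le₀ (one_le_pow₀ ?_)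
  nlinarith [Real.pi_gt_three]

end Multiplier

/-! ### Polar coordinates for radial symbols. -/

section Polar

variable {n : ℕ}

lemma integral_eq_integral_Ioi_sphere (i₀ : Fin n) {f : EuclideanSpace ℝ (Fin n) → ℂ}
    (hf : Integrable f) :
    ∫ x, f x = ∫ r in Ioi (0 : ℝ), ((r ^ (n - 1) : ℝ) : ℂ) *
      ∫ η : Metric.sphere (0 : EuclideanSpace ℝ (Fin n)) 1,
        f (r • (η : EuclideanSpace ℝ (Fin n))) ∂sphereMeasure n := by
  have : Nonempty (Fin n) := ⟨i₀⟩
  have hdim : Module.finrank ℝ (EuclideanSpace ℝ (Fin n)) = n := finrank_euclideanSpace_fin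
  have hmp := (volume : Measure (EuclideanSpace ℝ (Fin n))).measurePreserving_homeomorphUnitSphereProd
  have hemb := (homeomorphUnitSphereProd (EuclideanSpace ℝ (Fin n))).measurableEmbedding
  rw [hdim] at hmp
  have hval : ∀ x : ({0}ᶜ : Set (EuclideanSpace ℝ (Fin n))),
      f (((homeomorphUnitSphereProd (EuclideanSpace ℝ (Fin n)) x).2 : ℝ) •
        ((homeomorphUnitSphereProd (EuclideanSpace ℝ (Fin n)) x).1 : EuclideanSpace ℝ (Fin n))) =
      f x := by
    intro x
    have hx : ‖(x : EuclideanSpace ℝ (Fin n))‖ ≠ 0 := norm_ne_zero_iff.2 x.2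
    simp [smul_smul, hx]
  set g : Metric.sphere (0 : EuclideanSpace ℝ (Fin n)) 1 × Ioi (0 : ℝ) → ℂ :=
    fun p => f ((p.2 : ℝ) • (p.1 : EuclideanSpace ℝ (Fin n))) with hg
  have hgi : Integrable g ((sphereMeasure n).prod (Measure.volumeIoiPow (n - 1))) := by
    rw [← hmp.integrable_comp_emb hemb]
    have h1 : Integrable (fun x : ({0}ᶜ : Set (EuclideanSpace ℝ (Fin n))) => f x)
        (Measure.comap Subtype.val volume) := by
      have := hf.integrableOn (s := ({0}ᶜ : Set (EuclideanSpace ℝ (Fin n))))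
      rwa [integrableOn_iff_comap_subtypeVal (measurableSet_singleton _).compl] at this
    exact h1.congr (Filter.Eventually.of_forall fun x => (hval x).symm)
  calc ∫ x, f x = ∫ x : ({0}ᶜ : Set (EuclideanSpace ℝ (Fin n))), f x ∂(Measure.comap Subtype.val volume) := by
        rw [integral_subtype_comap (measurableSet_singleton _).compl fun x => f x,
          restrict_compl_singleton]
    _ = ∫ p, g p ∂((sphereMeasure n).prod (Measure.volumeIoiPow (n - 1))) := by
        rw [← hmp.integral_comp hemb]
        exact integral_congr_ae (Filter.Eventually.of_forall fun x => (hval x).symm)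
    _ = ∫ r, (∫ η, g (η, r) ∂sphereMeasure n) ∂(Measure.volumeIoiPow (n - 1)) :=
        integral_prod_symm _ hgi
    _ = _ := by
        simp only [Measure.volumeIoiPow, ENNReal.ofReal]
        rw [integral_withDensity_eq_integral_smul, integral_subtype_comap measurableSet_Ioi
          fun a => Real.toNNReal (a ^ (n - 1)) • ∫ η : Metric.sphere (0 : EuclideanSpace ℝ (Fin n)) 1,
            f (a • (η : EuclideanSpace ℝ (Fin n))) ∂sphereMeasure n]
        · refine setIntegral_congr_fun measurableSet_Ioi fun x hx => ?_
          rw [NNReal.smul_def, Real.coe_toNNReal _ (pow_nonneg (le_of_lt hx) _), Complex.real_smul]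
        · exact (measurable_subtype_coe.pow_const _).real_toNNReal

lemma integral_exp_inner_mul_radial (i₀ : Fin n) {h : ℝ → ℂ}
    (hh : Integrable fun ξ : EuclideanSpace ℝ (Fin n) => h ‖ξ‖) (x : EuclideanSpace ℝ (Fin n)) :
    ∫ ξ : EuclideanSpace ℝ (Fin n), Complex.exp (Complex.I * ((inner ℝ ξ x : ℝ) : ℂ)) * h ‖ξ‖ =
      ∫ r in Ioi (0 : ℝ), ((r ^ (n - 1) : ℝ) : ℂ) * h r * sphereMoment i₀ 0 (r * ‖x‖) := by
  rw [integral_eq_integral_Ioi_sphere i₀]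
  · refine setIntegral_congr_fun measurableSet_Ioi fun r hr => ?_
    have hr0 : (0 : ℝ) ≤ r := le_of_lt hr
    have h1 : r * ‖x‖ = ‖r • x‖ := by rw [norm_smul, Real.norm_of_nonneg hr0]
    rw [h1, ← sphereFourier_eq_sphereMoment, mul_assoc]
    congr 1
    unfold sphereFourier
    rw [← integral_const_mul]
    congr 1
    ext η
    rw [real_inner_smul_left, real_inner_smul_right, norm_smul, Real.norm_of_nonneg hr0,
      norm_eq_of_mem_sphere η, mul_one, mul_comm]
  · refine hh.bdd_mul (c := 1) (Continuous.aestronglyMeasurable (by fun_prop)) ?_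
    refine Filter.Eventually.of_forall fun ξ => ?_
    rw [mul_comm, Complex.norm_exp_ofReal_mul_I]

lemma norm_sphereMoment_zero_le (i₀ : Fin n) (ρ : ℝ) :
    ‖sphereMoment i₀ 0 ρ‖ ≤ (sphereMeasure n).real univ := by
  unfold sphereMoment
  refine (norm_integral_le_of_norm_le_const (C := 1) (Filter.Eventually.of_forall fun η => ?_)).trans
    (one_mul _).le
  rw [pow_zero, one_mul, mul_comm, Complex.norm_exp_ofReal_mul_I]

/-- With the sphere integral outside, each point of the sphere contributes a one-dimensional
integral with an extra linear phase of slope at most `|s|`, so bounds uniform in the slope suffice.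
-/
lemma intervalIntegral_mul_sphereMoment (i₀ : Fin n) {a b : ℝ} (hab : a ≤ b) {h : ℝ → ℂ}
    (hh : IntervalIntegrable h volume a b) (s : ℝ) :
    ∫ r in a..b, h r * sphereMoment i₀ 0 (r * s) =
      ∫ η : Metric.sphere (0 : EuclideanSpace ℝ (Fin n)) 1,
        (∫ r in a..b, Complex.exp (Complex.I *
          ((s * (η : EuclideanSpace ℝ (Fin n)) i₀ * r : ℝ) : ℂ)) * h r) ∂sphereMeasure n := by
  simp only [intervalIntegral.integral_of_le hab]
  rw [integral_integral_swap]
  · refine setIntegral_congr_fun measurableSet_Ioc fun r _ => ?_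
    rw [integral_mul_const, mul_comm]
    congr 1
    unfold sphereMoment
    congr 1
    ext η
    rw [pow_zero, one_mul]
    congr 3
    ring
  · have h1 : Integrable (fun p : Metric.sphere (0 : EuclideanSpace ℝ (Fin n)) 1 × ℝ =>
        (1 : ℂ) * h p.2) ((sphereMeasure n).prod (volume.restrict (Ioc a b))) :=
      (integrable_const (1 : ℂ)).mul_prod ((intervalIntegrable_iff_integrableOn_Ioc_of_le hab).1 hh)
    simp only [one_mul] at h1
    refine h1.bdd_mul (c := 1) (Continuous.aestronglyMeasurable (by fun_prop)) ?_
    refine Filter.Eventually.of_forall fun p => ?_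
    rw [mul_comm, Complex.norm_exp_ofReal_mul_I]

end Polar

/-! ### Radial oscillatory integrals on the unit shell. -/

namespace UniformlySmoothOn

variable {ι : Type*} {K : Set ℝ} {f g : ι → ℝ → ℝ}

lemma add_const (hf : UniformlySmoothOn K f) {v : ι → ℝ} {V : ℝ} (hv : ∀ i, |v i| ≤ V) :
    UniformlySmoothOn K (fun i r => v i + f i r) := by
  refine ⟨fun i r hr => contDiffAt_const.add (hf.1 i r hr), fun j => ?_⟩
  obtain ⟨C, hC⟩ := hf.2 j
  rcases Nat.eq_zero_or_pos j with rfl | hj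
  · refine ⟨V + C, fun i r hr => ?_⟩
    rw [iteratedDeriv_zero]
    exact (abs_add_le _ _).trans (add_le_add (hv i) (by simpa using hC i r hr))
  · exact ⟨C, fun i r hr => by rw [iteratedDeriv_const_add hj]; exact hC i r hr⟩

end UniformlySmoothOn

section RadialOscillation

variable {n : ℕ}

/-- The radial oscillatory integral attached to a dyadic shell. -/
noncomputable def radialOsc (i₀ : Fin n) (g b : ℝ → ℝ) (Λ s : ℝ) : ℂ :=
  ∫ r in (1 / 2 : ℝ)..2, Complex.exp (Complex.I * ((Λ * g r : ℝ) : ℂ)) * (b r : ℂ) *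
    sphereMoment i₀ 0 (r * s)

/-- A uniformly smooth family of phases without critical points on the shell `[1/2, 2]`. -/
structure IsPhaseFamily {ι : Type*} (g : ι → ℝ → ℝ) (c : ℝ) : Prop where
  contDiffAt : ∀ i, ∀ r ∈ Icc (1 / 2 : ℝ) 2, ContDiffAt ℝ ∞ (g i) r
  deriv_smooth : UniformlySmoothOn (Icc (1 / 2 : ℝ) 2) (fun i => deriv (g i))
  pos : 0 < c
  le_deriv : ∀ i, ∀ r ∈ Icc (1 / 2 : ℝ) 2, c ≤ |deriv (g i) r|

variable {ι : Type*} {g : ι → ℝ → ℝ} {c : ℝ} {b : ℝ → ℝ}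

lemma IsPhaseFamily.hasDerivAt (hg : IsPhaseFamily g c) (i : ι) {r : ℝ}
    (hr : r ∈ Icc (1 / 2 : ℝ) 2) : HasDerivAt (g i) (deriv (g i) r) r :=
  ((hg.contDiffAt i r hr).differentiableAt (by simp)).hasDerivAt

lemma IsPhaseFamily.continuousOn (hg : IsPhaseFamily g c) (i : ι) :
    ContinuousOn (g i) (Icc (1 / 2 : ℝ) 2) :=
  fun r hr => (hg.contDiffAt i r hr).continuousAt.continuousWithinAt

lemma norm_exp_I_mul_ofReal (r : ℝ) : ‖Complex.exp (Complex.I * r)‖ = 1 := by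
  rw [mul_comm]; exact Complex.norm_exp_ofReal_mul_I _

lemma exists_norm_radialOsc_le (i₀ : Fin n) (hb : ContDiff ℝ ∞ b) :
    ∃ C : ℝ, 0 ≤ C ∧ ∀ (g : ℝ → ℝ) (Λ s : ℝ), ‖radialOsc i₀ g b Λ s‖ ≤ C := by
  obtain ⟨B, hB⟩ := isCompact_Icc.exists_bound_of_continuousOn
    (hb.continuous.continuousOn (s := Icc (1 / 2 : ℝ) 2))
  have hB0 : 0 ≤ B := (norm_nonneg _).trans (hB 1 (by norm_num))
  refine ⟨B * (sphereMeasure n).real univ * |2 - 1 / 2|, by positivity, fun g Λ s => ?_⟩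
  refine intervalIntegral.norm_integral_le_of_norm_le_const fun r hr => ?_
  rw [uIoc_of_le (by norm_num)] at hr
  rw [norm_mul, norm_mul, norm_exp_I_mul_ofReal, one_mul, Complex.norm_real]
  exact mul_le_mul (hB r (Ioc_subset_Icc_self hr)) (norm_sphereMoment_zero_le _ _) (norm_nonneg _) hB0

/-- The full phase derivative is `Λ (s η_{i₀} / Λ + g')`. Its bracket has modulus at least `c -
c/2`, so nonstationary phase applies at every point `η` of the sphere. -/
lemma IsPhaseFamily.exists_pow_mul_radialOsc_le (hg : IsPhaseFamily g c) (i₀ : Fin n)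
    (hb : ContDiff ℝ ∞ b) (hb0 : ∀ r, r ∉ Icc (1 / 2 : ℝ) 2 → b r = 0) (N : ℕ) :
    ∃ C : ℝ, 0 ≤ C ∧ ∀ i Λ s, Λ ≠ 0 → |s| ≤ c / 2 * |Λ| →
      |Λ| ^ N * ‖radialOsc i₀ (g i) b Λ s‖ ≤ C := by
  have hc := hg.pos
  -- `Λ` and the slope join the index set: uniformity in them is then part of the uniformity over
  -- the family.
  let κ := {x : ι × ℝ × ℝ // x.2.1 ≠ 0 ∧ |x.2.2| ≤ c / 2 * |x.2.1|}
  have hv : ∀ x : κ, |x.1.2.2 / x.1.2.1| ≤ c / 2 := fun x => by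
    rw [abs_div, div_le_iff₀ (abs_pos.2 x.2.1)]
    exact x.2.2
  have hh : UniformlySmoothOn (Icc (1 / 2 : ℝ) 2)
      (fun (x : κ) r => x.1.2.2 / x.1.2.1 + deriv (g x.1.1) r) :=
    (hg.deriv_smooth.comp fun x : κ => x.1.1).add_const hv
  have hlow : ∀ x : κ, ∀ r ∈ Icc (1 / 2 : ℝ) 2,
      c / 2 ≤ |x.1.2.2 / x.1.2.1 + deriv (g x.1.1) r| := fun x r hr => by
    have h1 := hg.le_deriv x.1.1 r hr
    have h2 := abs_sub_abs_le_abs_sub (deriv (g x.1.1) r) (-(x.1.2.2 / x.1.2.1))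
    rw [abs_neg, sub_neg_eq_add, add_comm (deriv _ _)] at h2
    linarith [hv x]
  obtain ⟨C, hC0, hC⟩ := exists_pow_mul_norm_integral_exp_le (by norm_num : (1 / 2 : ℝ) ≤ 2)
    (p := fun (x : κ) r => x.1.2.2 * r + x.1.2.1 * g x.1.1 r)
    (p' := fun (x : κ) r => x.1.2.1 * (x.1.2.2 / x.1.2.1 + deriv (g x.1.1) r))
    (q := fun x => (fun r => x.1.2.2 / x.1.2.1 + deriv (g x.1.1) r)⁻¹) (Λ := fun x => x.1.2.1)
    (fun x r hr => by
      have h1 := ((hasDerivAt_id r).const_mul x.1.2.2).add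
        ((hg.hasDerivAt x.1.1 hr).const_mul x.1.2.1)
      refine h1.congr_deriv ?_
      have := x.2.1
      field_simp)
    (fun x r hr => by
      have h1 := hlow x r hr
      have h2 : x.1.2.2 / x.1.2.1 + deriv (g x.1.1) r ≠ 0 := fun h0 => by
        rw [h0, abs_zero] at h1; linarith
      simp only [Pi.inv_apply]
      rw [mul_assoc, mul_inv_cancel₀ h2, mul_one])
    (fun x => continuousOn_const.mul (hh.continuousOn x)) (hh.inv (half_pos hc) hlow) N
    (fun _ => b) (UniformlySmoothOn.of_contDiff hb isCompact_Icc) (fun _ => hb0)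
  refine ⟨C * (sphereMeasure n).real univ, by positivity, fun i Λ s hΛ hs => ?_⟩
  unfold radialOsc
  have hcont : ContinuousOn (fun r => Complex.exp (Complex.I * ((Λ * g i r : ℝ) : ℂ)) * (b r : ℂ))
      (Icc (1 / 2 : ℝ) 2) := by
    have h1 := hg.continuousOn i
    have h2 := hb.continuous
    fun_prop
  rw [intervalIntegral_mul_sphereMoment i₀ (by norm_num)
    (ContinuousOn.intervalIntegrable (by rwa [uIcc_of_le (by norm_num)]))]
  rw [← le_div_iff₀' (pow_pos (abs_pos.2 hΛ) N), mul_div_right_comm]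
  refine norm_integral_le_of_norm_le_const (Filter.Eventually.of_forall fun η => ?_)
  have hη : |(η : EuclideanSpace ℝ (Fin n)) i₀| ≤ 1 := by
    have := PiLp.norm_apply_le (η : EuclideanSpace ℝ (Fin n)) i₀
    rwa [norm_eq_of_mem_sphere η] at this
  have h1 := hC ⟨(i, Λ, s * (η : EuclideanSpace ℝ (Fin n)) i₀), hΛ, by
    rw [abs_mul]
    exact (mul_le_of_le_one_right (abs_nonneg _) hη).trans hs⟩
  rw [le_div_iff₀' (pow_pos (abs_pos.2 hΛ) N)]
  refine le_trans (le_of_eq ?_) h1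
  congr 2
  refine intervalIntegral.integral_congr fun r _ => ?_
  simp only
  rw [← mul_assoc, ← Complex.exp_add]
  push_cast
  ring_nf

/-- Only the decay of the sphere's transform is used; absolute values are taken inside the integral,
so the phase `g` is arbitrary. -/
lemma exists_norm_radialOsc_le_rpow (i₀ : Fin n) (hb : ContDiff ℝ ∞ b) {s₀ : ℝ} (hs₀ : 0 < s₀) :
    ∃ C : ℝ, 0 ≤ C ∧ ∀ (g : ℝ → ℝ) (Λ s : ℝ), s₀ ≤ s →
      ‖radialOsc i₀ g b Λ s‖ ≤ C * s ^ (-(((n : ℝ) - 1) / 2)) := by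
  have hn : (1 : ℝ) ≤ n := by exact_mod_cast Nat.one_le_of_lt i₀.2
  obtain ⟨B, hB⟩ := isCompact_Icc.exists_bound_of_continuousOn
    (hb.continuous.continuousOn (s := Icc (1 / 2 : ℝ) 2))
  have hB0 : 0 ≤ B := (norm_nonneg _).trans (hB 1 (by norm_num))
  obtain ⟨M, α, α', hM0, hF, hα⟩ := exists_sphereMoment_eq_exp_mul_add i₀ (half_pos hs₀)
  set ν : ℝ := ((n : ℝ) - 1) / 2 with hν
  have hν0 : 0 ≤ ν := by rw [hν]; linarith
  refine ⟨B * ((1 / 2 : ℝ) ^ (-ν) * (M + M)) * |2 - 1 / 2|, by positivity, fun g Λ s hs => ?_⟩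
  have hs' : 0 < s := hs₀.trans_le hs
  rw [mul_right_comm]
  refine intervalIntegral.norm_integral_le_of_norm_le_const fun r hr => ?_
  rw [uIoc_of_le (by norm_num)] at hr
  have hrs : s₀ / 2 ≤ r * s := by nlinarith [hr.1]
  rw [norm_mul, norm_mul, norm_exp_I_mul_ofReal, one_mul, Complex.norm_real, mul_assoc]
  refine mul_le_mul (hB r (Ioc_subset_Icc_self hr)) ?_ (norm_nonneg _) hB0
  rw [hF _ hrs, norm_mul, Complex.norm_real, Real.mul_rpow (by linarith [hr.1]) hs'.le,
    Real.norm_of_nonneg (by have := hr.1; positivity), mul_right_comm]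
  have h1 : r ^ (-ν) ≤ (1 / 2 : ℝ) ^ (-ν) :=
    Real.rpow_le_rpow_of_nonpos (by norm_num) hr.1.le (by linarith)
  have h2 := (hα 1 (by simp) _ hrs).2.2.1
  have h3 := (hα (-1) (by simp) _ hrs).2.2.1
  gcongr
  refine (norm_add_le _ _).trans ?_
  rw [norm_mul, norm_mul, norm_exp_I_mul_ofReal, norm_exp_I_mul_ofReal, one_mul, one_mul]
  exact add_le_add h2 h3

/-- The two plane waves turn the phase into `Λ g ± s r`. The linear term leaves the second
derivative unchanged, so van der Corput's test applies with lower bound `|Λ| μ`. -/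
lemma IsPhaseFamily.exists_norm_radialOsc_le_of_deriv2 (hg : IsPhaseFamily g c) (i₀ : Fin n)
    (hb : ContDiff ℝ ∞ b) {s₀ : ℝ} (hs₀ : 0 < s₀) :
    ∃ C : ℝ, 0 ≤ C ∧ ∀ i Λ s μ, s₀ ≤ s → Λ ≠ 0 → 0 < μ →
      (∀ r ∈ Icc (1 / 2 : ℝ) 2, μ ≤ |iteratedDeriv 2 (g i) r|) →
      ‖radialOsc i₀ (g i) b Λ s‖ ≤
        C * (s ^ (-(((n : ℝ) - 1) / 2)) * (|Λ| * μ) ^ (-(1 / 2 : ℝ))) := by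
  obtain ⟨M, α, α', hM0, hF, hα⟩ := exists_sphereMoment_eq_exp_mul_add i₀ (half_pos hs₀)
  set ν : ℝ := ((n : ℝ) - 1) / 2 with hν
  set β : ℝ → ℝ := fun r => b r * r ^ (-ν) with hβ
  have hβd : ContDiffOn ℝ 1 β (Ioi 0) := by
    refine (hb.of_le (by exact_mod_cast le_top)).contDiffOn.mul fun r hr => ?_
    exact (Real.contDiffAt_rpow_const_of_ne (ne_of_gt hr)).contDiffWithinAt
  have hKpos : ∀ r ∈ Icc (1 / 2 : ℝ) 2, 0 < r := fun r hr => by linarith [hr.1]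
  have hβ' : ∀ r ∈ Icc (1 / 2 : ℝ) 2, HasDerivAt β (deriv β r) r := fun r hr =>
    ((hβd.differentiableOn one_ne_zero).differentiableAt (Ioi_mem_nhds (hKpos r hr))).hasDerivAt
  have hβc : ContinuousOn β (Icc (1 / 2 : ℝ) 2) :=
    fun r hr => (hβ' r hr).continuousAt.continuousWithinAt
  have hβ'c : ContinuousOn (deriv β) (Icc (1 / 2 : ℝ) 2) :=
    (hβd.continuousOn_deriv_of_isOpen isOpen_Ioi le_rfl).mono fun r hr => hKpos r hr
  obtain ⟨B, hB⟩ := isCompact_Icc.exists_bound_of_continuousOn hβc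
  obtain ⟨B', hB'⟩ := isCompact_Icc.exists_bound_of_continuousOn hβ'c
  have hB0 : 0 ≤ B := (norm_nonneg _).trans (hB 1 (by norm_num))
  have hB0' : 0 ≤ B' := (norm_nonneg _).trans (hB' 1 (by norm_num))
  -- The van der Corput constant for the amplitude `β(r) α(rs)`. The chain-rule factor `s` is
  -- absorbed by `|α'(rs)| ≤ M/(rs)²`, with `r ≥ 1/2` and `s ≥ s₀`.
  set D : ℝ := 8 * (B * M) + (2 - 1 / 2) * (B' * M + B * (4 * M / s₀)) with hD
  have hD0 : 0 ≤ D := by positivity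
  refine ⟨D + D, by positivity, fun i Λ s μ hs hΛ hμ h2 => ?_⟩
  have hs' : 0 < s := hs₀.trans_le hs
  have hΛμ : 0 < |Λ| * μ := mul_pos (abs_pos.2 hΛ) hμ
  have hrs : ∀ r ∈ Icc (1 / 2 : ℝ) 2, s₀ / 2 ≤ r * s := fun r hr => by nlinarith [hr.1]
  have key : ∀ ε : ℝ, |ε| = 1 →
      ‖∫ r in (1 / 2 : ℝ)..2, Complex.exp (Complex.I * ((Λ * g i r + ε * s * r : ℝ) : ℂ)) *
        ((β r : ℂ) * α ε (r * s))‖ ≤ D / √(|Λ| * μ) := by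
    intro ε hε
    have hin : ∀ r, HasDerivAt (fun r : ℝ => r * s) s r := fun r => by
      simpa using (hasDerivAt_id r).mul_const s
    refine norm_integral_exp_mul_le_of_le_abs_deriv2 (by norm_num) hΛμ
      (p' := fun r => Λ * deriv (g i) r + ε * s)
      (p'' := fun r => Λ * deriv (deriv (g i)) r)
      (A' := fun r => ((deriv β r : ℝ) : ℂ) * α ε (r * s) + (β r : ℂ) * (s * α' ε (r * s)))
      ?_ ?_ ?_ ?_ ?_ ?_ ?_ ?_
    · intro r hr
      refine (((hg.hasDerivAt i hr).const_mul Λ).add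
        ((hasDerivAt_id r).const_mul (ε * s))).congr_deriv ?_
      simp
    · intro r hr
      exact ((hg.deriv_smooth.hasDerivAt i hr).const_mul Λ).add_const _
    · exact continuousOn_const.mul (hg.deriv_smooth.deriv.continuousOn i)
    · intro r hr
      refine ((hβ' r hr).ofReal_comp.mul
        (((hα ε hε _ (hrs r hr)).1).scomp r (hin r))).congr_deriv ?_
      rw [Complex.real_smul]
      rfl
    · have hαc : ContinuousOn (fun r => α ε (r * s)) (Icc (1 / 2 : ℝ) 2) := fun r hr =>
        (((hα ε hε _ (hrs r hr)).1).scomp r (hin r)).continuousAt.continuousWithinAt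
      have hα'c : ContinuousOn (fun r => α' ε (r * s)) (Icc (1 / 2 : ℝ) 2) := fun r hr =>
        (ContinuousAt.comp (f := fun r : ℝ => r * s) (hα ε hε _ (hrs r hr)).2.1
          (by fun_prop)).continuousWithinAt
      exact ((Complex.continuous_ofReal.comp_continuousOn hβ'c).mul hαc).add
        ((Complex.continuous_ofReal.comp_continuousOn hβc).mul (continuousOn_const.mul hα'c))
    · intro r hr
      rw [norm_mul, Complex.norm_real]
      exact mul_le_mul (hB r hr) (hα ε hε _ (hrs r hr)).2.2.1 (norm_nonneg _) hB0
    · intro r hr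
      refine (norm_add_le _ _).trans (add_le_add ?_ ?_)
      · rw [norm_mul, Complex.norm_real]
        exact mul_le_mul (hB' r hr) (hα ε hε _ (hrs r hr)).2.2.1 (norm_nonneg _) hB0'
      · rw [norm_mul, Complex.norm_real]
        refine mul_le_mul (hB r hr) ?_ (norm_nonneg _) hB0
        rw [norm_mul, Complex.norm_real, Real.norm_of_nonneg hs'.le]
        have h3 := (hα ε hε _ (hrs r hr)).2.2.2
        have hr0 := hKpos r hr
        calc s * ‖α' ε (r * s)‖ ≤ s * (M / (r * s) ^ 2) := by gcongr
          _ = M / (r ^ 2 * s) := by field_simp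
          _ ≤ M / ((1 / 2) ^ 2 * s₀) := by
              gcongr
              exact hr.1
          _ = 4 * M / s₀ := by field_simp; norm_num
    · intro r hr
      rw [abs_mul]
      have h3 := h2 r hr
      rw [iteratedDeriv_succ', iteratedDeriv_one] at h3
      gcongr
  have hsplit : radialOsc i₀ (g i) b Λ s = ((s ^ (-ν) : ℝ) : ℂ) *
      ((∫ r in (1 / 2 : ℝ)..2, Complex.exp (Complex.I * ((Λ * g i r + 1 * s * r : ℝ) : ℂ)) *
        ((β r : ℂ) * α 1 (r * s))) +
      ∫ r in (1 / 2 : ℝ)..2, Complex.exp (Complex.I * ((Λ * g i r + (-1) * s * r : ℝ) : ℂ)) *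
        ((β r : ℂ) * α (-1) (r * s))) := by
    have hci : ∀ ε : ℝ, |ε| = 1 → IntervalIntegrable (fun r =>
        Complex.exp (Complex.I * ((Λ * g i r + ε * s * r : ℝ) : ℂ)) * ((β r : ℂ) * α ε (r * s)))
        volume (1 / 2) 2 := by
      intro ε hε
      refine ContinuousOn.intervalIntegrable ?_
      rw [uIcc_of_le (by norm_num)]
      have h1 := hg.continuousOn i
      have hαc : ContinuousOn (fun r => α ε (r * s)) (Icc (1 / 2 : ℝ) 2) := fun r hr =>
        (ContinuousAt.comp (f := fun r : ℝ => r * s) (hα ε hε _ (hrs r hr)).1.continuousAt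
          (by fun_prop)).continuousWithinAt
      have h2 : ContinuousOn (fun r => Λ * g i r + ε * s * r) (Icc (1 / 2 : ℝ) 2) := by fun_prop
      exact (Complex.continuous_exp.comp_continuousOn (continuousOn_const.mul
        (Complex.continuous_ofReal.comp_continuousOn h2))).mul
        ((Complex.continuous_ofReal.comp_continuousOn hβc).mul hαc)
    rw [← intervalIntegral.integral_add (hci 1 (by simp)) (hci (-1) (by simp)),
      ← intervalIntegral.integral_const_mul]
    refine intervalIntegral.integral_congr fun r hr => ?_
    rw [uIcc_of_le (by norm_num)] at hr
    rw [hF _ (hrs r hr), Real.mul_rpow (hKpos r hr).le hs'.le]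
    have e : ∀ ε : ℝ, Complex.exp (Complex.I * ((Λ * g i r + ε * s * r : ℝ) : ℂ)) =
        Complex.exp (Complex.I * ((Λ * g i r : ℝ) : ℂ)) *
          Complex.exp (Complex.I * ((ε * (r * s) : ℝ) : ℂ)) := fun ε => by
      rw [← Complex.exp_add]
      push_cast
      ring_nf
    rw [e, e]
    simp only [hβ]
    push_cast
    ring
  rw [hsplit, norm_mul, Complex.norm_real, Real.norm_of_nonneg (by positivity),
    Real.rpow_neg hΛμ.le, ← Real.sqrt_eq_rpow]
  calc s ^ (-ν) * ‖_ + _‖ ≤ s ^ (-ν) * (D / √(|Λ| * μ) + D / √(|Λ| * μ)) := by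
        gcongr
        exact (norm_add_le _ _).trans (add_le_add (key 1 (by simp)) (key (-1) (by simp)))
    _ = _ := by ring

end RadialOscillation

/-! ### Decay of the radial integral in both regimes. -/

section Combine

variable {n : ℕ} {ι : Type*} {g : ι → ℝ → ℝ} {c : ℝ} {b : ℝ → ℝ}

/-- Away from the stationary region `|Λ| ≲ s` the radial integral decays rapidly in `Λ`. -/
lemma IsPhaseFamily.radialOsc_dichotomy (hg : IsPhaseFamily g c) (i₀ : Fin n)
    (hb : ContDiff ℝ ∞ b) (hb0 : ∀ r, r ∉ Icc (1 / 2 : ℝ) 2 → b r = 0) (N : ℕ) :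
    ∃ C : ℝ, 0 < C ∧ ∀ i Λ s, Λ ≠ 0 → 0 ≤ s →
      ‖radialOsc i₀ (g i) b Λ s‖ ≤ C * |Λ| ^ (-(N : ℝ)) ∨
      (1 ≤ |Λ| ∧ c / 2 * |Λ| ≤ s ∧
        ‖radialOsc i₀ (g i) b Λ s‖ ≤ C * s ^ (-(((n : ℝ) - 1) / 2)) ∧
        ∀ μ, 0 < μ → (∀ r ∈ Icc (1 / 2 : ℝ) 2, μ ≤ |iteratedDeriv 2 (g i) r|) →
          ‖radialOsc i₀ (g i) b Λ s‖ ≤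
            C * (s ^ (-(((n : ℝ) - 1) / 2)) * (|Λ| * μ) ^ (-(1 / 2 : ℝ)))) := by
  obtain ⟨C₀, hC₀, h₀⟩ := exists_norm_radialOsc_le i₀ hb
  obtain ⟨C₁, hC₁, h₁⟩ := hg.exists_pow_mul_radialOsc_le i₀ hb hb0 N
  obtain ⟨C₂, hC₂, h₂⟩ := exists_norm_radialOsc_le_rpow i₀ hb (half_pos hg.pos)
  obtain ⟨C₃, hC₃, h₃⟩ := hg.exists_norm_radialOsc_le_of_deriv2 i₀ hb (half_pos hg.pos)
  refine ⟨C₀ + C₁ + C₂ + C₃ + 1, by positivity, fun i Λ s hΛ hs => ?_⟩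
  have hΛ' : 0 < |Λ| := abs_pos.2 hΛ
  rcases lt_or_ge |Λ| 1 with h | h
  -- For `|Λ| < 1` the right-hand side is at least `C`, so the trivial bound is enough.
  · left
    have h4 : 1 ≤ |Λ| ^ (-(N : ℝ)) :=
      Real.one_le_rpow_of_pos_of_le_one_of_nonpos hΛ' h.le (by simp)
    nlinarith [h₀ (g i) Λ s]
  rcases le_or_gt s (c / 2 * |Λ|) with h' | h'
  · left
    have h4 := h₁ i Λ s hΛ (by rwa [abs_of_nonneg hs])
    rw [Real.rpow_neg hΛ'.le, Real.rpow_natCast, ← div_eq_mul_inv, le_div_iff₀' (by positivity)]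
    linarith
  · right
    have hsc : c / 2 ≤ s := by nlinarith [hg.pos]
    refine ⟨h, h'.le, (h₂ (g i) Λ s hsc).trans ?_, fun μ hμ hμ' => (h₃ i Λ s μ hsc hΛ hμ hμ').trans ?_⟩
    · gcongr; linarith
    · gcongr; linarith

/-- The condition `Λ ≠ 0 ∨ θ = 0` is needed because the real power `0 ^ (-θ)` is `0`, not infinity,
for `θ ≠ 0`. -/
lemma IsPhaseFamily.exists_radialOsc_le_rpow (hg : IsPhaseFamily g c) (i₀ : Fin n)
    (hb : ContDiff ℝ ∞ b) (hb0 : ∀ r, r ∉ Icc (1 / 2 : ℝ) 2 → b r = 0) :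
    ∃ C : ℝ, 0 < C ∧ ∀ i Λ s θ, 0 ≤ θ → θ ≤ ((n : ℝ) - 1) / 2 → Λ ≠ 0 ∨ θ = 0 → 0 ≤ s →
      ‖radialOsc i₀ (g i) b Λ s‖ ≤ C * |Λ| ^ (-θ) := by
  obtain ⟨C₀, hC₀, h₀⟩ := exists_norm_radialOsc_le i₀ hb
  -- Rapid decay of order `n` beats every exponent `θ ≤ (n - 1)/2`.
  obtain ⟨C₁, hC₁, h₁⟩ := hg.radialOsc_dichotomy i₀ hb hb0 n
  have hn : (1 : ℝ) ≤ n := by exact_mod_cast Nat.one_le_of_lt i₀.2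
  have hc2 : 0 < c / 2 := half_pos hg.pos
  set ν : ℝ := ((n : ℝ) - 1) / 2 with hν
  refine ⟨C₀ + C₁ + C₁ * (c / 2) ^ (-ν), by positivity, fun i Λ s θ hθ hθν hΛ hs => ?_⟩
  have hP : 0 < C₁ * (c / 2) ^ (-ν) := by positivity
  rcases eq_or_ne θ 0 with rfl | hθ0
  · rw [neg_zero, Real.rpow_zero, mul_one]
    linarith [h₀ (g i) Λ s]
  have hΛ0 := hΛ.resolve_right hθ0
  have hΛ' : 0 < |Λ| := abs_pos.2 hΛ0
  rcases lt_or_ge |Λ| 1 with h | h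
  · have h4 : 1 ≤ |Λ| ^ (-θ) :=
      Real.one_le_rpow_of_pos_of_le_one_of_nonpos hΛ' h.le (by linarith)
    nlinarith [h₀ (g i) Λ s]
  have hpos : 0 < |Λ| ^ (-θ) := by positivity
  rcases h₁ i Λ s hΛ0 hs with h5 | ⟨-, h5, h6, -⟩
  · have h7 : |Λ| ^ (-(n : ℝ)) ≤ |Λ| ^ (-θ) := Real.rpow_le_rpow_of_exponent_le h (by
      rw [hν] at hθν; linarith)
    calc _ ≤ C₁ * |Λ| ^ (-(n : ℝ)) := h5
      _ ≤ C₁ * |Λ| ^ (-θ) := by gcongr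
      _ ≤ _ := by gcongr; linarith
  · have h7 : s ^ (-ν) ≤ (c / 2) ^ (-ν) * |Λ| ^ (-θ) := by
      calc s ^ (-ν) ≤ (c / 2 * |Λ|) ^ (-ν) :=
            Real.rpow_le_rpow_of_nonpos (by positivity) h5 (by linarith)
        _ = (c / 2) ^ (-ν) * |Λ| ^ (-ν) := Real.mul_rpow hc2.le hΛ'.le
        _ ≤ _ := by
            gcongr
    calc _ ≤ C₁ * s ^ (-ν) := h6
      _ ≤ C₁ * ((c / 2) ^ (-ν) * |Λ| ^ (-θ)) := by gcongr
      _ = C₁ * (c / 2) ^ (-ν) * |Λ| ^ (-θ) := by ring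
      _ ≤ _ := by gcongr; linarith

lemma IsPhaseFamily.exists_radialOsc_le_rpow_mul_rpow (hg : IsPhaseFamily g c) (i₀ : Fin n)
    (hb : ContDiff ℝ ∞ b) (hb0 : ∀ r, r ∉ Icc (1 / 2 : ℝ) 2 → b r = 0) :
    ∃ C : ℝ, 0 < C ∧ ∀ i Λ s θ μ, 0 ≤ θ → θ ≤ 1 → Λ ≠ 0 ∨ ((n : ℝ) - 1 + θ) / 2 = 0 → 0 ≤ s →
      0 < μ → (∀ r ∈ Icc (1 / 2 : ℝ) 2, μ ≤ |iteratedDeriv 2 (g i) r|) →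
      ‖radialOsc i₀ (g i) b Λ s‖ ≤
        C * (|Λ| ^ (-(((n : ℝ) - 1) / 2)) * (|Λ| * μ) ^ (-(θ / 2))) := by
  obtain ⟨C₀, hC₀, h₀⟩ := hg.exists_radialOsc_le_rpow i₀ hb hb0
  obtain ⟨C₁, hC₁, h₁⟩ := hg.radialOsc_dichotomy i₀ hb hb0 n
  obtain ⟨D, hD0, hD⟩ := hg.deriv_smooth.exists_bound 1
  have hn : (1 : ℝ) ≤ n := by exact_mod_cast Nat.one_le_of_lt i₀.2
  have hc2 : 0 < c / 2 := half_pos hg.pos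
  set ν : ℝ := ((n : ℝ) - 1) / 2 with hν
  have hν0 : 0 ≤ ν := by rw [hν]; linarith
  -- Since `|g''| ≤ D` forces `μ ≤ D + 1`, the factor `E` dominates `√μ`, which lets `|Λ|^{-1/2}` be
  -- replaced by `(|Λ| μ)^{-1/2}` where second derivatives play no role.
  set E : ℝ := (D + 1) ^ (1 / 2 : ℝ) with hE
  have hE1 : 1 ≤ E := Real.one_le_rpow (by linarith) (by norm_num)
  have hP : 0 < C₁ * (c / 2) ^ (-ν) := by positivity
  set C := C₀ * E + C₁ * E + C₁ * (c / 2) ^ (-ν) with hCdef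
  have hCE : 0 < C₁ * E := by positivity
  have hCE0 : 0 < C₀ * E := by positivity
  have hC0C : C₀ ≤ C := by nlinarith
  refine ⟨C, by positivity, fun i Λ s θ μ hθ hθ1 hΛ hs hμ hμ' => ?_⟩
  rcases eq_or_ne Λ 0 with rfl | hΛ0
  · have h1 : ((n : ℝ) - 1 + θ) / 2 = 0 := hΛ.resolve_left (by simp)
    have h2 : θ = 0 := by linarith
    have h3 : ν = 0 := by rw [hν]; linarith
    have h4 := h₀ i 0 s 0 le_rfl hν0 (Or.inr rfl) hs
    rw [h2, h3]
    simp only [neg_zero, Real.rpow_zero, zero_div, mul_one] at h4 ⊢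
    linarith
  have hΛ' : 0 < |Λ| := abs_pos.2 hΛ0
  have hΛμ : 0 < |Λ| * μ := by positivity
  have hμD : μ ≤ D + 1 := by
    have h3 := hμ' 1 (by norm_num)
    rw [iteratedDeriv_succ'] at h3
    have h4 := hD 1 le_rfl i 1 (by norm_num)
    linarith
  have hA := h₀ i Λ s ν hν0 le_rfl (Or.inl hΛ0) hs
  have hB : ‖radialOsc i₀ (g i) b Λ s‖ ≤ C * (|Λ| ^ (-ν) * (|Λ| * μ) ^ (-(1 / 2) : ℝ)) := by
    have hEμ : |Λ| ^ (-(1 / 2) : ℝ) ≤ E * (|Λ| * μ) ^ (-(1 / 2) : ℝ) := by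
      rw [Real.mul_rpow hΛ'.le hμ.le, hE, ← mul_assoc, mul_right_comm]
      refine le_mul_of_one_le_left (by positivity) ?_
      rw [Real.rpow_neg hμ.le, ← div_eq_mul_inv, ← Real.div_rpow (by positivity) hμ.le]
      exact Real.one_le_rpow ((one_le_div hμ).2 hμD) (by norm_num)
    rcases lt_or_ge |Λ| 1 with h | h
    · have h4 : 1 ≤ |Λ| ^ (-(1 / 2) : ℝ) :=
        Real.one_le_rpow_of_pos_of_le_one_of_nonpos hΛ' h.le (by norm_num)
      calc _ ≤ C₀ * |Λ| ^ (-ν) := hA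
        _ = C₀ * (|Λ| ^ (-ν) * 1) := by ring
        _ ≤ C₀ * (|Λ| ^ (-ν) * (E * (|Λ| * μ) ^ (-(1 / 2) : ℝ))) := by
            gcongr; exact h4.trans hEμ
        _ = C₀ * E * (|Λ| ^ (-ν) * (|Λ| * μ) ^ (-(1 / 2) : ℝ)) := by ring
        _ ≤ _ := by gcongr; linarith
    rcases h₁ i Λ s hΛ0 hs with h5 | ⟨-, h5, -, h6⟩
    · have h7 : |Λ| ^ (-(n : ℝ)) ≤ |Λ| ^ (-ν) * |Λ| ^ (-(1 / 2) : ℝ) := by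
        rw [← Real.rpow_add hΛ']
        exact Real.rpow_le_rpow_of_exponent_le h (by rw [hν]; linarith)
      calc _ ≤ C₁ * |Λ| ^ (-(n : ℝ)) := h5
        _ ≤ C₁ * (|Λ| ^ (-ν) * (E * (|Λ| * μ) ^ (-(1 / 2) : ℝ))) := by
            gcongr
            exact h7.trans (by gcongr)
        _ = C₁ * E * (|Λ| ^ (-ν) * (|Λ| * μ) ^ (-(1 / 2) : ℝ)) := by ring
        _ ≤ _ := by gcongr; linarith
    · have h7 : s ^ (-ν) ≤ (c / 2) ^ (-ν) * |Λ| ^ (-ν) := by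
        rw [← Real.mul_rpow hc2.le hΛ'.le]
        exact Real.rpow_le_rpow_of_nonpos (by positivity) h5 (by linarith)
      calc _ ≤ C₁ * (s ^ (-ν) * (|Λ| * μ) ^ (-(1 / 2) : ℝ)) := h6 μ hμ hμ'
        _ ≤ C₁ * ((c / 2) ^ (-ν) * |Λ| ^ (-ν) * (|Λ| * μ) ^ (-(1 / 2) : ℝ)) := by gcongr
        _ = C₁ * (c / 2) ^ (-ν) * (|Λ| ^ (-ν) * (|Λ| * μ) ^ (-(1 / 2) : ℝ)) := by ring
        _ ≤ _ := by gcongr; linarith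
  -- Intermediate `θ`: the case `θ = 0` suffices when `|Λ| μ ≤ 1`, the case `θ = 1` otherwise.
  rcases le_total (|Λ| * μ) 1 with h | h
  · have h4 : 1 ≤ (|Λ| * μ) ^ (-(θ / 2)) :=
      Real.one_le_rpow_of_pos_of_le_one_of_nonpos hΛμ h (by linarith)
    calc _ ≤ C₀ * |Λ| ^ (-ν) := hA
      _ = C₀ * (|Λ| ^ (-ν) * 1) := by ring
      _ ≤ _ := by gcongr
  · refine hB.trans ?_
    gcongr

end Combine

/-! ### Extending the symbol hypotheses to neighbouring intervals. -/

section Symbol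

lemma continuousOn_iteratedDeriv_Ioi {φ : ℝ → ℝ} (hφ : ContDiffOn ℝ ∞ φ (Ioi 0)) (j : ℕ) :
    ContinuousOn (iteratedDeriv j φ) (Ioi 0) :=
  (hφ.continuousOn_iteratedDerivWithin (m := j) (by exact_mod_cast le_top)
    (isOpen_Ioi.uniqueDiffOn)).congr fun _ hx => (iteratedDerivWithin_of_isOpen isOpen_Ioi hx).symm

/-- `|f(r)| ∼ r ^ p` on `S`. -/
def IsComparableOn (f : ℝ → ℝ) (p : ℝ) (S : Set ℝ) : Prop :=
  ∃ c C : ℝ, 0 < c ∧ 0 < C ∧ ∀ r ∈ S, c * r ^ p ≤ |f r| ∧ |f r| ≤ C * r ^ p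

/-- `|f(r)| ≲ r ^ p` on `S`. -/
def IsDominatedOn (f : ℝ → ℝ) (p : ℝ) (S : Set ℝ) : Prop :=
  ∃ C : ℝ, 0 < C ∧ ∀ r ∈ S, |f r| ≤ C * r ^ p

variable {f : ℝ → ℝ} {p : ℝ} {S T : Set ℝ}

lemma IsDominatedOn.union (hS : IsDominatedOn f p S) (hT : IsDominatedOn f p T)
    (hS0 : S ⊆ Ioi 0) (hT0 : T ⊆ Ioi 0) : IsDominatedOn f p (S ∪ T) := by
  obtain ⟨C, hC, h⟩ := hS
  obtain ⟨D, hD, h'⟩ := hT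
  refine ⟨C + D, by positivity, fun r hr => ?_⟩
  rcases hr with hr | hr
  · have h0 : 0 < r ^ p := Real.rpow_pos_of_pos (hS0 hr) _
    nlinarith [h r hr, mul_pos hD h0]
  · have h0 : 0 < r ^ p := Real.rpow_pos_of_pos (hT0 hr) _
    nlinarith [h' r hr, mul_pos hC h0]

lemma IsComparableOn.union (hS : IsComparableOn f p S) (hT : IsComparableOn f p T)
    (hS0 : S ⊆ Ioi 0) (hT0 : T ⊆ Ioi 0) : IsComparableOn f p (S ∪ T) := by
  obtain ⟨c, C, hc, hC, h⟩ := hS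
  obtain ⟨d, D, hd, hD, h'⟩ := hT
  refine ⟨min c d, C + D, lt_min hc hd, by positivity, fun r hr => ?_⟩
  rcases hr with hr | hr
  · have h0 : 0 < r ^ p := Real.rpow_pos_of_pos (hS0 hr) _
    have h1 := mul_le_mul_of_nonneg_right (min_le_left c d) h0.le
    constructor <;> nlinarith [h r hr, mul_pos hD h0]
  · have h0 : 0 < r ^ p := Real.rpow_pos_of_pos (hT0 hr) _
    have h1 := mul_le_mul_of_nonneg_right (min_le_right c d) h0.le
    constructor <;> nlinarith [h' r hr, mul_pos hC h0]

lemma isDominatedOn_Icc (hf : ContinuousOn f (Ioi 0)) {a b : ℝ} (ha : 0 < a) :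
    IsDominatedOn f p (Icc a b) := by
  have hsub : Icc a b ⊆ Ioi (0 : ℝ) := fun r hr => ha.trans_le hr.1
  have hq : ContinuousOn (fun r : ℝ => f r * r ^ (-p)) (Icc a b) := (hf.mono hsub).mul
    (continuousOn_id.rpow_const fun r hr => Or.inl (ne_of_gt (hsub hr)))
  obtain ⟨C, hC⟩ := isCompact_Icc.exists_bound_of_continuousOn hq
  refine ⟨|C| + 1, by positivity, fun r hr => ?_⟩
  have hr0 : 0 < r := hsub hr
  have h1 := hC r hr
  have h2 : 0 < r ^ p := by positivity
  rw [norm_mul, Real.norm_of_nonneg (by positivity : 0 ≤ r ^ (-p)), Real.rpow_neg hr0.le,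
    ← div_eq_mul_inv, div_le_iff₀ h2] at h1
  exact h1.trans (mul_le_mul_of_nonneg_right (by linarith [le_abs_self C]) h2.le)

/-- On a compact interval away from the origin all powers of `r` are comparable to 1, so a
nonvanishing continuous function is comparable to each. The hypotheses on zeros of `φ'` and `φ''`
enter here. -/
lemma isComparableOn_Icc (hf : ContinuousOn f (Ioi 0)) {a b : ℝ} (ha : 0 < a)
    (h0 : ∀ r ∈ Icc a b, f r ≠ 0) : IsComparableOn f p (Icc a b) := by
  have hsub : Icc a b ⊆ Ioi (0 : ℝ) := fun r hr => ha.trans_le hr.1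
  obtain ⟨C, hC, h⟩ := isDominatedOn_Icc (p := p) (b := b) hf ha
  have hq : ContinuousOn (fun r : ℝ => r ^ p / f r) (Icc a b) :=
    (continuousOn_id.rpow_const fun r hr => Or.inl (ne_of_gt (hsub hr))).div (hf.mono hsub) h0
  obtain ⟨D, hD⟩ := isCompact_Icc.exists_bound_of_continuousOn hq
  refine ⟨(|D| + 1)⁻¹, C, by positivity, hC, fun r hr => ⟨?_, h r hr⟩⟩
  have hr0 : 0 < r := hsub hr
  have h1 := hD r hr
  have h2 : 0 < r ^ p := by positivity
  have h3 : 0 < |f r| := abs_pos.2 (h0 r hr)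
  rw [norm_div, Real.norm_of_nonneg h2.le, Real.norm_eq_abs, div_le_iff₀ h3] at h1
  rw [inv_mul_le_iff₀ (by positivity)]
  exact h1.trans (mul_le_mul_of_nonneg_right (by linarith [le_abs_self D]) h3.le)

lemma tendsto_mul_rpow_Iio_one (C p : ℝ) :
    Filter.Tendsto (fun r : ℝ => C * r ^ p) (nhdsWithin 1 (Ioo 0 1)) (nhds (C * 1 ^ p)) :=
  ((Real.continuousAt_rpow_const 1 p (Or.inl one_ne_zero)).tendsto.mono_left
    nhdsWithin_le_nhds).const_mul C

lemma nhdsWithin_Ioo_zero_one_neBot : (nhdsWithin (1 : ℝ) (Ioo 0 1)).NeBot :=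
  mem_closure_iff_nhdsWithin_neBot.1 (by rw [closure_Ioo zero_ne_one]; norm_num)

lemma tendsto_abs_nhdsWithin_one (hf : ContinuousOn f (Ioi 0)) :
    Filter.Tendsto (fun r => |f r|) (nhdsWithin 1 (Ioo 0 1)) (nhds |f 1|) :=
  ((hf.continuousAt (Ioi_mem_nhds one_pos)).abs.tendsto).mono_left nhdsWithin_le_nhds

/-- The endpoint is reached by continuity. It is needed because the shell of `k = -1` is `[1/4, 1]`.
-/
lemma IsDominatedOn.Ioc (hf : ContinuousOn f (Ioi 0)) (h : IsDominatedOn f p (Ioo 0 1)) :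
    IsDominatedOn f p (Ioc 0 1) := by
  obtain ⟨C, hC, h⟩ := h
  have := nhdsWithin_Ioo_zero_one_neBot
  refine ⟨C, hC, fun r hr => ?_⟩
  rcases hr.2.lt_or_eq with h1 | rfl
  · exact h r ⟨hr.1, h1⟩
  · exact le_of_tendsto_of_tendsto (tendsto_abs_nhdsWithin_one hf) (tendsto_mul_rpow_Iio_one C p)
      (eventually_nhdsWithin_of_forall h)

lemma IsComparableOn.Ioc (hf : ContinuousOn f (Ioi 0)) (h : IsComparableOn f p (Ioo 0 1)) :
    IsComparableOn f p (Ioc 0 1) := by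
  obtain ⟨c, C, hc, hC, h⟩ := h
  have := nhdsWithin_Ioo_zero_one_neBot
  refine ⟨c, C, hc, hC, fun r hr => ?_⟩
  rcases hr.2.lt_or_eq with h1 | rfl
  · exact h r ⟨hr.1, h1⟩
  · exact ⟨le_of_tendsto_of_tendsto (tendsto_mul_rpow_Iio_one c p) (tendsto_abs_nhdsWithin_one hf)
      (eventually_nhdsWithin_of_forall fun r hr => (h r hr).1),
      le_of_tendsto_of_tendsto (tendsto_abs_nhdsWithin_one hf) (tendsto_mul_rpow_Iio_one C p)
      (eventually_nhdsWithin_of_forall fun r hr => (h r hr).2)⟩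

lemma IsDominatedOn.mono (h : IsDominatedOn f p S) (hTS : T ⊆ S) : IsDominatedOn f p T :=
  h.imp fun _ hC => ⟨hC.1, fun r hr => hC.2 r (hTS hr)⟩

lemma IsComparableOn.mono (h : IsComparableOn f p S) (hTS : T ⊆ S) : IsComparableOn f p T := by
  obtain ⟨c, C, hc, hC, h⟩ := h
  exact ⟨c, C, hc, hC, fun r hr => h r (hTS hr)⟩

variable {φ : ℝ → ℝ} {m : ℝ}

lemma continuousOn_deriv_Ioi (hφ : ContDiffOn ℝ ∞ φ (Ioi 0)) : ContinuousOn (deriv φ) (Ioi 0) := by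
  simpa only [iteratedDeriv_one] using continuousOn_iteratedDeriv_Ioi hφ 1

lemma SymbolOrderOn.mono (h : SymbolOrderOn φ m S) (hTS : T ⊆ S) : SymbolOrderOn φ m T :=
  ⟨IsComparableOn.mono h.1 hTS, fun α hα => IsDominatedOn.mono (h.2 α hα) hTS⟩

lemma SymbolOrderOn.union_Icc (hφ : ContDiffOn ℝ ∞ φ (Ioi 0)) (h : SymbolOrderOn φ m S)
    (hS0 : S ⊆ Ioi 0) {a b : ℝ} (ha : 0 < a) (h0 : ∀ r ∈ Icc a b, deriv φ r ≠ 0) :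
    SymbolOrderOn φ m (S ∪ Icc a b) := by
  have hsub : Icc a b ⊆ Ioi (0 : ℝ) := fun r hr => ha.trans_le hr.1
  exact ⟨IsComparableOn.union h.1 (isComparableOn_Icc (continuousOn_deriv_Ioi hφ) ha h0) hS0 hsub,
    fun α hα => IsDominatedOn.union (h.2 α hα)
      (isDominatedOn_Icc (continuousOn_iteratedDeriv_Ioi hφ α) ha) hS0 hsub⟩

lemma SymbolOrderOn.Ioc (hφ : ContDiffOn ℝ ∞ φ (Ioi 0)) (h : SymbolOrderOn φ m (Ioo 0 1)) :
    SymbolOrderOn φ m (Ioc 0 1) :=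
  ⟨IsComparableOn.Ioc (continuousOn_deriv_Ioi hφ) h.1,
    fun α hα => IsDominatedOn.Ioc (continuousOn_iteratedDeriv_Ioi hφ α) (h.2 α hα)⟩

lemma SecondDerivOrderOn.union_Icc (hφ : ContDiffOn ℝ ∞ φ (Ioi 0)) (h : SecondDerivOrderOn φ m S)
    (hS0 : S ⊆ Ioi 0) {a b : ℝ} (ha : 0 < a) (h0 : ∀ r ∈ Icc a b, iteratedDeriv 2 φ r ≠ 0) :
    SecondDerivOrderOn φ m (S ∪ Icc a b) :=
  IsComparableOn.union h (isComparableOn_Icc (continuousOn_iteratedDeriv_Ioi hφ 2) ha h0) hS0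
    fun _ hr => ha.trans_le hr.1

lemma SecondDerivOrderOn.Ioc (hφ : ContDiffOn ℝ ∞ φ (Ioi 0))
    (h : SecondDerivOrderOn φ m (Ioo 0 1)) : SecondDerivOrderOn φ m (Ioc 0 1) :=
  IsComparableOn.Ioc (continuousOn_iteratedDeriv_Ioi hφ 2) h

end Symbol

/-! ### Rescaling the phase to the unit shell. -/

section Scaling

variable {φ : ℝ → ℝ} {m : ℝ} {S : Set ℝ}

lemma rpow_mem_Icc_of_mem_shell {r : ℝ} (hr : r ∈ Icc (1 / 2 : ℝ) 2) (p : ℝ) :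
    (2 : ℝ) ^ (-|p|) ≤ r ^ p ∧ r ^ p ≤ (2 : ℝ) ^ |p| := by
  have hr0 : 0 < r := by linarith [hr.1]
  have h2 : ∀ q : ℝ, (1 / 2 : ℝ) ^ q = 2 ^ (-q) := fun q => by
    rw [one_div, Real.inv_rpow (by norm_num), Real.rpow_neg (by norm_num)]
  rcases le_total 0 p with hp | hp
  · rw [abs_of_nonneg hp, ← h2]
    exact ⟨Real.rpow_le_rpow (by norm_num) hr.1 hp, Real.rpow_le_rpow hr0.le hr.2 hp⟩
  · rw [abs_of_nonpos hp, neg_neg, ← h2]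
    exact ⟨Real.rpow_le_rpow_of_nonpos hr0 hr.2 hp,
      Real.rpow_le_rpow_of_nonpos (by norm_num) hr.1 hp⟩

/-- The phase `φ` rescaled from the shell `|ξ| ∼ 2 ^ k` to the unit shell. -/
noncomputable def rescaledPhase (φ : ℝ → ℝ) (m : ℝ) (k : ℤ) (r : ℝ) : ℝ :=
  (2 : ℝ) ^ (-(m * k)) * φ ((2 : ℝ) ^ k * r)

lemma contDiffAt_rescaledPhase (hφ : ContDiffOn ℝ ∞ φ (Ioi 0)) (k : ℤ) {r : ℝ} (hr : 0 < r) :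
    ContDiffAt ℝ ∞ (rescaledPhase φ m k) r := by
  have h1 : ContDiffAt ℝ ∞ φ ((2 : ℝ) ^ k * r) := hφ.contDiffAt (Ioi_mem_nhds (by positivity))
  exact contDiffAt_const.mul (h1.comp r (contDiffAt_const.mul contDiffAt_id))

lemma iteratedDeriv_rescaledPhase (hφ : ContDiffOn ℝ ∞ φ (Ioi 0)) (k : ℤ) (j : ℕ) {r : ℝ}
    (hr : 0 < r) : iteratedDeriv j (rescaledPhase φ m k) r =
      (2 : ℝ) ^ (-(m * k)) * (((2 : ℝ) ^ k) ^ j * iteratedDeriv j φ ((2 : ℝ) ^ k * r)) := by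
  unfold rescaledPhase
  have hk : (0 : ℝ) < 2 ^ k := by positivity
  have h1 := iteratedDerivWithin_comp_const_smul (n := j) (mem_Ioi.2 hr) isOpen_Ioi.uniqueDiffOn
    (hφ.of_le (by exact_mod_cast le_top)) ((2 : ℝ) ^ k) (fun x (hx : 0 < x) => mul_pos hk hx)
  rw [iteratedDerivWithin_of_isOpen isOpen_Ioi (mem_Ioi.2 hr),
    iteratedDerivWithin_of_isOpen isOpen_Ioi (mem_Ioi.2 (mul_pos hk hr))] at h1
  rw [iteratedDeriv_const_mul_field, h1, smul_eq_mul]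

lemma abs_iteratedDeriv_rescaledPhase (hφ : ContDiffOn ℝ ∞ φ (Ioi 0)) (k : ℤ) (j : ℕ) {r : ℝ}
    (hr : 0 < r) : |iteratedDeriv j (rescaledPhase φ m k) r| =
      (2 : ℝ) ^ ((j - m) * k) * |iteratedDeriv j φ ((2 : ℝ) ^ k * r)| := by
  rw [iteratedDeriv_rescaledPhase hφ k j hr, abs_mul, abs_mul, abs_of_pos (by positivity),
    abs_of_pos (by positivity), ← mul_assoc, ← zpow_natCast, ← zpow_mul, ← Real.rpow_intCast,
    ← Real.rpow_add (by norm_num)]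
  congr 2
  push_cast
  ring

/-- With `a = j - m` and `p = m - j` the power of `2^k` cancels: this makes the bounds on `φ^{(j)}`
uniform in `k` after rescaling. -/
lemma mul_rpow_scale (k : ℤ) {r : ℝ} (hr : 0 < r) (a p C : ℝ) :
    (2 : ℝ) ^ (a * k) * (C * ((2 : ℝ) ^ k * r) ^ p) = C * ((2 : ℝ) ^ ((a + p) * k) * r ^ p) := by
  rw [Real.mul_rpow (by positivity) hr.le, ← Real.rpow_intCast, ← Real.rpow_mul (by norm_num),
    add_mul, Real.rpow_add (by norm_num), mul_comm (k : ℝ) p]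
  ring

lemma isPhaseFamily_rescaledPhase (hφ : ContDiffOn ℝ ∞ φ (Ioi 0)) (h : SymbolOrderOn φ m S) :
    ∃ c, IsPhaseFamily
      (fun k : {k : ℤ // ∀ r ∈ Icc (1 / 2 : ℝ) 2, (2 : ℝ) ^ k * r ∈ S} => rescaledPhase φ m k) c := by
  obtain ⟨⟨c, C, hc, hC, h1⟩, h2⟩ := h
  have hpos : ∀ r ∈ Icc (1 / 2 : ℝ) 2, 0 < r := fun r hr => by linarith [hr.1]
  refine ⟨c * 2 ^ (-|m - 1|), fun k r hr => contDiffAt_rescaledPhase hφ k (hpos r hr),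
    ⟨fun k r hr => ?_, fun j => ?_⟩, by positivity, fun k r hr => ?_⟩
  · have h3 := (((contDiffAt_rescaledPhase (m := m) hφ k (hpos r hr)).fderiv_right
      (m := ∞) (by simp)).clm_apply (contDiffAt_const (c := (1 : ℝ))))
    simpa only [fderiv_apply_one_eq_deriv] using h3
  · have hbound : ∃ D : ℝ, 0 < D ∧ ∀ r ∈ S,
        |iteratedDeriv (j + 1) φ r| ≤ D * r ^ (m - ((j + 1 : ℕ) : ℝ)) := by
      rcases Nat.eq_zero_or_pos j with rfl | hj
      · refine ⟨C, hC, fun r hr => ?_⟩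
        have h3 := (h1 r hr).2
        simpa only [zero_add, iteratedDeriv_one, Nat.cast_one] using h3
      · exact h2 (j + 1) (by omega)
    obtain ⟨D, hD, hDb⟩ := hbound
    refine ⟨D * 2 ^ |m - ((j + 1 : ℕ) : ℝ)|, fun k r hr => ?_⟩
    rw [← iteratedDeriv_succ', abs_iteratedDeriv_rescaledPhase hφ k _ (hpos r hr)]
    calc _ ≤ (2 : ℝ) ^ ((((j + 1 : ℕ) : ℝ) - m) * (k : ℤ)) *
          (D * ((2 : ℝ) ^ (k : ℤ) * r) ^ (m - ((j + 1 : ℕ) : ℝ))) := by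
          gcongr
          exact hDb _ (k.2 r hr)
      _ = D * r ^ (m - ((j + 1 : ℕ) : ℝ)) := by
          rw [mul_rpow_scale _ (hpos r hr)]
          simp
      _ ≤ _ := by
          gcongr
          exact (rpow_mem_Icc_of_mem_shell hr _).2
  · rw [← iteratedDeriv_one, abs_iteratedDeriv_rescaledPhase hφ k _ (hpos r hr), iteratedDeriv_one]
    calc c * 2 ^ (-|m - 1|) ≤ c * r ^ (m - 1) := by
          gcongr
          exact (rpow_mem_Icc_of_mem_shell hr _).1
      _ = (2 : ℝ) ^ ((((1 : ℕ) : ℝ) - m) * (k : ℤ)) * (c * ((2 : ℝ) ^ (k : ℤ) * r) ^ (m - 1)) := by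
          rw [mul_rpow_scale _ (hpos r hr)]
          simp
      _ ≤ _ := by
          gcongr
          exact (h1 _ (k.2 r hr)).1

/-- Here the cancellation is incomplete: the factor `2^{(a-m)k}` left over produces the term `θ (a -
m)/2` in the final exponents. -/
lemma exists_le_abs_iteratedDeriv_two_rescaledPhase (hφ : ContDiffOn ℝ ∞ φ (Ioi 0)) {a : ℝ}
    (h : SecondDerivOrderOn φ a S) :
    ∃ d : ℝ, 0 < d ∧ ∀ k : {k : ℤ // ∀ r ∈ Icc (1 / 2 : ℝ) 2, (2 : ℝ) ^ k * r ∈ S},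
      ∀ r ∈ Icc (1 / 2 : ℝ) 2, d * 2 ^ ((a - m) * (k : ℤ)) ≤ |iteratedDeriv 2 (rescaledPhase φ m k) r| := by
  obtain ⟨c, C, hc, hC, h1⟩ := h
  have hpos : ∀ r ∈ Icc (1 / 2 : ℝ) 2, 0 < r := fun r hr => by linarith [hr.1]
  refine ⟨c * 2 ^ (-|a - 2|), by positivity, fun k r hr => ?_⟩
  rw [abs_iteratedDeriv_rescaledPhase hφ k _ (hpos r hr)]
  calc c * 2 ^ (-|a - 2|) * 2 ^ ((a - m) * (k : ℤ))
      ≤ c * r ^ (a - 2) * 2 ^ ((a - m) * (k : ℤ)) := by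
        gcongr
        exact (rpow_mem_Icc_of_mem_shell hr _).1
    _ = (2 : ℝ) ^ ((((2 : ℕ) : ℝ) - m) * (k : ℤ)) * (c * ((2 : ℝ) ^ (k : ℤ) * r) ^ (a - 2)) := by
        rw [mul_rpow_scale _ (hpos r hr), mul_assoc, mul_comm (r ^ (a - 2))]
        congr 3
        push_cast
        ring
    _ ≤ _ := by
        gcongr
        exact (h1 _ (k.2 r hr)).1

end Scaling

/-! ### The annular bump and its radial profile. -/

section Cutoff

variable {n : ℕ} {Φ : EuclideanSpace ℝ (Fin n) → ℝ}

lemma DispersiveDecay.IsRadialCutoff.eq_zero (hΦ : IsRadialCutoff Φ) {x : EuclideanSpace ℝ (Fin n)}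
    (hx : 2 < ‖x‖) : Φ x = 0 := by
  refine image_eq_zero_of_notMem_tsupport fun h => ?_
  have := hΦ.support_subset h
  rw [mem_closedBall_zero_iff] at this
  linarith

lemma DispersiveDecay.IsRadialCutoff.hasCompactSupport (hΦ : IsRadialCutoff Φ) :
    HasCompactSupport Φ :=
  (isCompact_closedBall _ _).of_isClosed_subset (isClosed_tsupport _) hΦ.support_subset

lemma contDiff_annular (hΦ : IsRadialCutoff Φ) : ContDiff ℝ ∞ (annular Φ) :=
  hΦ.smooth.sub (hΦ.smooth.comp (contDiff_const_smul _))

lemma annular_eq_zero (hΦ : IsRadialCutoff Φ) {x : EuclideanSpace ℝ (Fin n)}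
    (hx : ‖x‖ ∉ Icc (1 / 2 : ℝ) 2) : annular Φ x = 0 := by
  have h2 : ‖(2 : ℝ) • x‖ = 2 * ‖x‖ := by rw [norm_smul, Real.norm_of_nonneg (by norm_num)]
  rw [annular]
  rcases lt_or_ge ‖x‖ (1 / 2) with h | h
  · rw [hΦ.eq_one _ (by linarith), hΦ.eq_one _ (by rw [h2]; linarith), sub_self]
  · have h3 : 2 < ‖x‖ := by
      by_contra h4
      exact hx ⟨h, not_lt.1 h4⟩
    rw [hΦ.eq_zero h3, hΦ.eq_zero (by rw [h2]; linarith), sub_self]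

lemma annular_radial (hΦ : IsRadialCutoff Φ) {x y : EuclideanSpace ℝ (Fin n)} (h : ‖x‖ = ‖y‖) :
    annular Φ x = annular Φ y := by
  rw [annular, annular, hΦ.radial x y h, hΦ.radial ((2 : ℝ) • x) ((2 : ℝ) • y) (by rw [norm_smul, norm_smul, h])]

lemma hasCompactSupport_annular (hΦ : IsRadialCutoff Φ) : HasCompactSupport (annular Φ) :=
  HasCompactSupport.intro (isCompact_closedBall 0 2) fun _ hx => annular_eq_zero hΦ fun h =>
    hx (mem_closedBall_zero_iff.2 h.2)

lemma contDiff_comp_single {χ : EuclideanSpace ℝ (Fin n) → ℝ} (hχ : ContDiff ℝ ∞ χ) (i₀ : Fin n) :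
    ContDiff ℝ ∞ fun r : ℝ => χ (EuclideanSpace.single i₀ r) := by
  have h2 : (fun r : ℝ => χ (EuclideanSpace.single i₀ r)) =
      fun r : ℝ => χ (r • EuclideanSpace.single i₀ (1 : ℝ)) := by
    ext r
    congr 1
    ext j
    simp
  rw [h2]
  exact hχ.comp (contDiff_id.smul contDiff_const)

/-- The radial profile of the annular bump, with the Jacobian of polar coordinates. -/
noncomputable def annularProfile (Φ : EuclideanSpace ℝ (Fin n) → ℝ) (i₀ : Fin n) (r : ℝ) : ℝ :=
  if 0 < r then r ^ (n - 1) * annular Φ (EuclideanSpace.single i₀ r) else 0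

lemma annularProfile_eq_zero (hΦ : IsRadialCutoff Φ) (i₀ : Fin n) {r : ℝ}
    (hr : r ∉ Icc (1 / 2 : ℝ) 2) : annularProfile Φ i₀ r = 0 := by
  unfold annularProfile
  split_ifs with h
  · rw [annular_eq_zero hΦ, mul_zero]
    rwa [PiLp.norm_single, Real.norm_of_nonneg h.le]
  · rfl

/-- Cutting at `r = 0` discards the mirror image of the bump on the negative axis. Smoothness
survives since the profile vanishes for `r < 1/2`. -/
lemma contDiff_annularProfile (hΦ : IsRadialCutoff Φ) (i₀ : Fin n) :
    ContDiff ℝ ∞ (annularProfile Φ i₀) := by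
  refine contDiff_iff_contDiffAt.2 fun r => ?_
  rcases lt_or_ge r (1 / 2) with h | h
  · refine (contDiffAt_const (c := (0 : ℝ))).congr_of_eventuallyEq ?_
    filter_upwards [Iio_mem_nhds h] with x hx
    exact annularProfile_eq_zero hΦ i₀ fun h' => absurd h'.1 (not_le.2 hx)
  · have h3 : ContDiff ℝ ∞ fun r : ℝ => r ^ (n - 1) * annular Φ (EuclideanSpace.single i₀ r) :=
      (contDiff_id.pow _).mul (contDiff_comp_single (contDiff_annular hΦ) i₀)
    refine h3.contDiffAt.congr_of_eventuallyEq ?_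
    filter_upwards [Ioi_mem_nhds (show (0 : ℝ) < r by linarith)] with x hx
    exact if_pos hx

end Cutoff

/-! ### Kernels of the localized propagator. -/

section Kernel

variable {n : ℕ} {Φ : EuclideanSpace ℝ (Fin n) → ℝ} {φ : ℝ → ℝ}

lemma aestronglyMeasurable_exp_radial (i₀ : Fin n) {h : ℝ → ℝ} (hh : ContinuousOn h (Ioi 0)) (t : ℝ) :
    AEStronglyMeasurable (fun ξ : EuclideanSpace ℝ (Fin n) =>
      Complex.exp (Complex.I * (t : ℂ) * (h ‖ξ‖ : ℂ))) volume := by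
  have : Nonempty (Fin n) := ⟨i₀⟩
  rw [← restrict_compl_singleton (μ := (volume : Measure (EuclideanSpace ℝ (Fin n)))) 0]
  refine ContinuousOn.aestronglyMeasurable ?_ (measurableSet_singleton _).compl
  have h1 : ContinuousOn (fun ξ : EuclideanSpace ℝ (Fin n) => h ‖ξ‖) {0}ᶜ :=
    hh.comp continuous_norm.continuousOn fun ξ hξ => norm_pos_iff.2 hξ
  exact Complex.continuous_exp.comp_continuousOn
    (continuousOn_const.mul (Complex.continuous_ofReal.comp_continuousOn h1))

lemma norm_exp_I_mul_mul (t y : ℝ) : ‖Complex.exp (Complex.I * (t : ℂ) * (y : ℂ))‖ = 1 := by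
  rw [mul_assoc, ← Complex.ofReal_mul, norm_exp_I_mul_ofReal]

lemma integrable_exp_radial_mul (i₀ : Fin n) {h : ℝ → ℝ} (hh : ContinuousOn h (Ioi 0)) (t : ℝ)
    {χ : EuclideanSpace ℝ (Fin n) → ℝ} (hχ : Continuous χ) (hχc : HasCompactSupport χ) :
    Integrable fun ξ : EuclideanSpace ℝ (Fin n) =>
      Complex.exp (Complex.I * (t : ℂ) * (h ‖ξ‖ : ℂ)) * (χ ξ : ℂ) := by
  refine ((hχ.integrable_of_hasCompactSupport hχc).ofReal (𝕜 := ℂ)).bdd_mul (c := 1)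
    (aestronglyMeasurable_exp_radial i₀ hh t) (Filter.Eventually.of_forall fun ξ => ?_)
  rw [norm_exp_I_mul_mul]

/-- The kernel of the propagator localized by the cutoff `χ`, up to a constant. -/
noncomputable def localizedKernel (φ : ℝ → ℝ) (χ : EuclideanSpace ℝ (Fin n) → ℝ) (t : ℝ)
    (x : EuclideanSpace ℝ (Fin n)) : ℂ :=
  ∫ ξ : EuclideanSpace ℝ (Fin n), Complex.exp (Complex.I * ((inner ℝ ξ x : ℝ) : ℂ)) *
    (Complex.exp (Complex.I * (t : ℂ) * (φ ‖ξ‖ : ℂ)) * (χ ξ : ℂ))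

lemma norm_localizedKernel_le (φ : ℝ → ℝ) (χ : EuclideanSpace ℝ (Fin n) → ℝ) (t : ℝ)
    (x : EuclideanSpace ℝ (Fin n)) : ‖localizedKernel φ χ t x‖ ≤ ∫ ξ, |χ ξ| := by
  refine (norm_integral_le_integral_norm _).trans (le_of_eq ?_)
  congr 1
  ext ξ
  rw [norm_mul, norm_mul, norm_exp_I_mul_ofReal, norm_exp_I_mul_mul, one_mul, one_mul,
    Complex.norm_real, Real.norm_eq_abs]

lemma eLpNorm_propagator_multiplier_le (i₀ : Fin n) (hφ : ContinuousOn φ (Ioi 0))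
    {χ : EuclideanSpace ℝ (Fin n) → ℝ} (hχ : ContDiff ℝ ∞ χ) (hχc : HasCompactSupport χ)
    {u : EuclideanSpace ℝ (Fin n) → ℂ} (hu : Integrable u) {t B : ℝ}
    (hB : ∀ x, ‖localizedKernel φ χ t x‖ ≤ B) :
    eLpNorm (propagator φ t (multiplier (fun ξ => (χ ξ : ℂ)) u)) ∞ volume ≤
      ENNReal.ofReal B * eLpNorm u 1 volume := by
  unfold propagator
  rw [multiplier_multiplier (a := fun ξ => (χ ξ : ℂ)) (Complex.ofRealCLM.contDiff.comp hχ)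
    (hχc.comp_left Complex.ofReal_zero) hu]
  exact eLpNorm_multiplier_le (integrable_exp_radial_mul i₀ hφ t hχ.continuous hχc) hu hB

lemma eLpNorm_propagator_multiplier_le_rpow (i₀ : Fin n) (hφ : ContinuousOn φ (Ioi 0))
    {χ : EuclideanSpace ℝ (Fin n) → ℝ} (hχ : ContDiff ℝ ∞ χ) (hχc : HasCompactSupport χ)
    {u : EuclideanSpace ℝ (Fin n) → ℂ} (hu : Integrable u) {t C p q : ℝ} (hC : 0 < C) (hp : 0 ≤ p)
    (hB : t ≠ 0 ∨ p = 0 → ∀ x, ‖localizedKernel φ χ t x‖ ≤ C * (|t| ^ (-p) * 2 ^ q)) :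
    eLpNorm (propagator φ t (multiplier (fun ξ => (χ ξ : ℂ)) u)) ∞ volume ≤
      (C.toNNReal : ℝ≥0∞) * ‖t‖ₑ ^ (-p) * (2 : ℝ≥0∞) ^ q * eLpNorm u 1 volume := by
  have h2 : (2 : ℝ≥0∞) ^ q = ENNReal.ofReal (2 ^ q) := by
    rw [← ENNReal.ofReal_rpow_of_pos (by norm_num), ENNReal.ofReal_ofNat]
  rcases eq_or_ne t 0 with rfl | ht
  · rcases hp.eq_or_lt with rfl | hp
    · refine (eLpNorm_propagator_multiplier_le i₀ hφ hχ hχc hu (hB (Or.inr rfl))).trans ?_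
      rw [neg_zero, Real.rpow_zero, ENNReal.rpow_zero, one_mul, mul_one, h2,
        ENNReal.ofReal_mul hC.le]
      rfl
    -- At `t = 0` with `p > 0` the right-hand side is infinite unless `‖u‖₁ = 0`; then `∞ · 0 = 0`,
    -- and the trivial kernel bound shows that the left-hand side vanishes.
    · rcases eq_or_ne (eLpNorm u 1 volume) 0 with h0 | h0
      · refine (eLpNorm_propagator_multiplier_le i₀ hφ hχ hχc hu
          (norm_localizedKernel_le φ χ 0)).trans ?_
        rw [h0, mul_zero, mul_zero]
      · rw [enorm_zero, ENNReal.zero_rpow_of_neg (by linarith), ENNReal.mul_top (by simpa using hC),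
          h2, ENNReal.top_mul (by simp; positivity), ENNReal.top_mul h0]
        exact le_top
  · refine (eLpNorm_propagator_multiplier_le i₀ hφ hχ hχc hu (hB (Or.inl ht))).trans ?_
    have h3 : ‖t‖ₑ ^ (-p) = ENNReal.ofReal (|t| ^ (-p)) := by
      rw [← ENNReal.ofReal_rpow_of_pos (abs_pos.2 ht), ← ofReal_norm, Real.norm_eq_abs]
    rw [h2, h3, ENNReal.ofReal_mul hC.le, ENNReal.ofReal_mul (by positivity), ← mul_assoc]
    rfl

/-- The substitution `ξ ↦ 2^k ξ` gives the Jacobian `2^{kn}`, the distance `2^k |x|` and the phase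
`t φ(2^k r)`, which is `t 2^{mk}` times the rescaled phase. -/
lemma localizedKernel_dyadic (i₀ : Fin n) (hΦ : IsRadialCutoff Φ) (hφ : ContinuousOn φ (Ioi 0))
    (m : ℝ) (k : ℤ) (t : ℝ) (x : EuclideanSpace ℝ (Fin n)) :
    localizedKernel φ (fun ξ => annular Φ (((2 : ℝ) ^ (-k)) • ξ)) t x =
      ((((2 : ℝ) ^ k) ^ n : ℝ) : ℂ) * radialOsc i₀ (rescaledPhase φ m k) (annularProfile Φ i₀)
        (t * 2 ^ (m * k)) (2 ^ k * ‖x‖) := by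
  have hc : (0 : ℝ) < 2 ^ k := by positivity
  set c : ℝ := 2 ^ k with hcdef
  set h : ℝ → ℂ := fun r => Complex.exp (Complex.I * (t : ℂ) * (φ (c * r) : ℂ)) *
    (annular Φ (EuclideanSpace.single i₀ r) : ℂ) with hh
  have hrad : ∀ ξ : EuclideanSpace ℝ (Fin n), annular Φ (EuclideanSpace.single i₀ ‖ξ‖) = annular Φ ξ :=
    fun ξ => annular_radial hΦ (by simp)
  have hint : Integrable fun ξ : EuclideanSpace ℝ (Fin n) => h ‖ξ‖ := by
    simp only [hh, hrad]
    refine integrable_exp_radial_mul i₀ (h := fun r => φ (c * r)) (hφ.comp (by fun_prop) ?_) t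
      (contDiff_annular hΦ).continuous (hasCompactSupport_annular hΦ)
    exact fun r (hr : 0 < r) => mul_pos hc hr
  have hscale : localizedKernel φ (fun ξ => annular Φ (((2 : ℝ) ^ (-k)) • ξ)) t x =
      ((c ^ n : ℝ) : ℂ) * ∫ ξ : EuclideanSpace ℝ (Fin n),
        Complex.exp (Complex.I * ((inner ℝ ξ (c • x) : ℝ) : ℂ)) * h ‖ξ‖ := by
    unfold localizedKernel
    have h1 := Measure.integral_comp_smul (volume : Measure (EuclideanSpace ℝ (Fin n)))
      (fun ξ => Complex.exp (Complex.I * ((inner ℝ ξ x : ℝ) : ℂ)) *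
        (Complex.exp (Complex.I * (t : ℂ) * (φ ‖ξ‖ : ℂ)) *
          (annular Φ (((2 : ℝ) ^ (-k)) • ξ) : ℂ))) c
    rw [finrank_euclideanSpace_fin, abs_of_pos (by positivity)] at h1
    have h2 : ∀ y z : ℂ, y = (c ^ n)⁻¹ • z → z = ((c ^ n : ℝ) : ℂ) * y := fun y z hyz => by
      rw [hyz, ← Complex.real_smul, smul_smul, mul_inv_cancel₀ (by positivity), one_smul]
    refine (h2 _ _ h1).trans ?_
    congr 2
    ext ξ
    rw [norm_smul, Real.norm_of_nonneg hc.le, smul_smul, zpow_neg, ← hcdef,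
      inv_mul_cancel₀ hc.ne', one_smul, real_inner_smul_left, real_inner_smul_right]
    simp only [hh, hrad]
  rw [hscale, integral_exp_inner_mul_radial i₀ hint]
  congr 1
  unfold radialOsc
  rw [intervalIntegral.integral_of_le (by norm_num), ← integral_Icc_eq_integral_Ioc]
  have hsub : Icc (1 / 2 : ℝ) 2 ⊆ Ioi 0 := fun r hr => by
    have := hr.1
    rw [mem_Ioi]
    linarith
  have hval : ∀ r ∈ Ioi (0 : ℝ),
      Complex.exp (Complex.I * ((t * 2 ^ (m * k) * rescaledPhase φ m k r : ℝ) : ℂ)) *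
        (annularProfile Φ i₀ r : ℂ) * sphereMoment i₀ 0 (r * (c * ‖x‖)) =
      ((r ^ (n - 1) : ℝ) : ℂ) * h r * sphereMoment i₀ 0 (r * ‖c • x‖) := by
    intro r hr
    have h3 : t * 2 ^ (m * k) * rescaledPhase φ m k r = t * φ (c * r) := by
      have h4 : (2 : ℝ) ^ (m * k) * 2 ^ (-(m * k)) = 1 := by
        rw [← Real.rpow_add (by norm_num)]
        simp
      rw [rescaledPhase, ← hcdef]
      linear_combination (t * φ (c * r)) * h4
    rw [h3, norm_smul, Real.norm_of_nonneg hc.le, annularProfile, if_pos (mem_Ioi.1 hr)]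
    simp only [hh]
    push_cast
    ring_nf
  rw [← setIntegral_congr_fun measurableSet_Ioi hval]
  refine setIntegral_eq_of_subset_of_forall_sdiff_eq_zero measurableSet_Ioi hsub fun r hr => ?_
  rw [annularProfile_eq_zero hΦ i₀ hr.2]
  simp

end Kernel

/-! ### Estimates on a single dyadic shell: parts (a) and (b). -/

section Shell

variable {n : ℕ} {Φ : EuclideanSpace ℝ (Fin n) → ℝ} {φ : ℝ → ℝ} {m : ℝ} {S : Set ℝ}

lemma exists_norm_localizedKernel_dyadic_le (i₀ : Fin n) (hΦ : IsRadialCutoff Φ)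
    (hφ : ContDiffOn ℝ ∞ φ (Ioi 0)) (h : SymbolOrderOn φ m S) :
    ∃ C : ℝ, 0 < C ∧ ∀ k : ℤ, (∀ r ∈ Icc (1 / 2 : ℝ) 2, (2 : ℝ) ^ k * r ∈ S) →
      ∀ θ, 0 ≤ θ → θ ≤ ((n : ℝ) - 1) / 2 → ∀ t x, t ≠ 0 ∨ θ = 0 →
      ‖localizedKernel φ (fun ξ => annular Φ (((2 : ℝ) ^ (-k)) • ξ)) t x‖ ≤
        C * (|t| ^ (-θ) * 2 ^ ((k : ℝ) * ((n : ℝ) - m * θ))) := by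
  obtain ⟨c, hg⟩ := isPhaseFamily_rescaledPhase hφ h
  obtain ⟨C, hC, hC'⟩ := hg.exists_radialOsc_le_rpow i₀ (contDiff_annularProfile hΦ i₀)
    (fun r => annularProfile_eq_zero hΦ i₀)
  refine ⟨C, hC, fun k hk θ hθ hθ' t x ht => ?_⟩
  have h2 : (0 : ℝ) < 2 ^ (m * k) := by positivity
  rw [localizedKernel_dyadic i₀ hΦ hφ.continuousOn m, norm_mul, Complex.norm_real,
    Real.norm_of_nonneg (by positivity)]
  calc _ ≤ ((2 : ℝ) ^ k) ^ n * (C * |t * 2 ^ (m * k)| ^ (-θ)) := by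
        gcongr
        exact hC' ⟨k, hk⟩ _ _ θ hθ hθ' (ht.imp_left fun h => mul_ne_zero h h2.ne') (by positivity)
    _ = C * (|t| ^ (-θ) * (((2 : ℝ) ^ k) ^ n * (2 ^ (m * k)) ^ (-θ))) := by
        rw [abs_mul, abs_of_pos h2, Real.mul_rpow (abs_nonneg _) h2.le]
        ring
    _ = _ := by
        rw [← Real.rpow_mul (by norm_num), ← Real.rpow_intCast, ← Real.rpow_natCast,
          ← Real.rpow_mul (by norm_num), ← Real.rpow_add (by norm_num)]
        congr 3
        ring

lemma exists_norm_localizedKernel_dyadic_le' (i₀ : Fin n) (hΦ : IsRadialCutoff Φ)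
    (hφ : ContDiffOn ℝ ∞ φ (Ioi 0)) (h : SymbolOrderOn φ m S) {a : ℝ}
    (h' : SecondDerivOrderOn φ a S) :
    ∃ C : ℝ, 0 < C ∧ ∀ k : ℤ, (∀ r ∈ Icc (1 / 2 : ℝ) 2, (2 : ℝ) ^ k * r ∈ S) →
      ∀ θ, 0 ≤ θ → θ ≤ 1 → ∀ t x, t ≠ 0 ∨ ((n : ℝ) - 1 + θ) / 2 = 0 →
      ‖localizedKernel φ (fun ξ => annular Φ (((2 : ℝ) ^ (-k)) • ξ)) t x‖ ≤
        C * (|t| ^ (-(((n : ℝ) - 1 + θ) / 2)) * 2 ^ ((k : ℝ) *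
          ((n : ℝ) - m * ((n : ℝ) - 1 + θ) / 2 - θ * (a - m) / 2))) := by
  obtain ⟨c, hg⟩ := isPhaseFamily_rescaledPhase hφ h
  obtain ⟨C, hC, hC'⟩ := hg.exists_radialOsc_le_rpow_mul_rpow i₀ (contDiff_annularProfile hΦ i₀)
    (fun r => annularProfile_eq_zero hΦ i₀)
  obtain ⟨d, hd, hd'⟩ := exists_le_abs_iteratedDeriv_two_rescaledPhase (m := m) hφ h'
  refine ⟨C * (1 + d ^ (-(1 / 2) : ℝ)), by positivity, fun k hk θ hθ hθ' t x ht => ?_⟩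
  have hn : (1 : ℝ) ≤ n := by exact_mod_cast Nat.one_le_of_lt i₀.2
  have h2 : (0 : ℝ) < 2 ^ (m * k) := by positivity
  have h3 : (0 : ℝ) < 2 ^ ((a - m) * k) := by positivity
  -- A bound free of `θ`, whether `d` lies below or above 1.
  have hdθ : d ^ (-(θ / 2)) ≤ 1 + d ^ (-(1 / 2) : ℝ) := by
    have h4 : 0 < d ^ (-(1 / 2) : ℝ) := by positivity
    rcases le_total d 1 with h5 | h5
    · have := Real.rpow_le_rpow_of_exponent_ge hd h5 (show -(1 / 2) ≤ -(θ / 2) by linarith)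
      linarith
    · have := Real.rpow_le_one_of_one_le_of_nonpos h5 (show -(θ / 2) ≤ 0 by linarith)
      linarith
  have htp : |t| ^ (-(((n : ℝ) - 1) / 2)) * |t| ^ (-(θ / 2)) = |t| ^ (-(((n : ℝ) - 1 + θ) / 2)) := by
    rcases eq_or_ne t 0 with rfl | ht0
    · have h4 := ht.resolve_left (by simp)
      have h5 : θ = 0 := by linarith
      have h6 : (n : ℝ) = 1 := by linarith
      rw [h5, h6]
      simp
    · rw [← Real.rpow_add (abs_pos.2 ht0)]
      congr 1
      ring
  rw [localizedKernel_dyadic i₀ hΦ hφ.continuousOn m, norm_mul, Complex.norm_real,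
    Real.norm_of_nonneg (by positivity)]
  calc _ ≤ ((2 : ℝ) ^ k) ^ n * (C * (|t * 2 ^ (m * k)| ^ (-(((n : ℝ) - 1) / 2)) *
        (|t * 2 ^ (m * k)| * (d * 2 ^ ((a - m) * k))) ^ (-(θ / 2)))) := by
        gcongr
        exact hC' ⟨k, hk⟩ _ _ θ _ hθ hθ' (ht.imp_left fun h => mul_ne_zero h h2.ne')
          (by positivity) (by positivity) (hd' ⟨k, hk⟩)
    _ = C * d ^ (-(θ / 2)) * ((|t| ^ (-(((n : ℝ) - 1) / 2)) * |t| ^ (-(θ / 2))) *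
        (((2 : ℝ) ^ k) ^ n * (2 ^ (m * k)) ^ (-(((n : ℝ) - 1) / 2)) * (2 ^ (m * k)) ^ (-(θ / 2)) *
          (2 ^ ((a - m) * k)) ^ (-(θ / 2)))) := by
        rw [abs_mul, abs_of_pos h2, Real.mul_rpow (abs_nonneg _) h2.le,
          Real.mul_rpow (by positivity) (by positivity), Real.mul_rpow (abs_nonneg _) h2.le,
          Real.mul_rpow hd.le h3.le]
        ring
    _ = C * d ^ (-(θ / 2)) * (|t| ^ (-(((n : ℝ) - 1 + θ) / 2)) * 2 ^ ((k : ℝ) *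
          ((n : ℝ) - m * ((n : ℝ) - 1 + θ) / 2 - θ * (a - m) / 2))) := by
        rw [htp, ← Real.rpow_mul (by norm_num), ← Real.rpow_mul (by norm_num),
          ← Real.rpow_mul (by norm_num), ← Real.rpow_intCast, ← Real.rpow_natCast,
          ← Real.rpow_mul (by norm_num), ← Real.rpow_add (by norm_num),
          ← Real.rpow_add (by norm_num), ← Real.rpow_add (by norm_num)]
        congr 3
        ring
    _ ≤ _ := by gcongr

lemma hasCompactSupport_annular_smul (hΦ : IsRadialCutoff Φ) {c : ℝ} (hc : c ≠ 0) :
    HasCompactSupport fun ξ => annular Φ (c • ξ) :=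
  (hasCompactSupport_annular hΦ).comp_smul hc

lemma contDiff_annular_smul (hΦ : IsRadialCutoff Φ) (c : ℝ) :
    ContDiff ℝ ∞ fun ξ => annular Φ (c • ξ) :=
  (contDiff_annular hΦ).comp (contDiff_const_smul c)

lemma exists_eLpNorm_propagator_dyadicProj_le (i₀ : Fin n) (hΦ : IsRadialCutoff Φ)
    (hφ : ContDiffOn ℝ ∞ φ (Ioi 0)) (h : SymbolOrderOn φ m S) :
    ∃ C : ℝ≥0, ∀ k : ℤ, (∀ r ∈ Icc (1 / 2 : ℝ) 2, (2 : ℝ) ^ k * r ∈ S) →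
      ∀ θ, 0 ≤ θ → θ ≤ ((n : ℝ) - 1) / 2 →
      ∀ (t : ℝ) (u : EuclideanSpace ℝ (Fin n) → ℂ), Integrable u volume →
          eLpNorm (propagator φ t (dyadicProj Φ k u)) ∞ volume ≤
            (C : ℝ≥0∞) * ‖t‖ₑ ^ (-θ) * (2 : ℝ≥0∞) ^ ((k : ℝ) * ((n : ℝ) - m * θ)) *
              eLpNorm u 1 volume := by
  obtain ⟨C, hC, h1⟩ := exists_norm_localizedKernel_dyadic_le i₀ hΦ hφ h
  refine ⟨C.toNNReal, fun k hk θ hθ hθ' t u hu => ?_⟩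
  exact eLpNorm_propagator_multiplier_le_rpow i₀ hφ.continuousOn (contDiff_annular_smul hΦ _)
    (hasCompactSupport_annular_smul hΦ (by positivity)) hu hC hθ
    fun ht x => h1 k hk θ hθ hθ' t x ht

lemma exists_eLpNorm_propagator_dyadicProj_le' (i₀ : Fin n) (hΦ : IsRadialCutoff Φ)
    (hφ : ContDiffOn ℝ ∞ φ (Ioi 0)) (h : SymbolOrderOn φ m S) {a : ℝ}
    (h' : SecondDerivOrderOn φ a S) :
    ∃ C : ℝ≥0, ∀ k : ℤ, (∀ r ∈ Icc (1 / 2 : ℝ) 2, (2 : ℝ) ^ k * r ∈ S) →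
      ∀ θ : ℝ, 0 ≤ θ → θ ≤ 1 →
        ∀ (t : ℝ) (u : EuclideanSpace ℝ (Fin n) → ℂ), Integrable u volume →
          eLpNorm (propagator φ t (dyadicProj Φ k u)) ∞ volume ≤
            (C : ℝ≥0∞) * ‖t‖ₑ ^ (-(((n : ℝ) - 1 + θ) / 2)) *
              (2 : ℝ≥0∞) ^ ((k : ℝ) *
                ((n : ℝ) - m * ((n : ℝ) - 1 + θ) / 2 - θ * (a - m) / 2)) *
              eLpNorm u 1 volume := by
  have hn : (1 : ℝ) ≤ n := by exact_mod_cast Nat.one_le_of_lt i₀.2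
  obtain ⟨C, hC, h1⟩ := exists_norm_localizedKernel_dyadic_le' i₀ hΦ hφ h h'
  refine ⟨C.toNNReal, fun k hk θ hθ hθ' t u hu => ?_⟩
  exact eLpNorm_propagator_multiplier_le_rpow i₀ hφ.continuousOn (contDiff_annular_smul hΦ _)
    (hasCompactSupport_annular_smul hΦ (by positivity)) hu hC (by linarith)
    fun ht x => h1 k hk θ hθ hθ' t x ht

lemma shell_subset_Ici_one {k : ℤ} (hk : 0 < k) : ∀ r ∈ Icc (1 / 2 : ℝ) 2, (2 : ℝ) ^ k * r ∈ Ici 1 := by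
  intro r hr
  have h1 : (2 : ℝ) ^ (1 : ℤ) ≤ 2 ^ k := zpow_le_zpow_right₀ (by norm_num) (by omega)
  rw [zpow_one] at h1
  rw [mem_Ici]
  nlinarith [hr.1]

lemma shell_subset_Ioc {k l : ℤ} (hk : k < l) :
    ∀ r ∈ Icc (1 / 2 : ℝ) 2, (2 : ℝ) ^ k * r ∈ Ioc (0 : ℝ) (2 ^ l) := by
  intro r hr
  have h1 : (2 : ℝ) ^ (k + 1) ≤ 2 ^ l := zpow_le_zpow_right₀ (by norm_num) (by omega)
  rw [zpow_add_one₀ (by norm_num)] at h1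
  have h2 : (0 : ℝ) < 2 ^ k := by positivity
  exact ⟨mul_pos h2 (by linarith [hr.1]), by nlinarith [hr.2]⟩

lemma Ici_one_subset_Ioi : Ici (1 : ℝ) ⊆ Ioi 0 := fun _ hr => mem_Ioi.2 (one_pos.trans_le hr)

lemma shell_subset_Ici_one_union {k : ℤ} (hk : 0 ≤ k) :
    ∀ r ∈ Icc (1 / 2 : ℝ) 2, (2 : ℝ) ^ k * r ∈ Ici 1 ∪ Icc (1 / 2) 1 := by
  intro r hr
  rcases hk.eq_or_lt with rfl | hk
  · rw [zpow_zero, one_mul]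
    rcases le_total 1 r with h | h
    · exact Or.inl h
    · exact Or.inr ⟨hr.1, h⟩
  · exact Or.inl (shell_subset_Ici_one hk r hr)

lemma high_frequency_decay (i₀ : Fin n) (hΦ : IsRadialCutoff Φ) (hφ : ContDiffOn ℝ ∞ φ (Ioi 0))
    (hH : H1 φ m) :
    ∃ C : ℝ≥0, ∀ k : ℤ, 0 ≤ k → (k = 0 → ∀ r ∈ Icc (1 / 2 : ℝ) 1, deriv φ r ≠ 0) →
      ∀ θ : ℝ, 0 ≤ θ → θ ≤ ((n : ℝ) - 1) / 2 →
      ∀ (t : ℝ) (u : EuclideanSpace ℝ (Fin n) → ℂ), Integrable u volume →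
        eLpNorm (propagator φ t (dyadicProj Φ k u)) ∞ volume ≤
          (C : ℝ≥0∞) * ‖t‖ₑ ^ (-θ) * (2 : ℝ≥0∞) ^ ((k : ℝ) * ((n : ℝ) - m * θ)) *
            eLpNorm u 1 volume := by
  -- The constant is chosen before `k`. If `φ'` has a zero in `[1/2, 1]`, then `k = 0` is excluded
  -- and every remaining shell lies in `[1, ∞)`.
  by_cases h0 : ∀ r ∈ Icc (1 / 2 : ℝ) 1, deriv φ r ≠ 0
  · obtain ⟨C, hC⟩ := exists_eLpNorm_propagator_dyadicProj_le i₀ hΦ hφ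
      (SymbolOrderOn.union_Icc hφ hH.2 Ici_one_subset_Ioi one_half_pos h0)
    exact ⟨C, fun k hk _ => hC k (shell_subset_Ici_one_union hk)⟩
  · obtain ⟨C, hC⟩ := exists_eLpNorm_propagator_dyadicProj_le i₀ hΦ hφ hH.2
    exact ⟨C, fun k hk hk0 => hC k (shell_subset_Ici_one
      (hk.lt_of_ne' fun h => h0 (hk0 h)))⟩

lemma high_frequency_decay' (i₀ : Fin n) (hΦ : IsRadialCutoff Φ) (hφ : ContDiffOn ℝ ∞ φ (Ioi 0))
    {a : ℝ} (hH : H1 φ m) (hH3 : H3 φ a) :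
    ∃ C : ℝ≥0, ∀ k : ℤ, 0 ≤ k →
      (k = 0 → ∀ r ∈ Icc (1 / 2 : ℝ) 1, deriv φ r ≠ 0 ∧ iteratedDeriv 2 φ r ≠ 0) →
      ∀ θ : ℝ, 0 ≤ θ → θ ≤ 1 →
      ∀ (t : ℝ) (u : EuclideanSpace ℝ (Fin n) → ℂ), Integrable u volume →
        eLpNorm (propagator φ t (dyadicProj Φ k u)) ∞ volume ≤
          (C : ℝ≥0∞) * ‖t‖ₑ ^ (-(((n : ℝ) - 1 + θ) / 2)) *
            (2 : ℝ≥0∞) ^ ((k : ℝ) *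
              ((n : ℝ) - m * ((n : ℝ) - 1 + θ) / 2 - θ * (a - m) / 2)) *
            eLpNorm u 1 volume := by
  by_cases h0 : ∀ r ∈ Icc (1 / 2 : ℝ) 1, deriv φ r ≠ 0 ∧ iteratedDeriv 2 φ r ≠ 0
  · obtain ⟨C, hC⟩ := exists_eLpNorm_propagator_dyadicProj_le' i₀ hΦ hφ
      (SymbolOrderOn.union_Icc hφ hH.2 Ici_one_subset_Ioi one_half_pos fun r hr => (h0 r hr).1)
      (SecondDerivOrderOn.union_Icc hφ hH3 Ici_one_subset_Ioi one_half_pos fun r hr => (h0 r hr).2)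
    exact ⟨C, fun k hk _ => hC k (shell_subset_Ici_one_union hk)⟩
  · obtain ⟨C, hC⟩ := exists_eLpNorm_propagator_dyadicProj_le' i₀ hΦ hφ hH.2 hH3
    exact ⟨C, fun k hk hk0 => hC k (shell_subset_Ici_one
      (hk.lt_of_ne' fun h => h0 (hk0 h)))⟩

lemma low_shell_decay (i₀ : Fin n) (hΦ : IsRadialCutoff Φ) (hφ : ContDiffOn ℝ ∞ φ (Ioi 0))
    (hH : H2 φ m) :
    ∃ C : ℝ≥0, ∀ k : ℤ, k < 0 → ∀ θ : ℝ, 0 ≤ θ → θ ≤ ((n : ℝ) - 1) / 2 →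
      ∀ (t : ℝ) (u : EuclideanSpace ℝ (Fin n) → ℂ), Integrable u volume →
        eLpNorm (propagator φ t (dyadicProj Φ k u)) ∞ volume ≤
          (C : ℝ≥0∞) * ‖t‖ₑ ^ (-θ) * (2 : ℝ≥0∞) ^ ((k : ℝ) * ((n : ℝ) - m * θ)) *
            eLpNorm u 1 volume := by
  obtain ⟨C, hC⟩ := exists_eLpNorm_propagator_dyadicProj_le i₀ hΦ hφ (SymbolOrderOn.Ioc hφ hH.2)
  exact ⟨C, fun k hk => hC k (by simpa using shell_subset_Ioc hk)⟩

lemma low_shell_decay' (i₀ : Fin n) (hΦ : IsRadialCutoff Φ) (hφ : ContDiffOn ℝ ∞ φ (Ioi 0))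
    {a : ℝ} (hH : H2 φ m) (hH4 : H4 φ a) :
    ∃ C : ℝ≥0, ∀ k : ℤ, k < 0 → ∀ θ : ℝ, 0 ≤ θ → θ ≤ 1 →
      ∀ (t : ℝ) (u : EuclideanSpace ℝ (Fin n) → ℂ), Integrable u volume →
        eLpNorm (propagator φ t (dyadicProj Φ k u)) ∞ volume ≤
          (C : ℝ≥0∞) * ‖t‖ₑ ^ (-(((n : ℝ) - 1 + θ) / 2)) *
            (2 : ℝ≥0∞) ^ ((k : ℝ) *
              ((n : ℝ) - m * ((n : ℝ) - 1 + θ) / 2 - θ * (a - m) / 2)) *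
            eLpNorm u 1 volume := by
  obtain ⟨C, hC⟩ := exists_eLpNorm_propagator_dyadicProj_le' i₀ hΦ hφ (SymbolOrderOn.Ioc hφ hH.2)
    (SecondDerivOrderOn.Ioc hφ hH4)
  exact ⟨C, fun k hk => hC k (by simpa using shell_subset_Ioc hk)⟩

end Shell

/-! ### Geometric sums. -/

section Geometric

lemma sum_pow_le_of_injOn {q : ℝ} (hq : 0 < q) (hq1 : q < 1) (s : Finset ℕ) {f : ℕ → ℕ}
    (hf : Set.InjOn f s) : ∑ j ∈ s, q ^ f j ≤ (1 - q)⁻¹ := by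
  rw [← Finset.sum_image (f := fun i => q ^ i) hf, ← tsum_geometric_of_lt_one hq.le hq1]
  exact (summable_geometric_of_lt_one hq.le hq1).sum_le_tsum _ fun _ _ => by positivity

/-- A geometric sum is controlled by its largest term. -/
lemma exists_sum_geometric_le {q : ℝ} (hq : 0 < q) (hq1 : q ≠ 1) :
    ∃ C : ℝ, 0 < C ∧ ∀ (Z M : ℝ), 0 ≤ Z → 0 ≤ M → ∀ s : Finset ℕ, (∀ j ∈ s, Z * q ^ j ≤ M) →
      ∑ j ∈ s, Z * q ^ j ≤ C * M := by
  rcases hq1.lt_or_gt with h | h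
  · refine ⟨(1 - q)⁻¹, inv_pos.2 (by linarith), fun Z M hZ hM s hs => ?_⟩
    rcases s.eq_empty_or_nonempty with rfl | hne
    · rw [Finset.sum_empty]
      exact mul_nonneg (inv_nonneg.2 (by linarith)) hM
    set j₀ := s.min' hne
    have h1 : ∑ j ∈ s, Z * q ^ j = Z * q ^ j₀ * ∑ j ∈ s, q ^ (j - j₀) := by
      rw [Finset.mul_sum]
      refine Finset.sum_congr rfl fun j hj => ?_
      rw [mul_assoc, ← pow_add, Nat.add_sub_cancel' (s.min'_le j hj)]
    rw [h1, mul_comm]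
    refine mul_le_mul (sum_pow_le_of_injOn hq h s fun a ha b hb hab => ?_)
      (hs _ (s.min'_mem hne)) (by positivity) (inv_nonneg.2 (by linarith))
    have := s.min'_le a ha
    have := s.min'_le b hb
    omega
  · have hq' : q⁻¹ < 1 := inv_lt_one_of_one_lt₀ h
    refine ⟨(1 - q⁻¹)⁻¹, inv_pos.2 (by linarith), fun Z M hZ hM s hs => ?_⟩
    rcases s.eq_empty_or_nonempty with rfl | hne
    · rw [Finset.sum_empty]
      exact mul_nonneg (inv_nonneg.2 (by linarith)) hM
    set j₁ := s.max' hne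
    have h1 : ∑ j ∈ s, Z * q ^ j = Z * q ^ j₁ * ∑ j ∈ s, q⁻¹ ^ (j₁ - j) := by
      rw [Finset.mul_sum]
      refine Finset.sum_congr rfl fun j hj => ?_
      have h2 := s.le_max' j hj
      rw [mul_assoc, inv_pow]
      congr 1
      rw [eq_mul_inv_iff_mul_eq₀ (by positivity), ← pow_add, Nat.add_sub_cancel' h2]
    rw [h1, mul_comm]
    refine mul_le_mul (sum_pow_le_of_injOn (inv_pos.2 hq) hq' s fun a ha b hb hab => ?_)
      (hs _ (s.max'_mem hne)) (by positivity) (inv_nonneg.2 (by linarith))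
    have := s.le_max' a ha
    have := s.le_max' b hb
    omega

lemma two_rpow_neg_natCast_mul (j : ℕ) (γ : ℝ) :
    (2 : ℝ) ^ (((-(j : ℤ) : ℤ) : ℝ) * γ) = ((2 : ℝ) ^ (-γ)) ^ j := by
  rw [← Real.rpow_natCast, ← Real.rpow_mul (by norm_num)]
  congr 1
  push_cast
  ring

lemma two_rpow_neg_ne_one {γ : ℝ} (hγ : γ ≠ 0) : (2 : ℝ) ^ (-γ) ≠ 1 := by
  intro h
  rw [← Real.rpow_zero 2] at h
  have := (Real.strictMono_rpow_of_base_gt_one (by norm_num : (1 : ℝ) < 2)).injective h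
  exact hγ (by linarith)

/-- The sum over low-frequency shells of the trivial bound against a decaying one. -/
lemma exists_sum_min_le {d m N : ℝ} (hd : 0 < d) (hm : 0 < m) (hN : d < m * N) :
    ∃ C : ℝ, 0 < C ∧ ∀ T : ℝ, 0 < T → ∀ s : Finset ℕ,
      ∑ j ∈ s, min ((2 : ℝ) ^ (((-(j : ℤ) : ℤ) : ℝ) * d))
        (T ^ (-N) * 2 ^ (((-(j : ℤ) : ℤ) : ℝ) * (d - m * N))) ≤ C * T ^ (-(d / m)) := by
  obtain ⟨C₁, hC₁, h₁⟩ := exists_sum_geometric_le (q := (2 : ℝ) ^ (-d)) (by positivity)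
    (two_rpow_neg_ne_one hd.ne')
  obtain ⟨C₂, hC₂, h₂⟩ := exists_sum_geometric_le (q := (2 : ℝ) ^ (-(d - m * N))) (by positivity)
    (two_rpow_neg_ne_one (by linarith))
  refine ⟨C₁ + C₂, by positivity, fun T hT s => ?_⟩
  have hM : 0 < T ^ (-(d / m)) := by positivity
  -- The crossover is at `2^{-j} ≈ T^{-1/m}`, where both bounds equal `T^{-d/m}`. On each side one
  -- of them is geometric with that value as an upper bound.
  rw [← Finset.sum_filter_add_sum_filter_not s
    (fun j : ℕ => (2 : ℝ) ^ (((-(j : ℤ) : ℤ) : ℝ) * d) ≤ T ^ (-(d / m))), add_mul]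
  refine add_le_add ?_ ?_
  · refine le_trans (Finset.sum_le_sum fun j _ => min_le_left _ _) ?_
    have h3 := h₁ 1 _ zero_le_one hM.le
      (s.filter fun j : ℕ => (2 : ℝ) ^ (((-(j : ℤ) : ℤ) : ℝ) * d) ≤ T ^ (-(d / m))) fun j hj => by
        rw [one_mul, ← two_rpow_neg_natCast_mul]
        exact (Finset.mem_filter.1 hj).2
    simpa only [one_mul, ← two_rpow_neg_natCast_mul] using h3
  · refine le_trans (Finset.sum_le_sum fun j _ => min_le_right _ _) ?_
    have h3 := h₂ (T ^ (-N)) _ (by positivity) hM.le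
      (s.filter fun j : ℕ => ¬ (2 : ℝ) ^ (((-(j : ℤ) : ℤ) : ℝ) * d) ≤ T ^ (-(d / m))) fun j hj => by
        rw [← two_rpow_neg_natCast_mul]
        have h4 := not_le.1 (Finset.mem_filter.1 hj).2
        -- Written as a nonpositive power of `2^{-jd}`, so that the lower bound on the latter
        -- becomes an upper bound.
        have h5 : (2 : ℝ) ^ (((-(j : ℤ) : ℤ) : ℝ) * (d - m * N)) =
            ((2 : ℝ) ^ (((-(j : ℤ) : ℤ) : ℝ) * d)) ^ (1 - m * N / d) := by
          rw [← Real.rpow_mul (by norm_num)]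
          congr 1
          field_simp
        have h6 : 1 - m * N / d ≤ 0 := by
          rw [sub_nonpos, one_le_div hd]
          exact hN.le
        rw [h5]
        calc T ^ (-N) * ((2 : ℝ) ^ (((-(j : ℤ) : ℤ) : ℝ) * d)) ^ (1 - m * N / d)
            ≤ T ^ (-N) * (T ^ (-(d / m))) ^ (1 - m * N / d) :=
              mul_le_mul_of_nonneg_left (Real.rpow_le_rpow_of_nonpos hM h4.le h6) (by positivity)
          _ = T ^ (-(d / m)) := by
              rw [← Real.rpow_mul hT.le, ← Real.rpow_add hT]
              congr 1
              field_simp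
              ring
    simpa only [← two_rpow_neg_natCast_mul] using h3

end Geometric

/-! ### Dyadic decomposition of the low-frequency kernel. -/

section LowFrequency

variable {n : ℕ} {Φ : EuclideanSpace ℝ (Fin n) → ℝ} {φ : ℝ → ℝ}

lemma localizedKernel_add (i₀ : Fin n) (hφ : ContinuousOn φ (Ioi 0))
    {χ₁ χ₂ : EuclideanSpace ℝ (Fin n) → ℝ} (h₁ : Continuous χ₁) (h₁' : HasCompactSupport χ₁)
    (h₂ : Continuous χ₂) (h₂' : HasCompactSupport χ₂) (t : ℝ) (x : EuclideanSpace ℝ (Fin n)) :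
    localizedKernel φ (fun ξ => χ₁ ξ + χ₂ ξ) t x =
      localizedKernel φ χ₁ t x + localizedKernel φ χ₂ t x := by
  have hint : ∀ {χ : EuclideanSpace ℝ (Fin n) → ℝ}, Continuous χ → HasCompactSupport χ →
      Integrable fun ξ : EuclideanSpace ℝ (Fin n) =>
        Complex.exp (Complex.I * ((inner ℝ ξ x : ℝ) : ℂ)) *
          (Complex.exp (Complex.I * (t : ℂ) * (φ ‖ξ‖ : ℂ)) * (χ ξ : ℂ)) := fun hχ hχ' => by
    refine (integrable_exp_radial_mul i₀ hφ t hχ hχ').bdd_mul (c := 1)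
      (Continuous.aestronglyMeasurable (by fun_prop)) (Filter.Eventually.of_forall fun ξ => ?_)
    rw [norm_exp_I_mul_ofReal]
  unfold localizedKernel
  rw [← integral_add (hint h₁ h₁') (hint h₂ h₂')]
  congr 1
  ext ξ
  push_cast
  ring

lemma localizedKernel_low_eq_sum_add (i₀ : Fin n) (hφ : ContinuousOn φ (Ioi 0))
    (hΦ : IsRadialCutoff Φ) (t : ℝ) (x : EuclideanSpace ℝ (Fin n)) (J : ℕ) :
    localizedKernel φ Φ t x =
      ∑ j ∈ Finset.range J,
        localizedKernel φ (fun ξ => annular Φ (((2 : ℝ) ^ (-(-(j : ℤ)))) • ξ)) t x +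
      localizedKernel φ (fun ξ => Φ (((2 : ℝ) ^ J) • ξ)) t x := by
  induction J with
  | zero => simp
  | succ J ih =>
    -- Telescoping: `ψ(2^J ξ) = Φ(2^J ξ) - Φ(2^{J+1} ξ)`.
    have h1 : (fun ξ => Φ (((2 : ℝ) ^ J) • ξ)) = fun ξ =>
        annular Φ (((2 : ℝ) ^ (-(-(J : ℤ)))) • ξ) + Φ (((2 : ℝ) ^ (J + 1)) • ξ) := by
      ext ξ
      rw [annular, neg_neg, zpow_natCast, smul_smul, pow_succ']
      ring
    have h2 : Continuous fun ξ => Φ (((2 : ℝ) ^ (J + 1)) • ξ) :=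
      hΦ.smooth.continuous.comp (continuous_const_smul _)
    have h3 : HasCompactSupport fun ξ => Φ (((2 : ℝ) ^ (J + 1)) • ξ) :=
      hΦ.hasCompactSupport.comp_smul (c := (2 : ℝ) ^ (J + 1)) (by positivity)
    rw [ih, h1, localizedKernel_add i₀ hφ (contDiff_annular_smul hΦ _).continuous
      (hasCompactSupport_annular_smul hΦ (by positivity)) h2 h3, Finset.sum_range_succ, add_assoc]

/-- The remainder after `J` shells is at most `2^{-Jn} ‖Φ‖₁`. The bound is stated at a fixed `x`, as
the critical case requires. -/
lemma norm_localizedKernel_low_le (i₀ : Fin n) (hφ : ContinuousOn φ (Ioi 0))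
    (hΦ : IsRadialCutoff Φ) {t B : ℝ} {x : EuclideanSpace ℝ (Fin n)}
    (hB : ∀ s : Finset ℕ, ∑ j ∈ s,
      ‖localizedKernel φ (fun ξ => annular Φ (((2 : ℝ) ^ (-(-(j : ℤ)))) • ξ)) t x‖ ≤ B) :
    ‖localizedKernel φ Φ t x‖ ≤ B := by
  have hn : n ≠ 0 := (Nat.pos_of_ne_zero fun h => by subst h; exact i₀.elim0).ne'
  have h1 : ∀ J : ℕ, ‖localizedKernel φ Φ t x‖ ≤ B + (((2 : ℝ) ^ n)⁻¹) ^ J * ∫ ξ, |Φ ξ| := by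
    intro J
    rw [localizedKernel_low_eq_sum_add i₀ hφ hΦ t x J]
    refine (norm_add_le _ _).trans (add_le_add ((norm_sum_le _ _).trans (hB _)) ?_)
    refine (norm_localizedKernel_le _ _ _ _).trans (le_of_eq ?_)
    rw [Measure.integral_comp_smul volume (fun ξ => |Φ ξ|), finrank_euclideanSpace_fin,
      abs_of_pos (by positivity), smul_eq_mul, inv_pow, ← pow_mul, ← pow_mul, mul_comm J n]
  have h2 : Filter.Tendsto (fun J : ℕ => B + (((2 : ℝ) ^ n)⁻¹) ^ J * ∫ ξ, |Φ ξ|) Filter.atTop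
      (nhds (B + 0 * ∫ ξ, |Φ ξ|)) :=
    ((tendsto_pow_atTop_nhds_zero_of_lt_one (by positivity)
      (inv_lt_one_of_one_lt₀ (one_lt_pow₀ (by norm_num) hn))).mul_const _).const_add B
  rw [zero_mul, add_zero] at h2
  exact ge_of_tendsto' h2 h1

lemma exists_eLpNorm_propagator_lowProj_le (i₀ : Fin n) (hφ : ContinuousOn φ (Ioi 0))
    (hΦ : IsRadialCutoff Φ) {θ : ℝ} (hθ : 0 ≤ θ)
    (h : ∃ C : ℝ, 0 < C ∧ ∀ t : ℝ, 1 ≤ |t| → ∀ x, ‖localizedKernel φ Φ t x‖ ≤ C * |t| ^ (-θ)) :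
    ∃ C : ℝ≥0, ∀ (t : ℝ) (u : EuclideanSpace ℝ (Fin n) → ℂ), Integrable u volume →
      eLpNorm (propagator φ t (lowProj Φ u)) ∞ volume ≤
        (C : ℝ≥0∞) * (1 + ‖t‖ₑ) ^ (-θ) * eLpNorm u 1 volume := by
  obtain ⟨C, hC, h⟩ := h
  set I₀ : ℝ := ∫ ξ, |Φ ξ| with hI
  have hI0 : 0 ≤ I₀ := integral_nonneg fun _ => abs_nonneg _
  refine ⟨((C + I₀) * 2 ^ θ).toNNReal, fun t u hu => ?_⟩
  have h1 : ∀ x, ‖localizedKernel φ Φ t x‖ ≤ (C + I₀) * 2 ^ θ * (1 + |t|) ^ (-θ) := by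
    intro x
    have hp : 0 < (2 : ℝ) ^ θ * (1 + |t|) ^ (-θ) := by positivity
    rcases le_or_gt 1 |t| with ht | ht
    · have h2 : |t| ^ (-θ) ≤ 2 ^ θ * (1 + |t|) ^ (-θ) := by
        have h3 : (2 : ℝ) ^ θ * (2 * |t|) ^ (-θ) = |t| ^ (-θ) := by
          rw [Real.mul_rpow (by norm_num) (abs_nonneg _), ← mul_assoc,
            ← Real.rpow_add (by norm_num), add_neg_cancel, Real.rpow_zero, one_mul]
        rw [← h3]
        refine mul_le_mul_of_nonneg_left ?_ (by positivity)
        exact Real.rpow_le_rpow_of_nonpos (by positivity) (by linarith) (by linarith)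
      calc _ ≤ C * |t| ^ (-θ) := h t ht x
        _ ≤ C * (2 ^ θ * (1 + |t|) ^ (-θ)) := by gcongr
        _ ≤ (C + I₀) * (2 ^ θ * (1 + |t|) ^ (-θ)) := by gcongr; linarith
        _ = _ := by ring
    · have h2 : 1 ≤ (2 : ℝ) ^ θ * (1 + |t|) ^ (-θ) := by
        rw [Real.rpow_neg (by positivity), ← div_eq_mul_inv, ← Real.div_rpow (by norm_num)
          (by positivity)]
        exact Real.one_le_rpow ((one_le_div (by positivity)).2 (by linarith)) hθ
      have h3 := norm_localizedKernel_le φ Φ t x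
      calc _ ≤ I₀ := h3
        _ ≤ (C + I₀) * 1 := by linarith
        _ ≤ (C + I₀) * (2 ^ θ * (1 + |t|) ^ (-θ)) := by gcongr
        _ = _ := by ring
  refine (eLpNorm_propagator_multiplier_le i₀ hφ hΦ.smooth hΦ.hasCompactSupport hu h1).trans
    (le_of_eq ?_)
  have h4 : (1 + ‖t‖ₑ) ^ (-θ) = ENNReal.ofReal ((1 + |t|) ^ (-θ)) := by
    rw [← ENNReal.ofReal_rpow_of_pos (by positivity), ENNReal.ofReal_add (by norm_num)
      (abs_nonneg _), ENNReal.ofReal_one, ← Real.norm_eq_abs, ofReal_norm]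
  rw [h4, ENNReal.ofReal_mul (by positivity)]
  rfl

end LowFrequency

/-! ### Summation over the shells. -/

section Summation

variable {ι : Type*} {F : ι → ℕ → ℝ} {T R : ι → ℝ}

/-- If `m θ < d`, the decaying bounds form a convergent geometric series dominated by `j = 0`. If `m
θ > d`, they are balanced against the trivial bounds, which gives the rate `d / m`. -/
lemma exists_sum_shell_le {d m θ : ℝ} (hd : 0 < d) (hm : 0 < m) (hθ : m * θ ≠ d)
    (hT : ∀ i, 1 ≤ T i)
    (h₁ : ∃ C : ℝ, 0 < C ∧ ∀ i (j : ℕ), F i j ≤ C * 2 ^ (((-(j : ℤ) : ℤ) : ℝ) * d))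
    (h₂ : ∃ C : ℝ, 0 < C ∧ ∀ i (j : ℕ),
      F i j ≤ C * (T i ^ (-θ) * 2 ^ (((-(j : ℤ) : ℤ) : ℝ) * (d - m * θ)))) :
    ∃ C : ℝ, 0 < C ∧ ∀ i (s : Finset ℕ), ∑ j ∈ s, F i j ≤ C * T i ^ (-(min (d / m) θ)) := by
  obtain ⟨C₁, hC₁, h₁⟩ := h₁
  obtain ⟨C₂, hC₂, h₂⟩ := h₂
  rcases hθ.lt_or_gt with h | h
  · obtain ⟨C₃, hC₃, h₃⟩ := exists_sum_geometric_le (q := (2 : ℝ) ^ (-(d - m * θ)))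
      (by positivity) (two_rpow_neg_ne_one (by linarith))
    refine ⟨C₂ * C₃, by positivity, fun i s => ?_⟩
    have hT0 : 0 < T i := one_pos.trans_le (hT i)
    have hmin : min (d / m) θ = θ := min_eq_right (by rw [le_div_iff₀ hm]; linarith)
    have h4 : (2 : ℝ) ^ (-(d - m * θ)) ≤ 1 :=
      Real.rpow_le_one_of_one_le_of_nonpos (by norm_num) (by linarith)
    rw [hmin, mul_assoc]
    calc _ ≤ ∑ j ∈ s, C₂ * (T i ^ (-θ) * ((2 : ℝ) ^ (-(d - m * θ))) ^ j) :=
          Finset.sum_le_sum fun j _ => by rw [← two_rpow_neg_natCast_mul]; exact h₂ i j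
      _ = C₂ * ∑ j ∈ s, T i ^ (-θ) * ((2 : ℝ) ^ (-(d - m * θ))) ^ j := by rw [Finset.mul_sum]
      _ ≤ _ := mul_le_mul_of_nonneg_left (h₃ _ _ (by positivity) (by positivity) s fun j _ =>
          mul_le_of_le_one_right (by positivity) (pow_le_one₀ (by positivity) h4)) hC₂.le
  · obtain ⟨C₃, hC₃, h₃⟩ := exists_sum_min_le hd hm h
    refine ⟨(C₁ + C₂) * C₃, by positivity, fun i s => ?_⟩
    have hT0 : 0 < T i := one_pos.trans_le (hT i)
    have hmin : min (d / m) θ = d / m := min_eq_left (by rw [div_le_iff₀ hm]; linarith)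
    rw [hmin, mul_assoc]
    refine le_trans ?_ (mul_le_mul_of_nonneg_left (h₃ (T i) hT0 s) (by positivity))
    rw [Finset.mul_sum]
    refine Finset.sum_le_sum fun j _ => ?_
    rw [mul_min_of_nonneg _ _ (by positivity)]
    refine le_min ((h₁ i j).trans ?_) ((h₂ i j).trans ?_)
    · gcongr; linarith
    · gcongr; linarith

/-- The critical exponent: all shells share the bound `T^{-(ν+δ)}`. For fixed `R` the stationary
bounds are nevertheless geometric in `j`, with ratio `2^{-(m-1)ν} ≠ 1`, so the sum is comparable to
its largest term and no logarithm appears. -/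
lemma exists_sum_shell_le_of_dichotomy {d m ν δ c : ℝ} (hd : 0 < d) (hm : 0 < m) (hm1 : m ≠ 1)
    (hν : 0 < ν) (hνδ : m * (ν + δ) = d) (hc : 0 < c)
    (hT : ∀ i, 1 ≤ T i) (hR : ∀ i, 0 ≤ R i)
    (h₁ : ∃ C : ℝ, 0 < C ∧ ∀ i (j : ℕ), F i j ≤ C * 2 ^ (((-(j : ℤ) : ℤ) : ℝ) * d))
    (h₂ : ∀ N : ℕ, ∃ C : ℝ, 0 < C ∧ ∀ i (j : ℕ),
      F i j ≤ C * (T i ^ (-(N : ℝ)) * 2 ^ (((-(j : ℤ) : ℤ) : ℝ) * (d - m * N))) ∨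
      (c * (T i * 2 ^ (((-(j : ℤ) : ℤ) : ℝ) * m)) ≤ 2 ^ ((-(j : ℤ) : ℤ) : ℝ) * R i ∧
        F i j ≤ C * (2 ^ (((-(j : ℤ) : ℤ) : ℝ) * d) * ((2 ^ ((-(j : ℤ) : ℤ) : ℝ) * R i) ^ (-ν) *
          (T i * 2 ^ (((-(j : ℤ) : ℤ) : ℝ) * m)) ^ (-δ))))) :
    ∃ C : ℝ, 0 < C ∧ ∀ i (s : Finset ℕ), ∑ j ∈ s, F i j ≤ C * T i ^ (-(ν + δ)) := by
  obtain ⟨N, hN⟩ := exists_nat_gt (d / m)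
  have hN' : d < m * N := by rw [div_lt_iff₀ hm] at hN; linarith
  obtain ⟨C₁, hC₁, h₁⟩ := h₁
  obtain ⟨C₂, hC₂, h₂⟩ := h₂ N
  obtain ⟨C₃, hC₃, h₃⟩ := exists_sum_min_le hd hm hN'
  have hq : (m - 1) * ν ≠ 0 := mul_ne_zero (sub_ne_zero.2 hm1) hν.ne'
  obtain ⟨C₄, hC₄, h₄⟩ := exists_sum_geometric_le (q := (2 : ℝ) ^ (-((m - 1) * ν)))
    (by positivity) (two_rpow_neg_ne_one hq)
  have hdm : d / m = ν + δ := by rw [← hνδ]; field_simp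
  refine ⟨(C₁ + C₂) * C₃ + C₂ * (C₄ * c ^ (-ν)), by positivity, fun i s => ?_⟩
  have hT0 : 0 < T i := one_pos.trans_le (hT i)
  -- The nonstationary shells. As `m N > d`, the trivial and rapid bounds sum to `T^{-d/m} =
  -- T^{-(ν+δ)}`.
  set P : ℕ → Prop := fun j =>
    F i j ≤ C₂ * (T i ^ (-(N : ℝ)) * 2 ^ (((-(j : ℤ) : ℤ) : ℝ) * (d - m * N)))
  classical
  rw [← Finset.sum_filter_add_sum_filter_not s P, add_mul]
  refine add_le_add ?_ ?_
  · rw [← hdm, mul_assoc]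
    refine le_trans ?_ (mul_le_mul_of_nonneg_left (h₃ (T i) hT0 (s.filter P)) (by positivity))
    rw [Finset.mul_sum]
    refine Finset.sum_le_sum fun j hj => ?_
    rw [mul_min_of_nonneg _ _ (by positivity)]
    refine le_min ((h₁ i j).trans ?_) (((Finset.mem_filter.1 hj).2).trans ?_)
    · gcongr; linarith
    · gcongr; linarith
  · have h5 : ∀ j ∈ s.filter (fun j => ¬ P j), 0 < R i ∧
        F i j ≤ C₂ * (R i ^ (-ν) * T i ^ (-δ) * ((2 : ℝ) ^ (-((m - 1) * ν))) ^ j) ∧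
        R i ^ (-ν) * T i ^ (-δ) * ((2 : ℝ) ^ (-((m - 1) * ν))) ^ j ≤
          c ^ (-ν) * T i ^ (-(ν + δ)) := by
      intro j hj
      obtain ⟨h6, h7⟩ := (h₂ i j).resolve_left (Finset.mem_filter.1 hj).2
      rw [← two_rpow_neg_natCast_mul]
      set κ : ℝ := ((-(j : ℤ) : ℤ) : ℝ)
      have hRi : 0 < R i := by
        refine (hR i).lt_of_ne' fun h0 => ?_
        rw [h0, mul_zero] at h6
        exact absurd h6 (not_le.2 (by positivity))
      refine ⟨hRi, h7.trans (le_of_eq ?_), ?_⟩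
      · congr 1
        rw [Real.mul_rpow (by positivity) hRi.le, Real.mul_rpow hT0.le (by positivity),
          ← Real.rpow_mul (by norm_num), ← Real.rpow_mul (by norm_num)]
        have h8 : (2 : ℝ) ^ (κ * ((m - 1) * ν)) =
            2 ^ (κ * d) * (2 ^ (κ * -ν) * 2 ^ (κ * m * -δ)) := by
          rw [← Real.rpow_add (by norm_num), ← Real.rpow_add (by norm_num), ← hνδ]
          congr 1
          ring
        rw [h8]
        ring
      -- The stationarity condition, raised to the power `-ν`, bounds each term of the progression
      -- by `c^{-ν} T^{-(ν+δ)}`.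
      · have h8 : c * T i ≤ 2 ^ (κ * (1 - m)) * R i := by
          have h9 : (2 : ℝ) ^ κ = 2 ^ (κ * (1 - m)) * 2 ^ (κ * m) := by
            rw [← Real.rpow_add (by norm_num)]
            congr 1
            ring
          rw [h9] at h6
          have h10 : (0 : ℝ) < 2 ^ (κ * m) := by positivity
          refine le_of_mul_le_mul_right ?_ h10
          linarith
        have h9 := Real.rpow_le_rpow_of_nonpos (by positivity) h8 (neg_nonpos.2 hν.le)
        rw [Real.mul_rpow (by positivity) hRi.le, Real.mul_rpow hc.le hT0.le,
          ← Real.rpow_mul (by norm_num)] at h9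
        have h10 : κ * (1 - m) * -ν = κ * ((m - 1) * ν) := by ring
        rw [h10] at h9
        calc R i ^ (-ν) * T i ^ (-δ) * 2 ^ (κ * ((m - 1) * ν))
            = 2 ^ (κ * ((m - 1) * ν)) * R i ^ (-ν) * T i ^ (-δ) := by ring
          _ ≤ c ^ (-ν) * T i ^ (-ν) * T i ^ (-δ) := by gcongr
          _ = _ := by rw [mul_assoc, ← Real.rpow_add hT0, neg_add]
    have hR0 : 0 ≤ R i ^ (-ν) * T i ^ (-δ) := by
      have := Real.rpow_nonneg (hR i) (-ν)
      positivity
    calc _ ≤ ∑ j ∈ s.filter (fun j => ¬ P j),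
            C₂ * (R i ^ (-ν) * T i ^ (-δ) * ((2 : ℝ) ^ (-((m - 1) * ν))) ^ j) :=
          Finset.sum_le_sum fun j hj => (h5 j hj).2.1
      _ = C₂ * ∑ j ∈ s.filter (fun j => ¬ P j),
            R i ^ (-ν) * T i ^ (-δ) * ((2 : ℝ) ^ (-((m - 1) * ν))) ^ j := by rw [Finset.mul_sum]
      _ ≤ C₂ * (C₄ * (c ^ (-ν) * T i ^ (-(ν + δ)))) :=
          mul_le_mul_of_nonneg_left (h₄ _ _ hR0 (by positivity) _ fun j hj => (h5 j hj).2.2) hC₂.le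
      _ = _ := by ring

end Summation

/-! ### The one-dimensional critical case. -/

section DimensionOne

variable {n : ℕ} {Φ : EuclideanSpace ℝ (Fin n) → ℝ} {φ : ℝ → ℝ}

/-- With `n = 1` the polar weight `r^{n-1}` is 1 and the sphere contributes only linear phases, so
van der Corput's test handles all low frequencies at once. -/
lemma exists_norm_localizedKernel_le_of_dim_one (i₀ : Fin n) (hn : n = 1) (hΦ : IsRadialCutoff Φ)
    (hφ : ContDiffOn ℝ ∞ φ (Ioi 0)) {d : ℝ} (hd : 0 < d)
    (h : ∀ r ∈ Ioc (0 : ℝ) 2, d ≤ |iteratedDeriv 2 φ r|) :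
    ∃ C : ℝ, 0 < C ∧ ∀ t : ℝ, 1 ≤ |t| → ∀ x, ‖localizedKernel φ Φ t x‖ ≤ C * |t| ^ (-(1 / 2) : ℝ) := by
  set A : ℝ → ℝ := fun r => Φ (EuclideanSpace.single i₀ r) with hA
  have hAd : ContDiff ℝ ∞ A := contDiff_comp_single hΦ.smooth i₀
  have hA1 : ∀ r, |A r| ≤ 1 := fun r => by
    rw [abs_of_nonneg (hΦ.mem_Icc _).1]
    exact (hΦ.mem_Icc _).2
  have hA'c : Continuous (deriv A) := hAd.continuous_deriv (by simp)
  obtain ⟨D, hD⟩ := isCompact_Icc.exists_bound_of_continuousOn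
    (hA'c.continuousOn (s := Icc (0 : ℝ) 2))
  have hD0 : 0 ≤ D := (norm_nonneg _).trans (hD 1 (by norm_num))
  set σ : ℝ := (sphereMeasure n).real univ
  have hσ : 0 ≤ σ := measureReal_nonneg
  set E : ℝ := (8 * 1 + 2 * D) / √d with hE
  have hE0 : 0 < E := by positivity
  refine ⟨E * σ + 1, by positivity, fun t ht x => ?_⟩
  have ht0 : 0 < |t| := one_pos.trans_le ht
  set f : ℝ → ℂ := fun r => Complex.exp (Complex.I * (t : ℂ) * (φ r : ℂ)) * (A r : ℂ) with hf
  have hfc : ContinuousOn f (Ioi 0) := by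
    refine ContinuousOn.mul ?_ (Complex.continuous_ofReal.comp hAd.continuous).continuousOn
    exact Complex.continuous_exp.comp_continuousOn
      (continuousOn_const.mul (Complex.continuous_ofReal.comp_continuousOn hφ.continuousOn))
  have hf1 : ∀ r, ‖f r‖ ≤ 1 := fun r => by
    rw [hf, norm_mul, norm_exp_I_mul_mul, one_mul, Complex.norm_real]
    exact hA1 r
  have hsub : Ioc (0 : ℝ) 2 ⊆ Ioi 0 := fun r hr => hr.1
  have hfi : ∀ v : ℝ, IntervalIntegrable (fun r => Complex.exp (Complex.I * ((v * r : ℝ) : ℂ)) * f r)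
      volume 0 2 := fun v => by
    rw [intervalIntegrable_iff_integrableOn_Ioc_of_le (by norm_num)]
    refine Integrable.of_bound (C := 1) ?_ (Filter.Eventually.of_forall fun r => ?_)
    · have h1 : Continuous fun r : ℝ => Complex.exp (Complex.I * ((v * r : ℝ) : ℂ)) := by fun_prop
      exact (h1.continuousOn.mul (hfc.mono hsub)).aestronglyMeasurable measurableSet_Ioc
    · rw [norm_mul, norm_exp_I_mul_ofReal, one_mul]
      exact hf1 r
  have hosc : ∀ v : ℝ, ‖∫ r in (0 : ℝ)..2, Complex.exp (Complex.I * ((v * r : ℝ) : ℂ)) * f r‖ ≤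
      E * |t| ^ (-(1 / 2) : ℝ) := by
    intro v
    refine le_of_forall_pos_le_add fun ε hε => ?_
    -- The phase need not be smooth at `0`: the interval is cut at `a`, and the omitted piece
    -- contributes at most `ε`.
    set a : ℝ := min ε 2 with ha
    have ha0 : 0 < a := lt_min hε (by norm_num)
    have ha2 : a ≤ 2 := min_le_right _ _
    have h0 : IntervalIntegrable (fun r => Complex.exp (Complex.I * ((v * r : ℝ) : ℂ)) * f r)
        volume 0 a := (hfi v).mono_set (by
          rw [uIcc_of_le ha0.le, uIcc_of_le (by norm_num)]; exact Icc_subset_Icc_right ha2)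
    have h2 : IntervalIntegrable (fun r => Complex.exp (Complex.I * ((v * r : ℝ) : ℂ)) * f r)
        volume a 2 := (hfi v).mono_set (by
          rw [uIcc_of_le ha2, uIcc_of_le (by norm_num)]; exact Icc_subset_Icc_left ha0.le)
    rw [← intervalIntegral.integral_add_adjacent_intervals h0 h2, add_comm]
    refine (norm_add_le _ _).trans (add_le_add ?_ ?_)
    · have hpos : ∀ r ∈ Icc a 2, 0 < r := fun r hr => ha0.trans_le hr.1
      have hφ' : ContDiffOn ℝ ∞ (deriv φ) (Ioi 0) :=
        hφ.deriv_of_isOpen isOpen_Ioi (by simp)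
      have h3 := norm_integral_exp_mul_le_of_le_abs_deriv2 (a := a) (b := 2) (μ := |t| * d) (M := 1)
        (M' := D) (p := fun r => v * r + t * φ r) (p' := fun r => v + t * deriv φ r)
        (p'' := fun r => t * iteratedDeriv 2 φ r) (A := fun r => (A r : ℂ))
        (A' := fun r => ((deriv A r : ℝ) : ℂ)) ha2 (by positivity)
        (fun r hr => ?_) (fun r hr => ?_) ?_ (fun r hr => ?_) ?_ (fun r hr => ?_) (fun r hr => ?_)
        (fun r hr => ?_)
      · have h4 : ∀ r, Complex.exp (Complex.I * ((v * r : ℝ) : ℂ)) * f r =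
            Complex.exp (Complex.I * ((v * r + t * φ r : ℝ) : ℂ)) * (A r : ℂ) := fun r => by
          rw [hf, ← mul_assoc, ← Complex.exp_add]
          congr 2
          push_cast
          ring
        simp only [h4]
        refine h3.trans ?_
        rw [Real.sqrt_mul ht0.le, hE, Real.rpow_neg ht0.le, ← Real.sqrt_eq_rpow, mul_comm (√|t|),
          ← div_div, div_eq_mul_inv _ (√|t|)]
        gcongr
        linarith
      · have h5 := (hφ.contDiffAt (Ioi_mem_nhds (hpos r hr))).differentiableAt (by simp)
        refine (((hasDerivAt_id r).const_mul v).add (h5.hasDerivAt.const_mul t)).congr_deriv ?_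
        rw [mul_one]
      · have h5 := ((hφ'.contDiffAt (Ioi_mem_nhds (hpos r hr))).differentiableAt (by simp)).hasDerivAt
        rw [iteratedDeriv_succ, iteratedDeriv_one]
        exact (h5.const_mul t).const_add v
      · exact continuousOn_const.mul ((continuousOn_iteratedDeriv_Ioi hφ 2).mono hpos)
      · exact ((hAd.differentiable (by simp)) r).hasDerivAt.ofReal_comp
      · exact (Complex.continuous_ofReal.comp hA'c).continuousOn
      · rw [Complex.norm_real]
        exact hA1 r
      · rw [Complex.norm_real]
        exact hD r ⟨(hpos r hr).le, hr.2⟩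
      · rw [abs_mul]
        exact mul_le_mul_of_nonneg_left (h r ⟨hpos r hr, hr.2⟩) ht0.le
    · refine (intervalIntegral.norm_integral_le_of_norm_le_const (C := 1) fun r _ => ?_).trans ?_
      · rw [norm_mul, norm_exp_I_mul_ofReal, one_mul]
        exact hf1 r
      · rw [sub_zero, abs_of_pos ha0, one_mul]
        exact min_le_left _ _
  have hrad : ∀ ξ : EuclideanSpace ℝ (Fin n), Φ ξ = A ‖ξ‖ := fun ξ =>
    hΦ.radial _ _ (by simp)
  have hK : localizedKernel φ Φ t x = ∫ r in (0 : ℝ)..2, f r * sphereMoment i₀ 0 (r * ‖x‖) := by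
    have h1 : localizedKernel φ Φ t x = ∫ ξ : EuclideanSpace ℝ (Fin n),
        Complex.exp (Complex.I * ((inner ℝ ξ x : ℝ) : ℂ)) * f ‖ξ‖ := by
      unfold localizedKernel
      simp only [hf, hrad]
    have h2 : Integrable fun ξ : EuclideanSpace ℝ (Fin n) => f ‖ξ‖ := by
      have := integrable_exp_radial_mul i₀ hφ.continuousOn t hΦ.smooth.continuous
        hΦ.hasCompactSupport
      simpa only [hf, ← hrad] using this
    rw [h1, integral_exp_inner_mul_radial i₀ h2, intervalIntegral.integral_of_le (by norm_num)]
    have h3 : ∀ r ∈ Ioi (0 : ℝ), ((r ^ (n - 1) : ℝ) : ℂ) * f r * sphereMoment i₀ 0 (r * ‖x‖) =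
        f r * sphereMoment i₀ 0 (r * ‖x‖) := fun r _ => by
      have h4 : n - 1 = 0 := by omega
      rw [h4, pow_zero, Complex.ofReal_one, one_mul]
    rw [setIntegral_congr_fun measurableSet_Ioi h3]
    refine setIntegral_eq_of_subset_of_forall_sdiff_eq_zero measurableSet_Ioi hsub fun r hr => ?_
    have h4 : 2 < r := by
      by_contra h5
      exact hr.2 ⟨hr.1, not_lt.1 h5⟩
    have h5 : A r = 0 := hΦ.eq_zero (by
      rw [PiLp.norm_single, Real.norm_of_nonneg (by linarith)]; exact h4)
    rw [hf]
    simp [h5]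
  have hf0 : IntervalIntegrable f volume 0 2 := by simpa using hfi 0
  rw [hK, intervalIntegral_mul_sphereMoment i₀ (by norm_num) hf0]
  have hp : 0 < |t| ^ (-(1 / 2) : ℝ) := by positivity
  calc _ ≤ E * |t| ^ (-(1 / 2) : ℝ) * σ :=
        norm_integral_le_of_norm_le_const (Filter.Eventually.of_forall fun η => hosc _)
    _ ≤ _ := by nlinarith

end DimensionOne

/-! ### Low-frequency decay: part (c). -/

section LowKernel

variable {n : ℕ} {Φ : EuclideanSpace ℝ (Fin n) → ℝ} {φ : ℝ → ℝ} {m δ : ℝ} {S : Set ℝ}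

/-- The parameter `δ` treats both estimates together: `0` without, `1/2` with second derivative
information. As the exponent of `φ''` is `m` itself, the lower bound `d` on the rescaled second
derivative does not depend on `k`. -/
lemma exists_localizedKernel_dyadic_dichotomy (i₀ : Fin n) (hΦ : IsRadialCutoff Φ)
    (hφ : ContDiffOn ℝ ∞ φ (Ioi 0)) (h : SymbolOrderOn φ m S)
    (hδ : δ = 0 ∨ δ = 1 / 2 ∧ SecondDerivOrderOn φ m S) :
    ∃ c : ℝ, 0 < c ∧ ∀ N : ℕ, ∃ C : ℝ, 0 < C ∧
      ∀ k : ℤ, (∀ r ∈ Icc (1 / 2 : ℝ) 2, (2 : ℝ) ^ k * r ∈ S) → ∀ t x, t ≠ 0 →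
      ‖localizedKernel φ (fun ξ => annular Φ (((2 : ℝ) ^ (-k)) • ξ)) t x‖ ≤
        C * (|t| ^ (-(N : ℝ)) * 2 ^ ((k : ℝ) * (n - m * N))) ∨
      (c * (|t| * 2 ^ ((k : ℝ) * m)) ≤ 2 ^ (k : ℝ) * ‖x‖ ∧
        ‖localizedKernel φ (fun ξ => annular Φ (((2 : ℝ) ^ (-k)) • ξ)) t x‖ ≤
          C * (2 ^ ((k : ℝ) * n) * ((2 ^ (k : ℝ) * ‖x‖) ^ (-(((n : ℝ) - 1) / 2)) *
            (|t| * 2 ^ ((k : ℝ) * m)) ^ (-δ)))) := by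
  obtain ⟨c, hg⟩ := isPhaseFamily_rescaledPhase hφ h
  refine ⟨c / 2, half_pos hg.pos, fun N => ?_⟩
  obtain ⟨C, hC, hC'⟩ := hg.radialOsc_dichotomy i₀ (contDiff_annularProfile hΦ i₀)
    (fun r => annularProfile_eq_zero hΦ i₀) N
  obtain ⟨E, hE, hE'⟩ : ∃ E : ℝ, 0 < E ∧
      ∀ k : {k : ℤ // ∀ r ∈ Icc (1 / 2 : ℝ) 2, (2 : ℝ) ^ k * r ∈ S}, ∀ Λ s : ℝ, Λ ≠ 0 → 0 ≤ s →
      ‖radialOsc i₀ (rescaledPhase φ m k) (annularProfile Φ i₀) Λ s‖ ≤ C * |Λ| ^ (-(N : ℝ)) ∨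
      (c / 2 * |Λ| ≤ s ∧ ‖radialOsc i₀ (rescaledPhase φ m k) (annularProfile Φ i₀) Λ s‖ ≤
        E * (s ^ (-(((n : ℝ) - 1) / 2)) * |Λ| ^ (-δ))) := by
    rcases hδ with rfl | ⟨rfl, h'⟩
    · refine ⟨C, hC, fun k Λ s hΛ hs => (hC' k Λ s hΛ hs).imp_right fun h1 => ⟨h1.2.1, ?_⟩⟩
      rw [neg_zero, Real.rpow_zero, mul_one]
      exact h1.2.2.1
    · obtain ⟨d, hd, hd'⟩ := exists_le_abs_iteratedDeriv_two_rescaledPhase (m := m) hφ h'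
      refine ⟨C * d ^ (-(1 / 2) : ℝ), by positivity, fun k Λ s hΛ hs =>
        (hC' k Λ s hΛ hs).imp_right fun h1 => ⟨h1.2.1, ?_⟩⟩
      refine (h1.2.2.2 d hd fun r hr => by simpa using hd' k r hr).trans (le_of_eq ?_)
      rw [Real.mul_rpow (abs_nonneg _) hd.le]
      ring
  refine ⟨max C E, lt_max_of_lt_left hC, fun k hk t x ht => ?_⟩
  have h2 : (0 : ℝ) < 2 ^ (m * k) := by positivity
  have h3 : |t * 2 ^ (m * k)| = |t| * 2 ^ ((k : ℝ) * m) := by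
    rw [abs_mul, abs_of_pos h2, mul_comm m]
  have h4 : ((2 : ℝ) ^ k) ^ n = 2 ^ ((k : ℝ) * n) := by
    rw [← Real.rpow_intCast, ← Real.rpow_natCast, ← Real.rpow_mul (by norm_num)]
  have h5 := hE' ⟨k, hk⟩ (t * 2 ^ (m * k)) (2 ^ k * ‖x‖) (mul_ne_zero ht h2.ne') (by positivity)
  rw [localizedKernel_dyadic i₀ hΦ hφ.continuousOn m, norm_mul, Complex.norm_real,
    Real.norm_of_nonneg (by positivity), h4]
  rw [h3] at h5
  rw [Real.rpow_intCast]
  refine h5.imp (fun h6 => ?_) (fun h6 => ⟨h6.1, ?_⟩)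
  · have h7 : (2 : ℝ) ^ ((k : ℝ) * (n - m * N)) =
        2 ^ ((k : ℝ) * n) * (2 ^ ((k : ℝ) * m)) ^ (-(N : ℝ)) := by
      rw [← Real.rpow_mul (by norm_num), ← Real.rpow_add (by norm_num)]
      congr 1
      ring
    calc _ ≤ (2 : ℝ) ^ ((k : ℝ) * n) * (C * (|t| * 2 ^ ((k : ℝ) * m)) ^ (-(N : ℝ))) := by gcongr
      _ = C * (|t| ^ (-(N : ℝ)) * 2 ^ ((k : ℝ) * (n - m * N))) := by
        rw [h7, Real.mul_rpow (abs_nonneg _) (by positivity)]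
        ring
      _ ≤ _ := by gcongr; exact le_max_left _ _
  · calc _ ≤ (2 : ℝ) ^ ((k : ℝ) * n) * (E * ((2 ^ k * ‖x‖) ^ (-(((n : ℝ) - 1) / 2)) *
          (|t| * 2 ^ ((k : ℝ) * m)) ^ (-δ))) := by gcongr; exact h6.2
      _ = E * (2 ^ ((k : ℝ) * n) * ((2 ^ k * ‖x‖) ^ (-(((n : ℝ) - 1) / 2)) *
          (|t| * 2 ^ ((k : ℝ) * m)) ^ (-δ))) := by ring
      _ ≤ _ := by gcongr; exact le_max_right _ _

lemma exists_norm_localizedKernel_low_le (i₀ : Fin n) (hΦ : IsRadialCutoff Φ)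
    (hφ : ContDiffOn ℝ ∞ φ (Ioi 0)) (hm : 0 < m) (h : SymbolOrderOn φ m (Ioc 0 2))
    (hδ : δ = 0 ∨ δ = 1 / 2 ∧ SecondDerivOrderOn φ m (Ioc 0 2)) :
    ∃ C : ℝ, 0 < C ∧ ∀ t : ℝ, 1 ≤ |t| → ∀ x,
      ‖localizedKernel φ Φ t x‖ ≤ C * |t| ^ (-(min ((n : ℝ) / m) (((n : ℝ) - 1) / 2 + δ))) := by
  have hn : (1 : ℝ) ≤ n := by exact_mod_cast Nat.one_le_of_lt i₀.2
  set ν : ℝ := ((n : ℝ) - 1) / 2 with hν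
  have hν0 : 0 ≤ ν := by rw [hν]; linarith
  have hk : ∀ j : ℕ, ∀ r ∈ Icc (1 / 2 : ℝ) 2, (2 : ℝ) ^ (-(j : ℤ)) * r ∈ Ioc (0 : ℝ) 2 := fun j => by
    simpa using shell_subset_Ioc (show -(j : ℤ) < 1 by omega)
  -- The summation lemmas are applied to the family indexed by `(t, x)`, for constants uniform in
  -- both.
  let ι := {p : ℝ × EuclideanSpace ℝ (Fin n) // 1 ≤ |p.1|}
  let F : ι → ℕ → ℝ := fun p j =>
    ‖localizedKernel φ (fun ξ => annular Φ (((2 : ℝ) ^ (-(-(j : ℤ)))) • ξ)) p.1.1 p.1.2‖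
  have ht0 : ∀ p : ι, p.1.1 ≠ 0 := fun p h0 => by
    have := p.2
    rw [h0, abs_zero] at this
    linarith
  have h₁ : ∃ C : ℝ, 0 < C ∧ ∀ p (j : ℕ), F p j ≤ C * 2 ^ (((-(j : ℤ) : ℤ) : ℝ) * (n : ℝ)) := by
    obtain ⟨C, hC, hC'⟩ := exists_norm_localizedKernel_dyadic_le i₀ hΦ hφ h
    refine ⟨C, hC, fun p j => ?_⟩
    simpa only [neg_zero, Real.rpow_zero, mul_zero, sub_zero, one_mul] using
      hC' (-(j : ℤ)) (hk j) 0 le_rfl hν0 p.1.1 p.1.2 (Or.inr rfl)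
  have h₂ : ∃ C : ℝ, 0 < C ∧ ∀ p (j : ℕ), F p j ≤
      C * (|p.1.1| ^ (-(ν + δ)) * 2 ^ (((-(j : ℤ) : ℤ) : ℝ) * (n - m * (ν + δ)))) := by
    rcases hδ with rfl | ⟨rfl, h'⟩
    · obtain ⟨C, hC, hC'⟩ := exists_norm_localizedKernel_dyadic_le i₀ hΦ hφ h
      refine ⟨C, hC, fun p j => ?_⟩
      rw [add_zero]
      exact hC' (-(j : ℤ)) (hk j) ν hν0 le_rfl p.1.1 p.1.2 (Or.inl (ht0 p))
    · obtain ⟨C, hC, hC'⟩ := exists_norm_localizedKernel_dyadic_le' i₀ hΦ hφ h h'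
      refine ⟨C, hC, fun p j => ?_⟩
      have h3 := hC' (-(j : ℤ)) (hk j) 1 zero_le_one le_rfl p.1.1 p.1.2 (Or.inl (ht0 p))
      have h4 : ((n : ℝ) - 1 + 1) / 2 = ν + 1 / 2 := by rw [hν]; ring
      have h5 : (n : ℝ) - m * ((n : ℝ) - 1 + 1) / 2 - 1 * (m - m) / 2 = n - m * (ν + 1 / 2) := by
        rw [hν]
        ring
      rwa [h4, h5] at h3
  suffices hsum : (∃ C : ℝ, 0 < C ∧ ∀ (p : ι) (s : Finset ℕ),
      ∑ j ∈ s, F p j ≤ C * |p.1.1| ^ (-(min ((n : ℝ) / m) (ν + δ)))) ∨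
      ∃ C : ℝ, 0 < C ∧ ∀ t : ℝ, 1 ≤ |t| → ∀ x,
        ‖localizedKernel φ Φ t x‖ ≤ C * |t| ^ (-(min ((n : ℝ) / m) (ν + δ))) by
    rcases hsum with ⟨C, hC, hC'⟩ | hsum
    · exact ⟨C, hC, fun t ht x => norm_localizedKernel_low_le i₀ hφ.continuousOn hΦ
        (hC' ⟨(t, x), ht⟩)⟩
    · exact hsum
  by_cases hend : m * (ν + δ) = n
  · have hmin : min ((n : ℝ) / m) (ν + δ) = ν + δ := by
      rw [← hend, mul_div_cancel_left₀ _ hm.ne', min_self]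
    rw [hmin]
    -- Critical exponent. If `ν = 0` then `n = 1`, which forces `δ = 1/2` and `m = 2`, so `|φ''|` is
    -- comparable to a constant on `(0, 2]`.
    rcases hν0.eq_or_lt with h0 | hνpos
    · right
      have hn1 : n = 1 := by
        have h3 : (n : ℝ) = 1 := by linarith
        exact_mod_cast h3
      rw [← h0, hn1, zero_add] at hend
      obtain ⟨rfl, h'⟩ := hδ.resolve_left fun h3 => by rw [h3] at hend; simp at hend
      have hm2 : m = 2 := by push_cast at hend; linarith
      obtain ⟨d, D, hd, -, h3⟩ := h'
      have h4 := exists_norm_localizedKernel_le_of_dim_one i₀ hn1 hΦ hφ hd fun r hr => by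
        have h5 := (h3 r hr).1
        rwa [hm2, sub_self, Real.rpow_zero, mul_one] at h5
      rwa [← h0, zero_add]
    · left
      -- With `m = 1` criticality would read `ν + δ = n`, whereas `ν + δ ≤ n/2`.
      have hm1 : m ≠ 1 := by
        rintro rfl
        rcases hδ with rfl | ⟨rfl, -⟩
        · linarith
        · linarith
      obtain ⟨c, hc, h3⟩ := exists_localizedKernel_dyadic_dichotomy i₀ hΦ hφ h hδ
      refine exists_sum_shell_le_of_dichotomy (T := fun p : ι => |p.1.1|)
        (R := fun p : ι => ‖p.1.2‖) (by linarith) hm hm1 hνpos hend hc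
        (fun p => p.2) (fun p => norm_nonneg _) h₁ fun N => ?_
      obtain ⟨C, hC, hC'⟩ := h3 N
      exact ⟨C, hC, fun p j => hC' (-(j : ℤ)) (hk j) p.1.1 p.1.2 (ht0 p)⟩
  · exact Or.inl (exists_sum_shell_le (by linarith) hm hend (fun p : ι => p.2) h₁ h₂)

lemma Ioc_zero_two_subset : Ioc (0 : ℝ) 2 ⊆ Ioo 0 1 ∪ Icc 1 2 := fun r hr => by
  rcases lt_or_ge r 1 with h | h
  · exact Or.inl ⟨hr.1, h⟩
  · exact Or.inr ⟨h, hr.2⟩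

lemma low_frequency_decay (i₀ : Fin n) (hΦ : IsRadialCutoff Φ) (hφ : ContDiffOn ℝ ∞ φ (Ioi 0))
    (hH : H2 φ m) (h0 : ∀ r ∈ Icc (1 : ℝ) 2, deriv φ r ≠ 0)
    (hδ : δ = 0 ∨ δ = 1 / 2 ∧ H4 φ m ∧ ∀ r ∈ Icc (1 : ℝ) 2, iteratedDeriv 2 φ r ≠ 0) :
    ∃ C : ℝ≥0, ∀ (t : ℝ) (u : EuclideanSpace ℝ (Fin n) → ℂ), Integrable u volume →
      eLpNorm (propagator φ t (lowProj Φ u)) ∞ volume ≤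
        (C : ℝ≥0∞) * (1 + ‖t‖ₑ) ^ (-(min ((n : ℝ) / m) (((n : ℝ) - 1) / 2 + δ))) *
          eLpNorm u 1 volume := by
  have hn : (1 : ℝ) ≤ n := by exact_mod_cast Nat.one_le_of_lt i₀.2
  have hm := hH.1
  have hsub : Ioo (0 : ℝ) 1 ⊆ Ioi 0 := fun r hr => hr.1
  refine exists_eLpNorm_propagator_lowProj_le i₀ hφ.continuousOn hΦ (le_min (by positivity) ?_)
    (exists_norm_localizedKernel_low_le i₀ hΦ hφ hm
      (SymbolOrderOn.mono (SymbolOrderOn.union_Icc hφ hH.2 hsub one_pos h0) Ioc_zero_two_subset)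
      (hδ.imp_right fun h => ⟨h.1, IsComparableOn.mono
        (SecondDerivOrderOn.union_Icc hφ h.2.1 hsub one_pos h.2.2) Ioc_zero_two_subset⟩))
  rcases hδ with rfl | ⟨rfl, -⟩ <;> linarith

end LowKernel

open DispersiveDecay in
theorem theorem1 (n : ℕ) (hn : 1 ≤ n) (φ : ℝ → ℝ) (hφ : ContDiffOn ℝ ∞ φ (Ioi 0))
    (Φ : EuclideanSpace ℝ (Fin n) → ℝ) (hΦ : IsRadialCutoff Φ) :
    -- (a), first estimate
    (∀ m₁ : ℝ, H1 φ m₁ →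
      ∃ C : ℝ≥0, ∀ k : ℤ, 0 ≤ k → (k = 0 → ∀ r ∈ Icc (1 / 2 : ℝ) 1, deriv φ r ≠ 0) →
        ∀ θ : ℝ, 0 ≤ θ → θ ≤ ((n : ℝ) - 1) / 2 →
        ∀ (t : ℝ) (u : EuclideanSpace ℝ (Fin n) → ℂ), Integrable u volume →
          eLpNorm (propagator φ t (dyadicProj Φ k u)) ∞ volume ≤
            (C : ℝ≥0∞) * ‖t‖ₑ ^ (-θ) * (2 : ℝ≥0∞) ^ ((k : ℝ) * ((n : ℝ) - m₁ * θ)) *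
              eLpNorm u 1 volume) ∧
    -- (a), improved estimate
    (∀ m₁ α₁ : ℝ, H1 φ m₁ → H3 φ α₁ →
      ∃ C : ℝ≥0, ∀ k : ℤ, 0 ≤ k →
        (k = 0 → ∀ r ∈ Icc (1 / 2 : ℝ) 1, deriv φ r ≠ 0 ∧ iteratedDeriv 2 φ r ≠ 0) →
        ∀ θ : ℝ, 0 ≤ θ → θ ≤ 1 →
        ∀ (t : ℝ) (u : EuclideanSpace ℝ (Fin n) → ℂ), Integrable u volume →
          eLpNorm (propagator φ t (dyadicProj Φ k u)) ∞ volume ≤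
            (C : ℝ≥0∞) * ‖t‖ₑ ^ (-(((n : ℝ) - 1 + θ) / 2)) *
              (2 : ℝ≥0∞) ^ ((k : ℝ) *
                ((n : ℝ) - m₁ * ((n : ℝ) - 1 + θ) / 2 - θ * (α₁ - m₁) / 2)) *
              eLpNorm u 1 volume) ∧
    -- (b), first estimate
    (∀ m₂ : ℝ, H2 φ m₂ →
      ∃ C : ℝ≥0, ∀ k : ℤ, k < 0 →
        ∀ θ : ℝ, 0 ≤ θ → θ ≤ ((n : ℝ) - 1) / 2 →
        ∀ (t : ℝ) (u : EuclideanSpace ℝ (Fin n) → ℂ), Integrable u volume →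
          eLpNorm (propagator φ t (dyadicProj Φ k u)) ∞ volume ≤
            (C : ℝ≥0∞) * ‖t‖ₑ ^ (-θ) * (2 : ℝ≥0∞) ^ ((k : ℝ) * ((n : ℝ) - m₂ * θ)) *
              eLpNorm u 1 volume) ∧
    -- (b), improved estimate
    (∀ m₂ α₂ : ℝ, H2 φ m₂ → H4 φ α₂ →
      ∃ C : ℝ≥0, ∀ k : ℤ, k < 0 →
        ∀ θ : ℝ, 0 ≤ θ → θ ≤ 1 →
        ∀ (t : ℝ) (u : EuclideanSpace ℝ (Fin n) → ℂ), Integrable u volume →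
          eLpNorm (propagator φ t (dyadicProj Φ k u)) ∞ volume ≤
            (C : ℝ≥0∞) * ‖t‖ₑ ^ (-(((n : ℝ) - 1 + θ) / 2)) *
              (2 : ℝ≥0∞) ^ ((k : ℝ) *
                ((n : ℝ) - m₂ * ((n : ℝ) - 1 + θ) / 2 - θ * (α₂ - m₂) / 2)) *
              eLpNorm u 1 volume) ∧
    -- (c), first estimate
    (∀ m₂ : ℝ, H2 φ m₂ → (∀ r ∈ Icc (1 : ℝ) 2, deriv φ r ≠ 0) →
      ∃ C : ℝ≥0, ∀ (t : ℝ) (u : EuclideanSpace ℝ (Fin n) → ℂ), Integrable u volume →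
          eLpNorm (propagator φ t (lowProj Φ u)) ∞ volume ≤
            (C : ℝ≥0∞) * (1 + ‖t‖ₑ) ^ (-(min ((n : ℝ) / m₂) (((n : ℝ) - 1) / 2))) *
              eLpNorm u 1 volume) ∧
    -- (c), improved estimate
    (∀ m₂ α₂ : ℝ, H2 φ m₂ → H4 φ α₂ → α₂ = m₂ →
      (∀ r ∈ Icc (1 : ℝ) 2, deriv φ r ≠ 0 ∧ iteratedDeriv 2 φ r ≠ 0) →
      ∃ C : ℝ≥0, ∀ (t : ℝ) (u : EuclideanSpace ℝ (Fin n) → ℂ), Integrable u volume →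
          eLpNorm (propagator φ t (lowProj Φ u)) ∞ volume ≤
            (C : ℝ≥0∞) * (1 + ‖t‖ₑ) ^ (-(min ((n : ℝ) / m₂) ((n : ℝ) / 2))) *
              eLpNorm u 1 volume) := by
  have i₀ : Fin n := ⟨0, hn⟩
  refine ⟨fun m₁ hH => high_frequency_decay i₀ hΦ hφ hH,
    fun m₁ α₁ hH hH3 => high_frequency_decay' i₀ hΦ hφ hH hH3,
    fun m₂ hH => low_shell_decay i₀ hΦ hφ hH,
    fun m₂ α₂ hH hH4 => low_shell_decay' i₀ hΦ hφ hH hH4,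
    fun m₂ hH h0 => ?_, fun m₂ α₂ hH hH4 hα h0 => ?_⟩
  · simpa only [add_zero] using low_frequency_decay (δ := 0) i₀ hΦ hφ hH h0 (Or.inl rfl)
  · subst hα
    have h1 : ((n : ℝ) - 1) / 2 + 1 / 2 = n / 2 := by ring
    rw [← h1]
    exact low_frequency_decay i₀ hΦ hφ hH (fun r hr => (h0 r hr).1)
      (Or.inr ⟨rfl, hH4, fun r hr => (h0 r hr).2⟩)
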